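/- There are absolute constants $c, C$ such that for every fixed integer $k \ge 0$ there is an algorithm which, given a finite simple undirected graph $G$ on $n$ vertices and $k$ pairs of vertices $(s_1,t_1),\dots,(s_k,t_k)$ of $G$, decides in at most $C\cdot\max(n,2)^{c\,k^{5^k}}$ steps, that is, in time $n^{O(k^{5^k})}$, whether there exist $k$ paths $P_1,\dots,P_k$ in $G$ such that each $P_i$ is a shortest path from $s_i$ to $t_i$ and the $P_i$ are pairwise internally vertex-disjoint (for $i\ne j$, no vertex of $P_i$ other than its ends $s_i,t_i$ lies on $P_j$). Here an algorithm is a program for a unit-cost random access machine with addition and truncated subtraction, which receives $n$, the adjacency matrix of $G$ and the pairs in its memory; the program may depend on $k$. -/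

import Mathlib

/-! ### The combinatorial problem -/

namespace SimpleGraph.Walk

/-- A walk is a shortest path if it is a path whose length (number of edges) is the distance
of its two ends. (A walk from `u` to `v` exists only if `u` and `v` lie in one component.) -/
def IsShortestPath {V : Type*} {G : SimpleGraph V} {u v : V} (p : G.Walk u v) : Prop :=
  p.IsPath ∧ p.length = G.dist u v

/-- The internal vertices of a path: its vertices other than its two ends. -/
def internalVertices {V : Type*} {G : SimpleGraph V} {u v : V} (p : G.Walk u v) : Set V :=
  {x | x ∈ p.support ∧ x ≠ u ∧ x ≠ v}

/-- Two paths are internally vertex-disjoint if neither contains an internal vertex of the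
other one, that is, all their common vertices are ends of both. -/
def InternallyDisjoint {V : Type*} {G : SimpleGraph V} {u v u' v' : V}
    (p : G.Walk u v) (q : G.Walk u' v') : Prop :=
  (∀ x ∈ p.internalVertices, x ∉ q.support) ∧ (∀ x ∈ q.internalVertices, x ∉ p.support)

end SimpleGraph.Walk

/-- There are pairwise internally vertex-disjoint paths `P i`, `i : Fin k`, such that each `P i`
is a shortest path from `s i` to `t i`. -/
def HasDisjointShortestPaths {V : Type*} (G : SimpleGraph V) {k : ℕ} (s t : Fin k → V) : Prop :=
  ∃ P : (i : Fin k) → G.Walk (s i) (t i),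
    (∀ i, (P i).IsShortestPath) ∧ ∀ i j, i ≠ j → (P i).InternallyDisjoint (P j)

/-! ### The machine model

A unit-cost random access machine with addition and truncated subtraction (no multiplication,
so that it is polynomially equivalent to Turing machines), programmed in structured form. -/

namespace RAM

/-- A memory state: registers, addressed by the constants in the program, and a memory, addressed
indirectly through the registers. All cells hold natural numbers. -/
structure State where
  reg : ℕ → ℕ
  mem : ℕ → ℕ

/-- Programs: finite syntactic objects. -/
inductive Prog where
  | skip : Prog
  /-- `r := a` for a constant `a` -/
  | const (r a : ℕ) : Prog
  /-- `r := x + y` on registers -/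
  | add (r x y : ℕ) : Prog
  /-- `r := x - y` on registers (truncated at zero) -/
  | sub (r x y : ℕ) : Prog
  /-- `r := mem[x]` -/
  | load (r x : ℕ) : Prog
  /-- `mem[x] := y` -/
  | store (x y : ℕ) : Prog
  | seq (p q : Prog) : Prog
  /-- if register `r` is nonzero then `p` else `q` -/
  | cond (r : ℕ) (p q : Prog) : Prog
  /-- while register `r` is nonzero do `p` -/
  | loop (r : ℕ) (p : Prog) : Prog

/-- The state with register `r` set to `a`. -/
def State.setReg (σ : State) (r a : ℕ) : State := { σ with reg := Function.update σ.reg r a }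

/-- The state with memory cell `i` set to `a`. -/
def State.setMem (σ : State) (i a : ℕ) : State := { σ with mem := Function.update σ.mem i a }

/-- `Exec p σ T τ`: the program `p`, started in the state `σ`, halts in the state `τ` after exactly
`T` steps. Every elementary instruction and every evaluation of a test is one step. -/
inductive Exec : Prog → State → ℕ → State → Prop
  | skip (σ : State) : Exec .skip σ 1 σ
  | const (σ : State) (r a : ℕ) : Exec (.const r a) σ 1 (σ.setReg r a)
  | add (σ : State) (r x y : ℕ) : Exec (.add r x y) σ 1 (σ.setReg r (σ.reg x + σ.reg y))
  | sub (σ : State) (r x y : ℕ) : Exec (.sub r x y) σ 1 (σ.setReg r (σ.reg x - σ.reg y))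
  | load (σ : State) (r x : ℕ) : Exec (.load r x) σ 1 (σ.setReg r (σ.mem (σ.reg x)))
  | store (σ : State) (x y : ℕ) : Exec (.store x y) σ 1 (σ.setMem (σ.reg x) (σ.reg y))
  | seq {p q : Prog} {σ τ ρ : State} {T U : ℕ} (hp : Exec p σ T τ) (hq : Exec q τ U ρ) :
      Exec (.seq p q) σ (T + U) ρ
  | cond_true {r : ℕ} {p q : Prog} {σ τ : State} {T : ℕ} (hr : σ.reg r ≠ 0)
      (hp : Exec p σ T τ) : Exec (.cond r p q) σ (T + 1) τ
  | cond_false {r : ℕ} {p q : Prog} {σ τ : State} {T : ℕ} (hr : σ.reg r = 0)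
      (hq : Exec q σ T τ) : Exec (.cond r p q) σ (T + 1) τ
  | loop_true {r : ℕ} {p : Prog} {σ τ ρ : State} {T U : ℕ} (hr : σ.reg r ≠ 0)
      (hp : Exec p σ T τ) (hl : Exec (.loop r p) τ U ρ) : Exec (.loop r p) σ (T + U + 1) ρ
  | loop_false {r : ℕ} {p : Prog} {σ : State} (hr : σ.reg r = 0) : Exec (.loop r p) σ 1 σ

/-- The machine is deterministic: the running time and the final state are unique. -/
theorem Exec.unique {p : Prog} {σ τ τ' : State} {T T' : ℕ} (h : Exec p σ T τ)
    (h' : Exec p σ T' τ') : T = T' ∧ τ = τ' := by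
  induction h generalizing T' τ' with
  | seq _ _ ih₁ ih₂ =>
    cases h' with
    | seq h₁ h₂ =>
      obtain ⟨rfl, rfl⟩ := ih₁ h₁
      obtain ⟨rfl, rfl⟩ := ih₂ h₂
      exact ⟨rfl, rfl⟩
  | cond_true hr _ ih =>
    cases h' with
    | cond_true _ h₁ => obtain ⟨rfl, rfl⟩ := ih h₁; exact ⟨rfl, rfl⟩
    | cond_false hr' _ => exact absurd hr' hr
  | cond_false hr _ ih =>
    cases h' with
    | cond_true hr' _ => exact absurd hr hr'
    | cond_false _ h₁ => obtain ⟨rfl, rfl⟩ := ih h₁; exact ⟨rfl, rfl⟩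
  | loop_true hr _ _ ih₁ ih₂ =>
    cases h' with
    | loop_true _ h₁ h₂ =>
      obtain ⟨rfl, rfl⟩ := ih₁ h₁
      obtain ⟨rfl, rfl⟩ := ih₂ h₂
      exact ⟨rfl, rfl⟩
    | loop_false hr' => exact absurd hr' hr
  | loop_false hr =>
    cases h' with
    | loop_true hr' _ _ => exact absurd hr hr'
    | loop_false _ => exact ⟨rfl, rfl⟩
  | _ => cases h'; exact ⟨rfl, rfl⟩

open Classical in
/-- The initial state for a graph `G` on the vertices `0, …, n - 1` and the pairs `(s i, t i)`.
Register `0` holds `n`. The memory holds, from address `0` on, the adjacency matrix of `G` row by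
row (the entry of `u, v` is at address `u * n + v`), then `s 0, …, s (k - 1)`, then
`t 0, …, t (k - 1)`. All other cells are `0`. -/
noncomputable def inputState {n k : ℕ} (G : SimpleGraph (Fin n)) (s t : Fin k → Fin n) : State where
  reg r := if r = 0 then n else 0
  mem a :=
    if h : a < n * n then
      if G.Adj (Fin.divNat ⟨a, h⟩) (Fin.modNat ⟨a, h⟩) then 1 else 0
    else if h : a - n * n < k then (s ⟨a - n * n, h⟩ : ℕ)
    else if h : a - n * n - k < k then (t ⟨a - n * n - k, h⟩ : ℕ)
    else 0

end RAM

/-! A solution can be cut into a number of segments that depends on `k` only, and disjointness of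
the segments can then be checked by a search that remembers just one current vertex per segment.

Cutting. For two geodesics `p i`, `p j` of a solution, plot a vertex `w` at the point with
coordinates `D (s i) w + D (s j) w` and `D (s i) w - D (s j) w`. Along `p i` both coordinates
increase; along `p j` the first increases and the second decreases. By `exists_crossing` some point
`(U, W)` has `p i` in two opposite quadrants and `p j` in the other two. If a segment of each stays
in one quadrant, a vertex on geodesics between the ends of both lies on an axis through `(U, W)`, so
its distances from `s i` and `s j` satisfy one of finitely many relations of slope `1` or `-1`.
Composing such relations along chains of indices gives at most `(4 * k + 1) ^ k` relations for each
`i`, and the places where one of them holds form an interval of `p i`. Cutting at the ends of these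
intervals makes the set of indices related to `i` constant on each long segment. A representative of
this set is the colour of the segment. Conflicting segments have equal colours, and the distance
from the terminal of that colour changes by one at every step of the segment
(`exists_segmentation`).

Token game. Each segment is traversed by a token from one end to the other, in the direction in
which the distance from the terminal of its colour grows. A token may enter a vertex only if no
other token can have visited it on a geodesic from its start to its present position. This test
needs no history, and it forces disjoint trails (`Reach.exists_walks`). Conversely the tokens of a
solution can be moved in the order of their distances from the terminals of their colours, since
conflicts occur only within a colour and respect that order (`reach_of_potential`).

Algorithm. Reachable configurations are a least fixed point in a table with `n ^ (3 * k * M)`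
entries for `M = segCount k`. A small language of expressions and loops is compiled to the machine,
with running time at most `max n 2` to a syntactic weight. This weight is quadratic in the number of
tokens and marks, that is `k ^ O(k)`, well below `k ^ 5 ^ k`. -/

namespace DisjointShortestPaths

/-! ### Monotone sequences in the plane -/

theorem exists_separator (A B : Finset ℤ) (h : ∀ a ∈ A, ∀ b ∈ B, a ≤ b) :
    ∃ V, (∀ a ∈ A, a ≤ V) ∧ ∀ b ∈ B, V ≤ b := by
  by_cases hA : A.Nonempty
  · exact ⟨A.max' hA, fun a ha => A.le_max' a ha, fun b hb => A.max'_le hA b fun a ha => h a ha b hb⟩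
  · rw [Finset.not_nonempty_iff_eq_empty] at hA
    subst hA
    by_cases hB : B.Nonempty
    · exact ⟨B.min' hB, by simp, fun b hb => B.min'_le b hb⟩
    · rw [Finset.not_nonempty_iff_eq_empty] at hB
      subst hB
      exact ⟨0, by simp, by simp⟩

/-- An increasing and a decreasing finite sequence of points of the plane cross: some point
`(U, V)` has the increasing sequence in its south-west and north-east quadrants and the
decreasing one in its north-west and south-east quadrants. -/
theorem exists_crossing (L L' : ℕ) (u v u' v' : ℕ → ℤ)
    (hv : ∀ x y, x ≤ y → y ≤ L → v x ≤ v y) (hu : ∀ x y, x ≤ y → y ≤ L → u x ≤ u y)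
    (hv' : ∀ x y, x ≤ y → y ≤ L' → v' y ≤ v' x) (hu' : ∀ x y, x ≤ y → y ≤ L' → u' x ≤ u' y) :
    ∃ U V, (∀ x ≤ L, (u x ≤ U ∧ v x ≤ V) ∨ (U ≤ u x ∧ V ≤ v x)) ∧
      ∀ y ≤ L', (u' y ≤ U ∧ V ≤ v' y) ∨ (U ≤ u' y ∧ v' y ≤ V) := by
  -- A strict inequality of first coordinates determines the order of the indices.
  have hv2 : ∀ x y, x ≤ L → y ≤ L → u x < u y → v x ≤ v y := by
    intro x y hx hy hlt
    refine hv x y ?_ hy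
    by_contra hcon
    exact absurd (hu y x (by omega) hx) (by omega)
  have hv2' : ∀ x y, x ≤ L' → y ≤ L' → u' x < u' y → v' y ≤ v' x := by
    intro x y hx hy hlt
    refine hv' x y ?_ hy
    by_contra hcon
    exact absurd (hu' y x (by omega) hx) (by omega)
  -- If the increasing sequence stays below the decreasing one, a crossing point to the right of
  -- everything works.
  by_cases hne : ∀ x ≤ L, ∀ y ≤ L', v x < v' y
  · obtain ⟨U, hU, -⟩ := exists_separator
      ((Finset.range (L + 1)).image u ∪ (Finset.range (L' + 1)).image u') ∅ (by simp)
    obtain ⟨V, hV, hV'⟩ := exists_separator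
      ((Finset.range (L + 1)).image v) ((Finset.range (L' + 1)).image v') (by
        intro a ha b hb
        simp only [Finset.mem_image, Finset.mem_range] at ha hb
        obtain ⟨x, hx, rfl⟩ := ha
        obtain ⟨y, hy, rfl⟩ := hb
        exact (hne x (by omega) y (by omega)).le)
    refine ⟨U, V, fun x hx => Or.inl ⟨hU _ ?_, hV _ ?_⟩, fun y hy => Or.inl ⟨hU _ ?_, hV' _ ?_⟩⟩
    · exact Finset.mem_union_left _ (Finset.mem_image_of_mem _ (Finset.mem_range.2 (by omega)))
    · exact Finset.mem_image_of_mem _ (Finset.mem_range.2 (by omega))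
    · exact Finset.mem_union_right _ (Finset.mem_image_of_mem _ (Finset.mem_range.2 (by omega)))
    · exact Finset.mem_image_of_mem _ (Finset.mem_range.2 (by omega))
  · push Not at hne
    obtain ⟨x1, hx1, y1, hy1, h1⟩ := hne
    -- `U` is the first abscissa by which the decreasing sequence has come down to the level of the
    -- increasing one.
    obtain ⟨⟨x0, y0⟩, hmem, hmin⟩ := Finset.exists_min_image
      ((Finset.range (L + 1) ×ˢ Finset.range (L' + 1)).filter fun q => v' q.2 ≤ v q.1)
      (fun q => max (u q.1) (u' q.2)) ⟨(x1, y1), by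
        simp only [Finset.mem_filter, Finset.mem_product, Finset.mem_range]
        exact ⟨⟨by omega, by omega⟩, h1⟩⟩
    simp only [Finset.mem_filter, Finset.mem_product, Finset.mem_range, Prod.forall] at hmem hmin
    obtain ⟨⟨hx0, hy0⟩, h0⟩ := hmem
    have hlow : ∀ x ≤ L, ∀ y ≤ L', u x < max (u x0) (u' y0) → u' y < max (u x0) (u' y0) →
        v x < v' y := by
      intro x hx y hy h2 h3
      by_contra hcon
      exact absurd (hmin x y ⟨⟨by omega, by omega⟩, by omega⟩) (by omega)
    -- `V` is to be above the increasing points left of `U` and the decreasing ones right of it, and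
    -- below the rest. Points with abscissa exactly `U` impose no condition, as they lie in closed
    -- quadrants on both sides.
    obtain ⟨V, hV, hV'⟩ := exists_separator
      (((Finset.range (L + 1)).filter fun x => u x < max (u x0) (u' y0)).image v ∪
        ((Finset.range (L' + 1)).filter fun y => max (u x0) (u' y0) < u' y).image v')
      (((Finset.range (L + 1)).filter fun x => max (u x0) (u' y0) < u x).image v ∪
        ((Finset.range (L' + 1)).filter fun y => u' y < max (u x0) (u' y0)).image v') (by
        intro a ha b hb
        simp only [Finset.mem_union, Finset.mem_image, Finset.mem_filter, Finset.mem_range]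
          at ha hb
        obtain ⟨x, ⟨hx, hx'⟩, rfl⟩ | ⟨y, ⟨hy, hy'⟩, rfl⟩ := ha <;>
          obtain ⟨x2, ⟨hx2, hx2'⟩, rfl⟩ | ⟨y2, ⟨hy2, hy2'⟩, rfl⟩ := hb
        · exact hv2 _ _ (by omega) (by omega) (by omega)
        · exact (hlow _ (by omega) _ (by omega) hx' hy2').le
        · have := hv2' y0 y (by omega) (by omega) (by omega)
          have := hv2 x0 x2 (by omega) (by omega) (by omega)
          omega
        · exact hv2' _ _ (by omega) (by omega) (by omega))
    simp only [Finset.mem_union, Finset.mem_image, Finset.mem_filter, Finset.mem_range] at hV hV'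
    refine ⟨max (u x0) (u' y0), V, fun x hx => ?_, fun y hy => ?_⟩
    · rcases lt_trichotomy (u x) (max (u x0) (u' y0)) with h | h | h
      · exact Or.inl ⟨h.le, hV _ (Or.inl ⟨x, ⟨by omega, h⟩, rfl⟩)⟩
      · rcases le_total (v x) V with h2 | h2
        · exact Or.inl ⟨h.le, h2⟩
        · exact Or.inr ⟨h.ge, h2⟩
      · exact Or.inr ⟨h.le, hV' _ (Or.inl ⟨x, ⟨by omega, h⟩, rfl⟩)⟩
    · rcases lt_trichotomy (u' y) (max (u x0) (u' y0)) with h | h | h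
      · exact Or.inl ⟨h.le, hV' _ (Or.inr ⟨y, ⟨by omega, h⟩, rfl⟩)⟩
      · rcases le_total (v' y) V with h2 | h2
        · exact Or.inr ⟨h.ge, h2⟩
        · exact Or.inl ⟨h.le, h2⟩
      · exact Or.inr ⟨h.le, hV _ (Or.inr ⟨y, ⟨by omega, h⟩, rfl⟩)⟩

/-- The interval `[0, L]` can be cut into `2 * F + 2` pieces such that a monotone function with
values in `[0, F]` takes the same value at both ends of every piece of length at least two. -/
theorem exists_marks (h : ℕ → ℕ) (L F : ℕ) (hmono : ∀ x y, x ≤ y → y ≤ L → h x ≤ h y)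
    (hF : h L ≤ F) :
    ∃ m : ℕ → ℕ, m 0 = 0 ∧ m (2 * F + 2) = L ∧ Monotone m ∧ (∀ r, m r ≤ L) ∧
      ∀ r, m (r + 1) ≤ m r + 1 ∨ h (m r) = h (m (r + 1)) := by
  -- `f v` is the first place where `h` reaches the value `v`, with default `L`.
  set f : ℕ → ℕ := fun v => sInf {x | v ≤ h x ∨ L ≤ x} with hf
  have hne : ∀ v, {x | v ≤ h x ∨ L ≤ x}.Nonempty := fun v => ⟨L, Or.inr le_rfl⟩
  have hmem : ∀ v, v ≤ h (f v) ∨ L ≤ f v := fun v => Nat.sInf_mem (hne v)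
  have hle : ∀ v, f v ≤ L := fun v => Nat.sInf_le (Or.inr le_rfl)
  have hlt : ∀ v x, x < f v → h x < v := by
    intro v x hx
    have := Nat.notMem_of_lt_sInf hx
    simp only [Set.mem_ofPred_eq, not_or] at this
    omega
  have hfm : ∀ v, f v ≤ f (v + 1) := by
    intro v
    refine Nat.sInf_le ?_
    rcases hmem (v + 1) with h1 | h1
    · exact Or.inl (by omega)
    · exact Or.inr h1
  have hf0 : f 0 = 0 := Nat.le_zero.1 (Nat.sInf_le (Or.inl (Nat.zero_le _)))
  have hfF : f (F + 1) = L := by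
    refine le_antisymm (hle _) ?_
    rcases hmem (F + 1) with h1 | h1
    · have := hmono _ L (hle (F + 1)) le_rfl
      omega
    · exact h1
  -- Even marks are the jump places `f v`, odd marks the last place before the next jump. Between `f
  -- v` and `f (v + 1) - 1` the value is constant, and the remaining pieces have length at most one;
  -- the `max` covers empty levels. There are `F + 1` levels with two pieces each.
  refine ⟨fun r => if r % 2 = 0 then f (r / 2) else max (f (r / 2)) (f (r / 2 + 1) - 1),
    by simpa using hf0, ?_, ?_, ?_, ?_⟩
  · have h1 : (2 * F + 2) % 2 = 0 := by omega
    have h2 : (2 * F + 2) / 2 = F + 1 := by omega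
    simp only [h1, h2, if_true, hfF]
  · refine monotone_nat_of_le_succ fun r => ?_
    rcases Nat.mod_two_eq_zero_or_one r with h1 | h1
    · have h2 : (r + 1) % 2 = 1 := by omega
      have h3 : (r + 1) / 2 = r / 2 := by omega
      simp [h1, h2, h3]
    · have h2 : (r + 1) % 2 = 0 := by omega
      have h3 : (r + 1) / 2 = r / 2 + 1 := by omega
      have := hfm (r / 2)
      simp [h1, h2, h3]
      omega
  · intro r
    have := hle (r / 2)
    have := hle (r / 2 + 1)
    dsimp only
    split_ifs <;> omega
  · intro r
    have hstep := hfm (r / 2)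
    rcases Nat.mod_two_eq_zero_or_one r with h1 | h1
    · have h2 : (r + 1) % 2 = 1 := by omega
      have h3 : (r + 1) / 2 = r / 2 := by omega
      simp only [h1, h2, h3, if_true, one_ne_zero, if_false]
      rcases Nat.lt_or_ge (f (r / 2)) (f (r / 2 + 1)) with h4 | h4
      · right
        rw [max_eq_right (by omega)]
        have h5 := hlt (r / 2 + 1) (f (r / 2 + 1) - 1) (by omega)
        have h6 := hmono (f (r / 2)) (f (r / 2 + 1) - 1) (by omega)
          (by have := hle (r / 2 + 1); omega)
        have h7 := hle (r / 2 + 1)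
        rcases hmem (r / 2) with h8 | h8 <;> omega
      · left
        omega
    · have h2 : (r + 1) % 2 = 0 := by omega
      have h3 : (r + 1) / 2 = r / 2 + 1 := by omega
      simp only [h1, h2, h3, if_true, one_ne_zero, if_false]
      left
      omega

/-! ### Natural-number valued metrics -/

/-- Total natural-valued distances spare a separate treatment of disconnected vertices; the instance
in use is `capDist`. -/
structure IsNatMetric {V : Type*} (D : V → V → ℕ) : Prop where
  self : ∀ u, D u u = 0
  eq_of : ∀ {u v}, D u v = 0 → u = v
  symm : ∀ u v, D u v = D v u
  tri : ∀ u v w, D u w ≤ D u v + D v w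

/-- `w` lies on a geodesic from `a` to `b`. -/
def Between {V : Type*} (D : V → V → ℕ) (a w b : V) : Prop := D a w + D w b = D a b

/-- The affine relation `e = (l, ε, c)`, which says that `D (s l) w = ε * D (s i) w + c`, holds
if and only if this function vanishes (for `ε = 1` and `ε = -1`). -/
def deviation {V : Type*} {k : ℕ} (D : V → V → ℕ) (s : Fin k → V) (i : Fin k) (e : Fin k × ℤ × ℤ)
    (w : V) : ℤ :=
  D (s i) w - e.2.1 * D (s e.1) w + e.2.1 * e.2.2

/-- The four affine relations between the `i`-th and the `j`-th coordinate that are given by a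
crossing point for every ordered pair. -/
def pairRels {k : ℕ} (U W : Fin k → Fin k → ℤ) (i j : Fin k) : Finset (ℤ × ℤ) :=
  {(-1, U i j), (1, -W i j), (-1, U j i), (1, W j i)}

/-- The relations obtained by composing at most `r` of the pair relations, beginning at `i`. -/
def chainRels {k : ℕ} (U W : Fin k → Fin k → ℤ) (i : Fin k) : ℕ → Finset (Fin k × ℤ × ℤ)
  | 0 => {(i, 1, 0)}
  | r + 1 => chainRels U W i r ∪ (chainRels U W i r).biUnion fun e =>
      Finset.univ.biUnion fun l' => (pairRels U W e.1 l').image fun q =>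
        (l', q.1 * e.2.1, q.1 * e.2.2 + q.2)

/-- Each relation is kept or prolonged by one of four pair relations to one of `k` indices, which
gives a factor `4 * k + 1`. -/
theorem card_chainRels_le {k : ℕ} (U W : Fin k → Fin k → ℤ) (i : Fin k) (r : ℕ) :
    (chainRels U W i r).card ≤ (4 * k + 1) ^ r := by
  induction r with
  | zero => simp [chainRels]
  | succ r ih =>
    have h1 : ∀ e ∈ chainRels U W i r, (Finset.univ.biUnion fun l' : Fin k =>
        (pairRels U W e.1 l').image fun q : ℤ × ℤ =>
          ((l', q.1 * e.2.1, q.1 * e.2.2 + q.2) : Fin k × ℤ × ℤ)).card ≤ 4 * k := by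
      intro e _
      refine (Finset.card_biUnion_le_card_mul _ _ 4 fun l' _ => ?_).trans (by simp [mul_comm])
      exact Finset.card_image_le.trans Finset.card_le_four
    calc _ ≤ (chainRels U W i r).card + (chainRels U W i r).card * (4 * k) :=
          (Finset.card_union_le _ _).trans
            (Nat.add_le_add_left (Finset.card_biUnion_le_card_mul _ _ _ h1) _)
      _ = (chainRels U W i r).card * (4 * k + 1) := by ring
      _ ≤ _ := by rw [pow_succ]; exact Nat.mul_le_mul_right _ ih

theorem sign_of_mem_pairRels {k : ℕ} {U W : Fin k → Fin k → ℤ} {i j : Fin k} {q : ℤ × ℤ}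
    (h : q ∈ pairRels U W i j) : q.1 = 1 ∨ q.1 = -1 := by
  simp only [pairRels, Finset.mem_insert, Finset.mem_singleton] at h
  rcases h with rfl | rfl | rfl | rfl <;> simp

theorem sign_of_mem_chainRels {k : ℕ} {U W : Fin k → Fin k → ℤ} {i : Fin k} {r : ℕ}
    {e : Fin k × ℤ × ℤ} (h : e ∈ chainRels U W i r) : e.2.1 = 1 ∨ e.2.1 = -1 := by
  induction r generalizing e with
  | zero =>
    simp only [chainRels, Finset.mem_singleton] at h
    simp [h]
  | succ r ih =>
    simp only [chainRels, Finset.mem_union, Finset.mem_biUnion, Finset.mem_image,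
      Finset.mem_univ, true_and] at h
    rcases h with h | ⟨e', he', l', q, hq, rfl⟩
    · exact ih h
    · rcases ih he' with h1 | h1 <;> rcases sign_of_mem_pairRels hq with h2 | h2 <;>
        simp [h1, h2]

theorem chainRels_mono {k : ℕ} {U W : Fin k → Fin k → ℤ} {i : Fin k} {r r' : ℕ} (h : r ≤ r') :
    chainRels U W i r ⊆ chainRels U W i r' := by
  induction r', h using Nat.le_induction with
  | base => exact subset_rfl
  | succ r' _ ih => exact ih.trans Finset.subset_union_left

theorem deviation_eq_zero_iff {V : Type*} {k : ℕ} {D : V → V → ℕ} {s : Fin k → V} {i l : Fin k}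
    {ε c : ℤ} (hε : ε = 1 ∨ ε = -1) {w : V} :
    deviation D s i (l, ε, c) w = 0 ↔ (D (s l) w : ℤ) = ε * D (s i) w + c := by
  rcases hε with rfl | rfl <;> simp only [deviation] <;> constructor <;> intro h <;> linarith

/-- The graph on the paths in which two paths are joined if one of their pair relations holds
at the vertex `w`. -/
def relGraph {V : Type*} {k : ℕ} (D : V → V → ℕ) (s : Fin k → V) (U W : Fin k → Fin k → ℤ)
    (w : V) : SimpleGraph (Fin k) where
  Adj i j := i ≠ j ∧ ∃ q ∈ pairRels U W i j, (D (s j) w : ℤ) = q.1 * D (s i) w + q.2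
  symm := ⟨by
    rintro i j ⟨hne, q, hq, h⟩
    -- This is the inverse of an affine map of slope `1` or `-1`; `pairRels` is closed under
    -- inversion when the two indices are exchanged.
    refine ⟨hne.symm, (q.1, -q.1 * q.2), ?_, ?_⟩
    · simp only [pairRels, Finset.mem_insert, Finset.mem_singleton] at hq ⊢
      rcases hq with rfl | rfl | rfl | rfl <;> simp
    · rcases sign_of_mem_pairRels hq with h1 | h1 <;> rw [h1] at h <;> simp only [h1] <;>
        linarith⟩
  loopless := ⟨fun i h => h.1 rfl⟩

/-- A relation between coordinates that holds along a chain of pair relations at `w` is one of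
the composed relations. -/
theorem exists_chainRel_of_walk {V : Type*} {k : ℕ} {D : V → V → ℕ} {s : Fin k → V}
    {U W : Fin k → Fin k → ℤ} {w w' : V} {i : Fin k}
    (hww : ∀ e ∈ chainRels U W i k, deviation D s i e w = 0 → deviation D s i e w' = 0)
    {l : Fin k} (h : (relGraph D s U W w).Reachable i l) :
    (∃ ε c, (l, ε, c) ∈ chainRels U W i k ∧ deviation D s i (l, ε, c) w = 0) ∧
      (relGraph D s U W w').Reachable i l := by
  classical
  obtain ⟨q⟩ := h
  obtain ⟨q, hq⟩ := q.toPath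
  -- Chains may be taken to be paths in a graph on `k` vertices, so `k` compositions suffice.
  have hlen : q.length ≤ k := by
    have := hq.length_lt
    simp only [Fintype.card_fin] at this
    exact this.le
  have key : ∀ r ≤ q.length, (∃ ε c, (q.getVert r, ε, c) ∈ chainRels U W i r ∧
      deviation D s i (q.getVert r, ε, c) w = 0) ∧
      (relGraph D s U W w').Reachable i (q.getVert r) := by
    intro r
    induction r with
    | zero =>
      intro _
      refine ⟨⟨1, 0, by simp [chainRels], by simp [deviation]⟩, by simp⟩
    | succ r ih =>
      intro hr
      obtain ⟨⟨ε, c, hmem, hdev⟩, hreach⟩ := ih (by omega)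
      obtain ⟨hne, ⟨ε', c'⟩, hq', hrel⟩ := q.adj_getVert_succ (i := r) (by omega)
      have hmem' : (q.getVert (r + 1), ε' * ε, ε' * c + c') ∈ chainRels U W i (r + 1) := by
        simp only [chainRels, Finset.mem_union, Finset.mem_biUnion, Finset.mem_image,
          Finset.mem_univ, true_and]
        exact Or.inr ⟨_, hmem, _, _, hq', rfl⟩
      have hs := sign_of_mem_chainRels hmem
      have hs2 := sign_of_mem_chainRels hmem'
      have hdev' : deviation D s i (q.getVert (r + 1), ε' * ε, ε' * c + c') w = 0 := by
        rw [deviation_eq_zero_iff hs] at hdev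
        rw [deviation_eq_zero_iff hs2, hrel, hdev]
        ring
      refine ⟨⟨_, _, hmem', hdev'⟩, hreach.trans (SimpleGraph.Adj.reachable ?_)⟩
      -- Two consecutive composed relations are transported to `w'`; together they give back the
      -- single pair relation there, hence the edge at `w'`.
      have h1 := hww _ (chainRels_mono (by omega) hmem) hdev
      have h2 := hww _ (chainRels_mono (by omega) hmem') hdev'
      rw [deviation_eq_zero_iff hs] at h1
      rw [deviation_eq_zero_iff hs2] at h2
      refine ⟨hne, _, hq', ?_⟩
      simp only
      rw [h1, h2]
      ring
  have := key q.length le_rfl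
  rw [q.getVert_length] at this
  obtain ⟨⟨ε, c, hmem, hdev⟩, hreach⟩ := this
  exact ⟨⟨ε, c, chainRels_mono hlen hmem, hdev⟩, hreach⟩

end DisjointShortestPaths

/-! ### Cutting geodesics into coloured segments -/

namespace DisjointShortestPaths

-- The number of true properties is a monotone function to which `exists_marks` applies. If this
-- number agrees at two places, every single property does, by monotonicity.
open Classical in
theorem exists_marks_family (𝓠 : Finset (ℕ → Prop)) (L F : ℕ) (hcard : 𝓠.card ≤ F)
    (hmono : ∀ Q ∈ 𝓠, ∀ x y, x ≤ y → y ≤ L → Q x → Q y) :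
    ∃ m : ℕ → ℕ, m 0 = 0 ∧ m (2 * F + 2) = L ∧ Monotone m ∧ (∀ r, m r ≤ L) ∧
      ∀ r, m (r + 1) ≤ m r + 1 ∨ ∀ Q ∈ 𝓠, Q (m r) ↔ Q (m (r + 1)) := by
  have hle : ∀ Q ∈ 𝓠, ∀ x y, x ≤ y → y ≤ L → (if Q x then 1 else 0) ≤ if Q y then 1 else 0 := by
    intro Q hQ x y hxy hy
    have := hmono Q hQ x y hxy hy
    split_ifs <;> simp_all
  obtain ⟨m, h0, hL, hm, hmL, hstep⟩ := exists_marks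
    (fun x => ∑ Q ∈ 𝓠, if Q x then 1 else 0) L F
    (fun x y hxy hy => Finset.sum_le_sum fun Q hQ => hle Q hQ x y hxy hy)
    ((Finset.sum_le_card_nsmul _ _ 1 fun Q _ => by split_ifs <;> simp).trans (by simpa using hcard))
  refine ⟨m, h0, hL, hm, hmL, fun r => (hstep r).imp_right fun heq Q hQ => ?_⟩
  have h1 := (Finset.sum_eq_sum_iff_of_le fun Q hQ =>
    hle Q hQ (m r) (m (r + 1)) (hm (Nat.le_succ r)) (hmL _)).1 heq Q hQ
  split_ifs at h1 <;> simp_all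

/-- If `a` is on a geodesic from `s` to `b`, then a geodesic from `s` to `a` can be continued by any
geodesic from `a` to `b`, not only by the given path. This is why conflicts may be formulated with
`Between`. -/
theorem Between.dist_left {V : Type*} {D : V → V → ℕ} (hD : IsNatMetric D) {s a w b : V}
    (h : Between D a w b) (hb : D s b = D s a + D a b) : D s w = D s a + D a w := by
  have h1 := hD.tri s a w
  have h2 := hD.tri s w b
  unfold Between at h
  omega

theorem Between.dist_right {V : Type*} {D : V → V → ℕ} (hD : IsNatMetric D) {s a w b : V}
    (h : Between D a w b) (hb : D s b = D s a + D a b) : D s b = D s w + D w b := by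
  have := h.dist_left hD hb
  unfold Between at h
  omega

/-- Moving away from `s i` along a geodesic raises the first distance by the full step, while the
other distance changes by at most that much. -/
theorem deviation_le {V : Type*} {D : V → V → ℕ} (hD : IsNatMetric D) {k : ℕ} {s : Fin k → V}
    {i : Fin k} {e : Fin k × ℤ × ℤ} (he : e.2.1 = 1 ∨ e.2.1 = -1) {a w : V}
    (h : D (s i) w = D (s i) a + D a w) : deviation D s i e a ≤ deviation D s i e w := by
  have h1 := hD.tri (s e.1) a w
  have h2 := hD.tri (s e.1) w a
  rw [hD.symm w a] at h2
  rcases he with he | he <;> simp only [deviation, he, h] <;> push_cast <;> omega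

/-- The number of pieces into which each of `k` disjoint shortest paths is cut. -/
def segCount (k : ℕ) : ℕ := 2 * (2 * (4 * k + 1) ^ k + 2 * k) + 2

open Classical in
/-- Geodesics `p i` starting in `s i` can be cut into boundedly many segments, and every segment
be given a colour `l`, such that every segment is monotone with respect to the distance from
`s l`, and segments with different colours never conflict. -/
theorem exists_segmentation {V : Type*} {D : V → V → ℕ} (hD : IsNatMetric D) {k : ℕ}
    (s : Fin k → V) (p : Fin k → ℕ → V) (L : Fin k → ℕ) (hp0 : ∀ i, p i 0 = s i)
    (hp : ∀ i x y, x ≤ y → y ≤ L i → D (p i x) (p i y) = y - x) :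
    ∃ (m : Fin k → ℕ → ℕ) (c : Fin k → ℕ → Fin k),
      (∀ i, m i 0 = 0 ∧ m i (segCount k) = L i ∧ Monotone (m i) ∧ ∀ r, m i r ≤ L i) ∧
      (∀ i r, D (s (c i r)) (p i (m i (r + 1))) =
          D (s (c i r)) (p i (m i r)) + (m i (r + 1) - m i r) ∨
        D (s (c i r)) (p i (m i r)) =
          D (s (c i r)) (p i (m i (r + 1))) + (m i (r + 1) - m i r)) ∧
      ∀ i j, i ≠ j → ∀ r r' w, Between D (p i (m i r)) w (p i (m i (r + 1))) →
        Between D (p j (m j r')) w (p j (m j (r' + 1))) →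
        w ≠ p i (m i r) → w ≠ p i (m i (r + 1)) → w ≠ p j (m j r') → w ≠ p j (m j (r' + 1)) →
        c i r = c j r' := by
  have hps : ∀ i x, x ≤ L i → D (s i) (p i x) = x := fun i x hx => by
    rw [← hp0 i, hp i 0 x (Nat.zero_le _) hx, Nat.sub_zero]
  have hpst : ∀ i x y, x ≤ y → y ≤ L i →
      D (s i) (p i y) = D (s i) (p i x) + D (p i x) (p i y) := fun i x y hxy hy => by
    rw [hp i x y hxy hy, hps i x (hxy.trans hy), hps i y hy]
    omega
  have hmono : ∀ i j a w, D (s i) w = D (s i) a + D a w →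
      D (s i) a + D (s j) a ≤ D (s i) w + D (s j) w ∧
        (D (s i) a : ℤ) - D (s j) a ≤ D (s i) w - D (s j) w := by
    intro i j a w h
    have h1 := hD.tri (s j) a w
    have h2 := hD.tri (s j) w a
    rw [hD.symm w a] at h2
    omega
  -- The crossing is taken in the coordinates sum and difference of the distances from `s i` and `s
  -- j`.
  have hcross : ∀ i j, ∃ U W : ℤ,
      (∀ x ≤ L i, ((D (s i) (p i x) + D (s j) (p i x) : ℤ) ≤ U ∧
          (D (s i) (p i x) - D (s j) (p i x) : ℤ) ≤ W) ∨
        (U ≤ (D (s i) (p i x) + D (s j) (p i x) : ℤ) ∧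
          W ≤ (D (s i) (p i x) - D (s j) (p i x) : ℤ))) ∧
      ∀ y ≤ L j, ((D (s i) (p j y) + D (s j) (p j y) : ℤ) ≤ U ∧
          W ≤ (D (s i) (p j y) - D (s j) (p j y) : ℤ)) ∨
        (U ≤ (D (s i) (p j y) + D (s j) (p j y) : ℤ) ∧
          (D (s i) (p j y) - D (s j) (p j y) : ℤ) ≤ W) := by
    intro i j
    refine exists_crossing (L i) (L j) (fun x => D (s i) (p i x) + D (s j) (p i x))
      (fun x => D (s i) (p i x) - D (s j) (p i x)) (fun x => D (s i) (p j x) + D (s j) (p j x))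
      (fun x => D (s i) (p j x) - D (s j) (p j x)) ?_ ?_ ?_ ?_
    · exact fun x y hxy hy => (hmono i j _ _ (hpst i x y hxy hy)).2
    · intro x y hxy hy
      have := (hmono i j _ _ (hpst i x y hxy hy)).1
      omega
    · intro x y hxy hy
      have := (hmono j i _ _ (hpst j x y hxy hy)).2
      omega
    · intro x y hxy hy
      have := (hmono j i _ _ (hpst j x y hxy hy)).1
      omega
  choose U W hU1 hU2 using hcross
  -- The vanishing of a deviation is recorded by two monotone thresholds, `0` and `1`; the last two
  -- families record when the path leaves its first quadrant, for every pair in either role. This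
  -- makes `2 * (4 * k + 1) ^ k + 2 * k` properties at most, whence `segCount`.
  set 𝓠 : Fin k → Finset (ℕ → Prop) := fun i =>
    ((chainRels U W i k).image (fun e x => 0 ≤ deviation D s i e (p i x)) ∪
      (chainRels U W i k).image (fun e x => 1 ≤ deviation D s i e (p i x))) ∪
    (Finset.univ.image (fun j x => ¬ ((D (s i) (p i x) + D (s j) (p i x) : ℤ) ≤ U i j ∧
          (D (s i) (p i x) - D (s j) (p i x) : ℤ) ≤ W i j)) ∪
      Finset.univ.image (fun j x => ¬ ((D (s j) (p i x) + D (s i) (p i x) : ℤ) ≤ U j i ∧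
          W j i ≤ (D (s j) (p i x) - D (s i) (p i x) : ℤ)))) with h𝓠
  have hex : ∀ i, ∃ m : ℕ → ℕ, m 0 = 0 ∧ m (segCount k) = L i ∧ Monotone m ∧ (∀ r, m r ≤ L i) ∧
      ∀ r, m (r + 1) ≤ m r + 1 ∨ ∀ Q ∈ 𝓠 i, Q (m r) ↔ Q (m (r + 1)) := by
    intro i
    refine exists_marks_family (𝓠 i) (L i) _ ?_ ?_
    · have h1 := card_chainRels_le U W i k
      refine (Finset.card_union_le _ _).trans ((Nat.add_le_add (Finset.card_union_le _ _)
        (Finset.card_union_le _ _)).trans ((Nat.add_le_add (Nat.add_le_add Finset.card_image_le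
        Finset.card_image_le) (Nat.add_le_add Finset.card_image_le Finset.card_image_le)).trans ?_))
      simp only [Finset.card_univ, Fintype.card_fin]
      omega
    · intro Q hQ x y hxy hy
      simp only [h𝓠, Finset.mem_union, Finset.mem_image, Finset.mem_univ, true_and] at hQ
      have hxy' := hpst i x y hxy hy
      rcases hQ with (⟨e, he, rfl⟩ | ⟨e, he, rfl⟩) | (⟨j, rfl⟩ | ⟨j, rfl⟩)
      · have := deviation_le hD (sign_of_mem_chainRels he) hxy'
        intro h
        omega
      · have := deviation_le hD (sign_of_mem_chainRels he) hxy'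
        intro h
        omega
      · have := hmono i j _ _ hxy'
        intro h
        omega
      · have := hmono i j _ _ hxy'
        intro h
        omega
  choose m hm0 hmL hmm hmle hstep using hex
  set K : Fin k → V → Set (Fin k) := fun i w => {l | (relGraph D s U W w).Reachable i l} with hK
  have hKi : ∀ i w, i ∈ K i w := fun i w => SimpleGraph.Reachable.refl i
  -- The choice of a representative depends on the component only, so indices with equal components
  -- get equal colours.
  obtain ⟨ch, hch⟩ : ∃ ch : Set (Fin k) → Fin k → Fin k, ∀ A i j, i ∈ A → j ∈ A →
      ch A i ∈ A ∧ ch A i = ch A j :=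
    ⟨fun A i => if h : A.Nonempty then h.some else i, fun A i j hi hj => by
      have h : A.Nonempty := ⟨i, hi⟩
      simp only [h, dif_pos]
      exact ⟨h.some_mem, trivial⟩⟩
  -- A deviation is monotone from one end of the piece through `w` to the other end. If it vanishes
  -- at `w`, its sign at the ends and the equal thresholds force it to vanish at both ends, hence
  -- everywhere between them.
  have hdev : ∀ i r, (∀ Q ∈ 𝓠 i, Q (m i r) ↔ Q (m i (r + 1))) → ∀ e ∈ chainRels U W i k,
      ∀ w w', Between D (p i (m i r)) w (p i (m i (r + 1))) →
        Between D (p i (m i r)) w' (p i (m i (r + 1))) → deviation D s i e w = 0 →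
          deviation D s i e w' = 0 := by
    intro i r hQ e he w w' hw hw' h0
    have hb := hpst i _ _ (hmm i (Nat.le_succ r)) (hmle i _)
    have hs := sign_of_mem_chainRels he
    have h1 := deviation_le hD hs (hw.dist_left hD hb)
    have h2 := deviation_le hD hs (hw.dist_right hD hb)
    have h3 := deviation_le hD hs (hw'.dist_left hD hb)
    have h4 := deviation_le hD hs (hw'.dist_right hD hb)
    have h5 := hQ _ (Finset.mem_union_left _ (Finset.mem_union_left _
      (Finset.mem_image_of_mem _ he)))
    have h6 := hQ _ (Finset.mem_union_left _ (Finset.mem_union_right _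
      (Finset.mem_image_of_mem _ he)))
    simp only [Nat.succ_eq_add_one] at *
    omega
  have hbl : ∀ i r, Between D (p i (m i r)) (p i (m i r)) (p i (m i (r + 1))) := fun i r => by
    simp [Between, hD.self]
  have hbr : ∀ i r, Between D (p i (m i r)) (p i (m i (r + 1))) (p i (m i (r + 1))) :=
    fun i r => by simp [Between, hD.self]
  have hKeq : ∀ i r, (∀ Q ∈ 𝓠 i, Q (m i r) ↔ Q (m i (r + 1))) → ∀ w,
      Between D (p i (m i r)) w (p i (m i (r + 1))) → K i w = K i (p i (m i r)) := by
    intro i r hQ w hw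
    refine Set.Subset.antisymm (fun l hl => ?_) (fun l hl => ?_)
    · exact (exists_chainRel_of_walk (fun e he => hdev i r hQ e he _ _ hw (hbl i r)) hl).2
    · exact (exists_chainRel_of_walk (fun e he => hdev i r hQ e he _ _ (hbl i r) hw) hl).2
  -- Pieces of length at most one have no vertex strictly between their ends and cannot conflict, so
  -- they may keep their own index as colour.
  refine ⟨m, fun i r => if m i (r + 1) ≤ m i r + 1 then i else ch (K i (p i (m i r))) i,
    fun i => ⟨hm0 i, hmL i, hmm i, hmle i⟩, fun i r => ?_, ?_⟩
  · have hb := hpst i _ _ (hmm i (Nat.le_succ r)) (hmle i _)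
    rw [hp i _ _ (hmm i (Nat.le_succ r)) (hmle i _)] at hb
    beta_reduce
    split_ifs with hshort
    · exact Or.inl hb
    · have hQ := (hstep i r).resolve_left hshort
      obtain ⟨⟨ε, c, he, h0⟩, -⟩ := exists_chainRel_of_walk (w' := p i (m i (r + 1)))
        (fun e he => hdev i r hQ e he _ _ (hbl i r) (hbr i r))
        (hch _ i i (hKi i (p i (m i r))) (hKi _ _)).1
      have h1 := hdev i r hQ _ he _ _ (hbl i r) (hbr i r) h0
      have hs := sign_of_mem_chainRels he
      rw [deviation_eq_zero_iff hs] at h0 h1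
      -- The relation to the colour holds at both ends, so the two distances grow together (slope
      -- `1`) or oppositely (slope `-1`).
      rcases hs with hs | hs <;> simp only at hs <;> subst hs <;>
        simp only [Nat.succ_eq_add_one] at * <;> omega
  · intro i j hij r r' w hw hw' h1 h2 h3 h4
    have hlong : ∀ i r, Between D (p i (m i r)) w (p i (m i (r + 1))) → w ≠ p i (m i r) →
        w ≠ p i (m i (r + 1)) → ¬ m i (r + 1) ≤ m i r + 1 := by
      intro i r hw h1 h2 hle
      have h3 : D (p i (m i r)) w ≠ 0 := fun h => h1 (hD.eq_of h).symm
      have h4 : D w (p i (m i (r + 1))) ≠ 0 := fun h => h2 (hD.eq_of h)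
      unfold Between at hw
      rw [hp i _ _ (hmm i (Nat.le_succ r)) (hmle i _)] at hw
      simp only [Nat.succ_eq_add_one] at *
      omega
    beta_reduce
    rw [if_neg (hlong i r hw h1 h2), if_neg (hlong j r' hw' h3 h4)]
    have hQ := (hstep i r).resolve_left (hlong i r hw h1 h2)
    have hQ' := (hstep j r').resolve_left (hlong j r' hw' h3 h4)
    have hKK : K i w = K j w := by
      have hadj : (relGraph D s U W w).Adj i j := by
        have hb := hpst i _ _ (hmm i (Nat.le_succ r)) (hmle i _)
        have hb' := hpst j _ _ (hmm j (Nat.le_succ r')) (hmle j _)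
        have e1 := hmono i j _ _ (hw.dist_left hD hb)
        have e2 := hmono i j _ _ (hw.dist_right hD hb)
        have e3 := hmono j i _ _ (hw'.dist_left hD hb')
        have e4 := hmono j i _ _ (hw'.dist_right hD hb')
        have q1 := hQ _ (Finset.mem_union_right _ (Finset.mem_union_left _
          (Finset.mem_image_of_mem _ (Finset.mem_univ j))))
        have q2 := hQ' _ (Finset.mem_union_right _ (Finset.mem_union_right _
          (Finset.mem_image_of_mem _ (Finset.mem_univ i))))
        have x1 := hU1 i j _ (hmle i r)
        have x2 := hU1 i j _ (hmle i (r + 1))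
        have y1 := hU2 i j _ (hmle j r')
        have y2 := hU2 i j _ (hmle j (r' + 1))
        simp only [Nat.succ_eq_add_one] at *
        -- By monotonicity `w` stays in the closed quadrant of each of the two pieces. A south-west
        -- or north-east quadrant meets a north-west or south-east one only on an axis.
        have : (D (s i) w + D (s j) w : ℤ) = U i j ∨ (D (s i) w - D (s j) w : ℤ) = W i j := by
          clear hQ hQ' hstep h𝓠 hdev hKeq
          omega
        refine ⟨hij, ?_⟩
        rcases this with h | h
        · exact ⟨(-1, U i j), by simp [pairRels], by simp only; omega⟩
        · exact ⟨(1, -W i j), by simp [pairRels], by simp only; omega⟩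
      refine Set.Subset.antisymm (fun l hl => ?_) (fun l hl => ?_)
      · exact hadj.symm.reachable.trans hl
      · exact hadj.reachable.trans hl
    rw [← hKeq i r hQ w hw, ← hKeq j r' hQ' w hw', ← hKK]
    exact (hch _ i j (hKi i w) (by rw [hKK]; exact hKi j w)).2

end DisjointShortestPaths

namespace DisjointShortestPaths

/-! ### The token game -/

variable {V ι : Type*}

/-- In the configuration `v`, the token `σ`, which travels from `a σ` to `b σ`, may move to `x`. -/
def Legal (G : SimpleGraph V) (D : V → V → ℕ) (a b v : ι → V) (σ : ι) (x : V) : Prop :=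
  G.Adj (v σ) x ∧ D x (b σ) + 1 = D (v σ) (b σ) ∧
    (x = b σ ∨ ∀ τ, x ≠ a τ ∧ x ≠ b τ ∧ (τ ≠ σ → ¬ Between D (a τ) x (v τ)))

/-- The configurations that can be reached if all tokens `σ` start in `a σ`. -/
inductive Reach [DecidableEq ι] (G : SimpleGraph V) (D : V → V → ℕ) (a b : ι → V) : (ι → V) → Prop
  | start : Reach G D a b a
  | step {v : ι → V} (σ : ι) (x : V) (hv : Reach G D a b v) (hx : Legal G D a b v σ x) :
      Reach G D a b (Function.update v σ x)

theorem Between.of_mem_support {G : SimpleGraph V} {D : V → V → ℕ} (hD : IsNatMetric D)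
    (hwalk : ∀ u v (p : G.Walk u v), D u v ≤ p.length) {u v x : V} (p : G.Walk u v)
    (hp : p.length ≤ D u v) (hx : x ∈ p.support) : Between D u x v := by
  classical
  have h1 := hwalk _ _ (p.takeUntil x hx)
  have h2 := hwalk _ _ (p.dropUntil x hx)
  have h3 := congrArg SimpleGraph.Walk.length (p.take_spec hx)
  rw [SimpleGraph.Walk.length_append] at h3
  have h4 := hD.tri u x v
  unfold Between
  omega

/-- The trails are geodesic prefixes, so all their vertices are `Between` start and position, and
the rule for moves protects them. A trail never meets the end of another token unless this is one of
its own ends; hence two trails can share only common ends. -/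
theorem Reach.exists_walks [DecidableEq ι] {G : SimpleGraph V} {D : V → V → ℕ} (hD : IsNatMetric D)
    (hwalk : ∀ u v (p : G.Walk u v), D u v ≤ p.length) {a b v : ι → V} (h : Reach G D a b v) :
    ∃ W : ∀ σ, G.Walk (a σ) (v σ), (∀ σ, (W σ).length + D (v σ) (b σ) = D (a σ) (b σ)) ∧
      (∀ σ, ∀ x ∈ (W σ).support, ∀ τ, x = a τ ∨ x = b τ → x = a σ ∨ x = b σ) ∧
      ∀ σ τ, σ ≠ τ → ∀ x ∈ (W σ).support, x ∈ (W τ).support → ∃ ρ, x = a ρ ∨ x = b ρ := by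
  induction h with
  | start =>
    refine ⟨fun σ => .nil, fun σ => by simp, fun σ x hx _ _ => ?_, fun σ τ _ x hx _ => ⟨σ, ?_⟩⟩
    · simp only [SimpleGraph.Walk.support_nil, List.mem_singleton] at hx
      exact Or.inl hx
    · simp only [SimpleGraph.Walk.support_nil, List.mem_singleton] at hx
      exact Or.inl hx
  | @step v σ x hv hx ih =>
    obtain ⟨W, hW, hends, hdisj⟩ := ih
    obtain ⟨hadj, hdec, hok⟩ := hx
    have key : ∀ ρ, ∃ q : G.Walk (a ρ) (Function.update v σ x ρ),
        q.length + D (Function.update v σ x ρ) (b ρ) = D (a ρ) (b ρ) ∧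
          ∀ z ∈ q.support, z ∈ (W ρ).support ∨ (ρ = σ ∧ z = x) := by
      intro ρ
      by_cases hρ : ρ = σ
      · subst hρ
        rw [Function.update_self]
        refine ⟨(W ρ).concat hadj, ?_, ?_⟩
        · rw [SimpleGraph.Walk.length_concat]
          have := hW ρ
          omega
        · intro z hz
          rw [SimpleGraph.Walk.support_concat, List.mem_append, List.mem_singleton] at hz
          exact hz.imp_right fun h => ⟨rfl, h⟩
      · rw [Function.update_of_ne hρ]
        exact ⟨W ρ, hW ρ, fun z hz => Or.inl hz⟩
    -- Only the last move of a token, into its end, can touch another trail.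
    have hclash : ∀ τ, τ ≠ σ → x ∈ (W τ).support → x = b σ := by
      intro τ hτ hmem
      rcases hok with h | h
      · exact h
      · refine absurd (Between.of_mem_support hD hwalk (W τ) ?_ hmem) ((h τ).2.2 hτ)
        have h1 := hW τ
        have h2 := hD.tri (a τ) (v τ) (b τ)
        omega
    choose W' hlen hsupp using key
    refine ⟨W', hlen, fun ρ z hz τ hzτ => ?_, fun ρ τ hne z hz hz' => ?_⟩
    · rcases hsupp ρ z hz with h | ⟨rfl, rfl⟩
      · exact hends ρ z h τ hzτ
      · rcases hok with h | h
        · exact Or.inr h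
        · exact absurd hzτ (by simp [(h τ).1, (h τ).2.1])
    · rcases hsupp ρ z hz with h | ⟨h1, h2⟩ <;> rcases hsupp τ z hz' with h' | ⟨h1', h2'⟩
      · exact hdisj ρ τ hne z h h'
      · subst h1' h2'
        exact ⟨_, Or.inr (hclash ρ hne h)⟩
      · subst h1 h2
        exact ⟨_, Or.inr (hclash τ hne.symm h')⟩
      · exact absurd (h1.trans h1'.symm) hne

/-- Tokens that travel along given paths can be moved one after another, in the order of a
potential, if all their conflicts respect this potential. -/
theorem reach_of_potential [Fintype ι] [DecidableEq ι] {G : SimpleGraph V} {D : V → V → ℕ} (hD : IsNatMetric D)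
    (y : ι → ℕ → V) (L κ : ι → ℕ) (hadj : ∀ σ x, x < L σ → G.Adj (y σ x) (y σ (x + 1)))
    (hgeo : ∀ σ x, x ≤ L σ → D (y σ x) (y σ (L σ)) = L σ - x)
    (hend : ∀ σ x, 0 < x → x < L σ → ∀ τ, y σ x ≠ y τ 0 ∧ y σ x ≠ y τ (L τ))
    (hconf : ∀ σ τ, τ ≠ σ → ∀ x x', 0 < x → x < L σ → x' ≤ L τ →
      Between D (y τ 0) (y σ x) (y τ x') → κ σ + x < κ τ + x') :
    Reach G D (fun σ => y σ 0) (fun σ => y σ (L σ)) (fun σ => y σ (L σ)) := by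
  -- The induction is on the number of remaining moves. The invariant says that no token has been
  -- moved to a potential beyond the next potential of an unfinished one.
  suffices h : ∀ N (p : ι → ℕ), ∑ σ, (L σ - p σ) = N → (∀ σ, p σ ≤ L σ) →
      (∀ τ σ, 0 < p τ → p σ < L σ → κ τ + p τ ≤ κ σ + (p σ + 1)) →
      Reach G D (fun σ => y σ 0) (fun σ => y σ (L σ)) (fun σ => y σ (p σ)) →
      Reach G D (fun σ => y σ 0) (fun σ => y σ (L σ)) (fun σ => y σ (L σ)) from
    h _ (fun _ => 0) rfl (fun _ => Nat.zero_le _) (fun τ σ h => absurd h (lt_irrefl 0)) .start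
  intro N
  induction N with
  | zero =>
    intro p hsum hp _ hreach
    have : (fun σ => y σ (p σ)) = fun σ => y σ (L σ) := by
      funext σ
      rw [Finset.sum_eq_zero_iff] at hsum
      have h1 := hsum σ (Finset.mem_univ σ)
      have h2 := hp σ
      congr 1
      omega
    rwa [this] at hreach
  | succ N ih =>
    intro p hsum hp hinv hreach
    -- The next token to move is an unfinished one with least potential after its move.
    obtain ⟨σ, hσ, hmin⟩ := Finset.exists_min_image (Finset.univ.filter fun σ => p σ < L σ)
      (fun σ => κ σ + (p σ + 1)) (by
        by_contra hcon
        rw [Finset.not_nonempty_iff_eq_empty, Finset.filter_eq_empty_iff] at hcon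
        rw [Finset.sum_eq_zero fun σ _ => by have := hcon (Finset.mem_univ σ); omega] at hsum
        omega)
    simp only [Finset.mem_filter, Finset.mem_univ, true_and] at hσ hmin
    refine ih (Function.update p σ (p σ + 1)) ?_ ?_ ?_ ?_
    · have h1 : ∑ τ, (L τ - p τ) = ∑ τ, (L τ - Function.update p σ (p σ + 1) τ) + 1 := by
        rw [← Finset.add_sum_erase _ _ (Finset.mem_univ σ),
          ← Finset.add_sum_erase _ (fun τ => L τ - Function.update p σ (p σ + 1) τ)
            (Finset.mem_univ σ), Function.update_self,
          Finset.sum_congr rfl fun τ hτ => by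
            rw [← Function.update_of_ne (Finset.ne_of_mem_erase hτ) (p σ + 1) p]]
        omega
      omega
    · intro τ
      rcases eq_or_ne τ σ with rfl | hτ
      · rw [Function.update_self]
        omega
      · rw [Function.update_of_ne hτ]
        exact hp τ
    · intro τ ρ
      rcases eq_or_ne τ σ with rfl | hτ <;> rcases eq_or_ne ρ τ with rfl | hρ
      · rw [Function.update_self]
        omega
      · rw [Function.update_self, Function.update_of_ne hρ]
        intro _ h
        exact hmin ρ h
      · rw [Function.update_of_ne hτ]
        omega
      · rw [Function.update_of_ne hτ]
        intro h1 h2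
        have h3 := hinv τ σ h1 hσ
        rcases eq_or_ne ρ σ with rfl | hρ'
        · rw [Function.update_self]
          omega
        · rw [Function.update_of_ne hρ'] at h2 ⊢
          have := hmin ρ h2
          omega
    · have hstep := hreach.step σ (y σ (p σ + 1)) ⟨hadj σ _ hσ, ?_, ?_⟩
      · convert hstep using 1
        funext τ
        rcases eq_or_ne τ σ with rfl | hτ
        · rw [Function.update_self, Function.update_self]
        · rw [Function.update_of_ne hτ, Function.update_of_ne hτ]
      · rw [hgeo σ _ hσ, hgeo σ _ hσ.le]
        omega
      · rcases Nat.lt_or_ge (p σ + 1) (L σ) with hlt | hge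
        · refine Or.inr fun τ => ⟨(hend σ _ (by omega) hlt τ).1, (hend σ _ (by omega) hlt τ).2,
            fun hτ hbet => ?_⟩
          -- A conflict would put `τ` strictly beyond the new potential of `σ`, against the
          -- invariant. If `τ` has not moved, the only vertex in conflict is its start, which is an
          -- end and already excluded.
          have h1 := hconf σ τ hτ _ _ (by omega) hlt (hp τ) hbet
          rcases Nat.eq_zero_or_pos (p τ) with h0 | h0
          · simp only [h0, Between, hD.self] at hbet
            exact (hend σ _ (by omega) hlt τ).1 (hD.eq_of (u := y τ 0) (by omega)).symm
          · have := hinv τ σ h0 hσ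
            omega
        · exact Or.inl (by rw [show p σ + 1 = L σ by omega])

/-! ### The token game decides the problem -/

/-- Cutting the `k` paths at the marks `m i r` into segments gives tokens that can all be moved to
their ends. -/
def Accepts (G : SimpleGraph V) (D : V → V → ℕ) {k : ℕ} (M : ℕ) (s t : Fin k → V) : Prop :=
  ∃ (m : Fin k → Fin (M + 1) → V) (a b : Fin k × Fin M → V),
    (∀ i, m i 0 = s i ∧ m i (Fin.last M) = t i) ∧
    (∀ i r, D (s i) (m i (Fin.succ r)) =
      D (s i) (m i (Fin.castSucc r)) + D (m i (Fin.castSucc r)) (m i (Fin.succ r))) ∧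
    (∀ i r, (a (i, r) = m i (Fin.castSucc r) ∧ b (i, r) = m i (Fin.succ r)) ∨
      (a (i, r) = m i (Fin.succ r) ∧ b (i, r) = m i (Fin.castSucc r))) ∧
    (∀ i j, i ≠ j → ∀ r r', m i r = m j r' → m i r = s i ∨ m i r = t i) ∧
    Reach G D a b b

/-- Since the marks lie in order on geodesics from `s i`, the final trails concatenate to shortest
paths. A common vertex of two of them is a mark of both, and common marks are terminals. -/
theorem Accepts.hasDisjointShortestPaths {G : SimpleGraph V} {D : V → V → ℕ}
    (hD : IsNatMetric D) (hdist : ∀ u v, G.Reachable u v → D u v = G.dist u v) {k M : ℕ}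
    {s t : Fin k → V} (h : Accepts G D M s t) : HasDisjointShortestPaths G s t := by
  have hwalk : ∀ u v (p : G.Walk u v), D u v ≤ p.length := fun u v p =>
    (hdist u v ⟨p⟩).trans_le (SimpleGraph.dist_le p)
  obtain ⟨m, a, b, hst, hgeo, hab, hmarks, hreach⟩ := h
  obtain ⟨W, hlen, hends, hdisj⟩ := hreach.exists_walks hD hwalk
  have hseg : ∀ i r, ∃ q : G.Walk (m i (Fin.castSucc r)) (m i (Fin.succ r)),
      q.length = D (m i (Fin.castSucc r)) (m i (Fin.succ r)) ∧
      ∀ x ∈ q.support, x ∈ (W (i, r)).support := by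
    intro i r
    have h1 := hlen (i, r)
    rw [hD.self, add_zero] at h1
    rcases hab i r with ⟨ha, hb⟩ | ⟨ha, hb⟩
    · refine ⟨(W (i, r)).copy ha hb, by simp [h1, ha, hb], fun x hx => by simpa using hx⟩
    · refine ⟨((W (i, r)).copy ha hb).reverse, ?_, fun x hx => by simpa using hx⟩
      rw [SimpleGraph.Walk.length_reverse, SimpleGraph.Walk.length_copy, h1, ha, hb, hD.symm]
  have hpath : ∀ i (r : Fin (M + 1)), ∃ q : G.Walk (s i) (m i r), q.length = D (s i) (m i r) ∧
      ∀ x ∈ q.support, x = s i ∨ ∃ r', x ∈ (W (i, r')).support := by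
    intro i r
    induction r using Fin.induction with
    | zero =>
      rw [(hst i).1]
      exact ⟨.nil, by simp [hD.self], fun x hx => by simpa using Or.inl hx⟩
    | succ r ih =>
      obtain ⟨q, hq, hqs⟩ := ih
      obtain ⟨q', hq', hqs'⟩ := hseg i r
      refine ⟨q.append q', ?_, fun x hx => ?_⟩
      · rw [SimpleGraph.Walk.length_append, hq, hq', hgeo]
      · rw [SimpleGraph.Walk.mem_support_append_iff] at hx
        rcases hx with hx | hx
        · exact hqs x hx
        · exact Or.inr ⟨r, hqs' x hx⟩
  have hpath' : ∀ i, ∃ q : G.Walk (s i) (t i), q.length = G.dist (s i) (t i) ∧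
      ∀ x ∈ q.support, x = s i ∨ ∃ r', x ∈ (W (i, r')).support := by
    intro i
    obtain ⟨q, hq, hqs⟩ := hpath i (Fin.last M)
    refine ⟨q.copy rfl (hst i).2, ?_, fun x hx => hqs x (by simpa using hx)⟩
    rw [SimpleGraph.Walk.length_copy, hq, hdist _ _ ⟨q⟩, (hst i).2]
  choose P hP hPs using hpath'
  have hmark : ∀ i r x, x ∈ (W (i, r)).support → (∃ τ, x = a τ ∨ x = b τ) →
      ∃ r', x = m i r' := by
    rintro i r x hx ⟨τ, hτ⟩
    have := hends _ x hx τ hτ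
    rcases hab i r with ⟨ha, hb⟩ | ⟨ha, hb⟩ <;> rw [ha, hb] at this <;>
      rcases this with h | h <;> exact ⟨_, h⟩
  have hint : ∀ i j, i ≠ j → ∀ x ∈ (P i).internalVertices, x ∉ (P j).support := by
    rintro i j hij x ⟨hx, hxs, hxt⟩ hxj
    obtain ⟨r, hr⟩ := (hPs i x hx).resolve_left hxs
    have hcontra : (∃ r', x = m i r') → (∃ r', x = m j r') → False := by
      rintro ⟨r1, h1⟩ ⟨r2, h2⟩
      rcases hmarks i j hij r1 r2 (h1.symm.trans h2) with h3 | h3 <;> rw [← h1] at h3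
      exacts [hxs h3, hxt h3]
    rcases hPs j x hxj with hx0 | ⟨r', hr'⟩
    -- The vertex `s j` is treated separately because it might lie on no trail a priori; it is the
    -- first mark, hence an end of the token `(j, 0)`.
    · have hM : 0 < M := r.pos
      have hm0 : x = m j (Fin.castSucc ⟨0, hM⟩) := by
        rw [hx0, ← (hst j).1]
        rfl
      refine hcontra (hmark i r x hr ⟨(j, ⟨0, hM⟩), ?_⟩) ⟨_, hm0⟩
      rcases hab j ⟨0, hM⟩ with ⟨ha, -⟩ | ⟨-, hb⟩
      · exact Or.inl (hm0.trans ha.symm)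
      · exact Or.inr (hm0.trans hb.symm)
    · have hE := hdisj (i, r) (j, r') (by simp [hij]) x hr hr'
      exact hcontra (hmark i r x hr hE) (hmark j r' x hr' hE)
  exact ⟨P, fun i => ⟨(P i).isPath_of_length_eq_dist (hP i), hP i⟩,
    fun i j hij => ⟨hint i j hij, hint j i hij.symm⟩⟩

end DisjointShortestPaths

/-! ### Every solution is accepted by the token game -/

namespace DisjointShortestPaths

variable {V : Type*}

/-- A segment of a geodesic that is monotone with respect to the distance from `c` can be
traversed such that this distance increases. -/
theorem exists_oriented_segment {G : SimpleGraph V} {D : V → V → ℕ} (hD : IsNatMetric D)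
    (p : ℕ → V) (L : ℕ) (hadj : ∀ x, x < L → G.Adj (p x) (p (x + 1)))
    (hp : ∀ x y, x ≤ y → y ≤ L → D (p x) (p y) = y - x) (c : V) (x₀ x₁ : ℕ) (h01 : x₀ ≤ x₁)
    (h1 : x₁ ≤ L) (hc : D c (p x₁) = D c (p x₀) + (x₁ - x₀) ∨
      D c (p x₀) = D c (p x₁) + (x₁ - x₀)) :
    ∃ y : ℕ → V, ((y 0 = p x₀ ∧ y (x₁ - x₀) = p x₁) ∨ (y 0 = p x₁ ∧ y (x₁ - x₀) = p x₀)) ∧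
      (∀ x, x < x₁ - x₀ → G.Adj (y x) (y (x + 1))) ∧
      (∀ x z, x ≤ z → z ≤ x₁ - x₀ → D (y x) (y z) = z - x) ∧
      (∀ x, 0 < x → x < x₁ - x₀ → ∃ z, x₀ < z ∧ z < x₁ ∧ y x = p z) ∧
      ∀ x, x ≤ x₁ - x₀ → D c (y x) = D c (y 0) + x := by
  rcases hc with hc | hc
  · refine ⟨fun x => p (x₀ + x), Or.inl ⟨rfl, by beta_reduce; rw [Nat.add_sub_cancel' h01]⟩,
      fun x hx => hadj _ (by omega), fun x z hxz hz => ?_,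
      fun x h0 hx => ⟨x₀ + x, by omega, by omega, rfl⟩, fun x hx => ?_⟩
    · dsimp only
      rw [hp _ _ (by omega) (by omega)]
      omega
    · have h2 := hD.tri c (p x₀) (p (x₀ + x))
      have h3 := hD.tri c (p (x₀ + x)) (p x₁)
      rw [hp _ _ (by omega) (by omega)] at h2 h3
      simp only [add_zero]
      omega
  · refine ⟨fun x => p (x₁ - x), Or.inr ⟨rfl, by beta_reduce; rw [Nat.sub_sub_self h01]⟩,
      fun x hx => ?_, fun x z hxz hz => ?_,
      fun x h0 hx => ⟨x₁ - x, by omega, by omega, rfl⟩, fun x hx => ?_⟩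
    · have := (hadj (x₁ - (x + 1)) (by omega)).symm
      rwa [show x₁ - (x + 1) + 1 = x₁ - x by omega] at this
    · dsimp only
      rw [hD.symm, hp _ _ (by omega) (by omega)]
      omega
    · have h2 := hD.tri c (p x₁) (p (x₁ - x))
      have h3 := hD.tri c (p (x₁ - x)) (p x₀)
      rw [hD.symm (p x₁), hp _ _ (by omega) (by omega)] at h2
      rw [hD.symm (p (x₁ - x)) (p x₀), hp _ _ (by omega) (by omega)] at h3
      simp only [Nat.sub_zero]
      omega

theorem HasDisjointShortestPaths.accepts {G : SimpleGraph V} {D : V → V → ℕ}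
    (hD : IsNatMetric D) (hdist : ∀ u v, G.Reachable u v → D u v = G.dist u v) {k : ℕ}
    {s t : Fin k → V} (h : HasDisjointShortestPaths G s t) : Accepts G D (segCount k) s t := by
  obtain ⟨P, hP, hdisj⟩ := h
  set p : Fin k → ℕ → V := fun i x => (P i).getVert x with hpdef
  set L : Fin k → ℕ := fun i => (P i).length with hL
  have hp0 : ∀ i, p i 0 = s i := fun i => (P i).getVert_zero
  have hpL : ∀ i, p i (L i) = t i := fun i => (P i).getVert_length
  have hadj : ∀ i x, x < L i → G.Adj (p i x) (p i (x + 1)) := fun i x hx =>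
    (P i).adj_getVert_succ hx
  have hle : ∀ i x d, x + d ≤ L i → D (p i x) (p i (x + d)) ≤ d := by
    intro i x d
    induction d with
    | zero => simp [hD.self]
    | succ d ih =>
      intro hd
      have h1 := ih (by omega)
      have h2 := hadj i (x + d) (by omega)
      have h3 := hD.tri (p i x) (p i (x + d)) (p i (x + d + 1))
      rw [hdist _ _ h2.reachable, SimpleGraph.dist_eq_one_iff_adj.2 h2] at h3
      rw [← add_assoc]
      omega
  -- The upper bounds on the three parts of the path add up to the distance of its ends, so each of
  -- them is attained.
  have hp : ∀ i x y, x ≤ y → y ≤ L i → D (p i x) (p i y) = y - x := by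
    intro i x y hxy hy
    have h1 := hle i 0 x (by omega)
    have h2 := hle i x (y - x) (by omega)
    have h3 := hle i y (L i - y) (by omega)
    rw [zero_add] at h1
    rw [Nat.add_sub_cancel' hxy] at h2
    rw [Nat.add_sub_cancel' hy] at h3
    have h4 := hD.tri (p i 0) (p i x) (p i (L i))
    have h5 := hD.tri (p i x) (p i y) (p i (L i))
    have h6 : D (p i 0) (p i (L i)) = L i := by
      rw [hp0, hpL, hdist _ _ ⟨P i⟩, ← (hP i).2]
    omega
  have hps : ∀ i x, x ≤ L i → D (s i) (p i x) = x := fun i x hx => by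
    rw [← hp0 i, hp i 0 x (Nat.zero_le _) hx, Nat.sub_zero]
  have hinj : ∀ i x y, x ≤ L i → y ≤ L i → p i x = p i y → x = y := fun i x y hx hy hxy => by
    rw [← hps i x hx, ← hps i y hy, hxy]
  have hint : ∀ i j, i ≠ j → ∀ x y, 0 < x → x < L i → p i x ≠ p j y := by
    intro i j hij x y h0 hx heq
    refine (hdisj i j hij).1 (p i x) ⟨(P i).getVert_mem_support x, ?_, ?_⟩
      (heq ▸ (P j).getVert_mem_support y)
    · rw [← hp0 i]
      intro h
      have := hinj i _ _ hx.le (Nat.zero_le _) h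
      omega
    · rw [← hpL i]
      intro h
      have := hinj i _ _ hx.le le_rfl h
      omega
  obtain ⟨m, c, hm, hc, hconf⟩ := exists_segmentation hD s p L hp0 hp
  have hmle : ∀ i r, m i r ≤ m i (r + 1) := fun i r => (hm i).2.2.1 (Nat.le_succ r)
  have hmL : ∀ i r, m i r ≤ L i := fun i r => (hm i).2.2.2 r
  choose y hy01 hyadj hygeo hyint hyc using fun i r => exists_oriented_segment hD (p i) (L i)
    (hadj i) (hp i) (s (c i r)) (m i r) (m i (r + 1)) (hmle i r) (hmL i _) (hc i r)
  have hbetween : ∀ i r w x, x ≤ m i (r + 1) - m i r → Between D (y i r 0) w (y i r x) →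
      Between D (p i (m i r)) w (p i (m i (r + 1))) := by
    intro i r w x hx hb
    have h1 := hD.tri w (y i r x) (y i r (m i (r + 1) - m i r))
    have h2 := hD.tri (y i r 0) w (y i r (m i (r + 1) - m i r))
    rw [hygeo i r _ _ hx le_rfl] at h1
    rw [hygeo i r 0 _ (Nat.zero_le _) le_rfl] at h2
    unfold Between at hb ⊢
    rw [hygeo i r 0 x (Nat.zero_le _) hx] at hb
    rw [hp i _ _ (hmle i r) (hmL i _)]
    rcases hy01 i r with ⟨h3, h4⟩ | ⟨h3, h4⟩ <;> rw [h3] at hb h2 <;> rw [h4] at h1 h2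
    · omega
    · rw [hD.symm] at hb h2
      rw [hD.symm w (p i (m i r))] at *
      rw [hD.symm w (p i (m i (r + 1)))] at *
      omega
  have hmark : ∀ i r, (∃ r', y i r 0 = p i (m i r')) ∧
      ∃ r', y i r (m i (r + 1) - m i r) = p i (m i r') := by
    intro i r
    rcases hy01 i r with ⟨h3, h4⟩ | ⟨h3, h4⟩ <;> exact ⟨⟨_, h3⟩, ⟨_, h4⟩⟩
  -- Interior vertices of a segment are no marks: on the same path by the order of the marks, on
  -- other paths by internal disjointness.
  have hnotmark : ∀ i r x, 0 < x → x < m i (r + 1) - m i r → ∀ j r',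
      y i r x ≠ p j (m j r') := by
    intro i r x h0 hx j r' heq
    obtain ⟨z, hz0, hz1, hz⟩ := hyint i r x h0 hx
    have h1 := hmL i (r + 1)
    rw [hz] at heq
    rcases eq_or_ne i j with rfl | hij
    · have h2 := hinj i _ _ (by omega) (hmL i r') heq
      rcases le_or_gt r' r with hr | hr
      · have := (hm i).2.2.1 hr
        omega
      · have := (hm i).2.2.1 (show r + 1 ≤ r' from hr)
        omega
    · exact hint i j hij z _ (by omega) (by omega) heq
  refine ⟨fun i r => p i (m i r), fun σ => y σ.1 σ.2 0,
    fun σ => y σ.1 σ.2 (m σ.1 (σ.2 + 1) - m σ.1 σ.2), fun i => ⟨?_, ?_⟩, fun i r => ?_,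
    fun i r => ?_, fun i j hij r r' heq => ?_, ?_⟩
  · simp only [Fin.val_zero, (hm i).1, hp0]
  · simp only [Fin.val_last, (hm i).2.1, hpL]
  · have h1 := hmle i r
    simp only [Fin.val_succ, Fin.val_castSucc]
    rw [hps i _ (hmL i _), hps i _ (hmL i _), hp i _ _ h1 (hmL i _)]
    omega
  · simp only [Fin.val_succ, Fin.val_castSucc]
    rcases hy01 i r with h | h
    · exact Or.inl h
    · exact Or.inr h
  · by_contra hcon
    push Not at hcon
    refine hint i j hij (m i r) (m j r') ?_ ?_ heq
    · exact Nat.pos_of_ne_zero fun h => hcon.1 (by simp only [h, hp0])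
    · exact lt_of_le_of_ne (hmL i r) fun h => hcon.2 (by simp only [h, hpL])
  -- The potential of a token is its distance from the terminal of its colour; the orientation of
  -- the segments makes it grow by one with every move.
  · refine reach_of_potential hD (fun σ : Fin k × Fin (segCount k) => y σ.1 σ.2)
      (fun σ => m σ.1 (σ.2 + 1) - m σ.1 σ.2) (fun σ => D (s (c σ.1 σ.2)) (y σ.1 σ.2 0))
      (fun σ => hyadj _ _) (fun σ x hx => hygeo _ _ _ _ hx le_rfl)
      (fun σ x h0 hx τ => ?_) (fun σ τ hτ x x' h0 hx hx' hbet => ?_)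
    · obtain ⟨⟨r1, h1⟩, ⟨r2, h2⟩⟩ := hmark τ.1 τ.2
      exact ⟨h1 ▸ hnotmark _ _ x h0 hx _ _, h2 ▸ hnotmark _ _ x h0 hx _ _⟩
    · obtain ⟨i, r⟩ := σ
      obtain ⟨j, r'⟩ := τ
      dsimp only at *
      have hb := hbetween j r' _ _ hx' hbet
      have hb' := hbetween i r (y i r x) (m i (r + 1) - m i r) le_rfl (by
        unfold Between
        rw [hygeo _ _ _ _ (Nat.zero_le _) hx.le, hygeo _ _ _ _ hx.le le_rfl,
          hygeo _ _ _ _ (Nat.zero_le _) le_rfl]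
        omega)
      -- Two segments of one path cannot conflict, as they occupy separate ranges of distances from
      -- `s i`.
      have hij : i ≠ j := by
        rintro rfl
        have hrr : (r : ℕ) ≠ r' := fun h => hτ (by rw [Fin.ext h])
        obtain ⟨z, hz0, hz1, hz⟩ := hyint i r x h0 hx
        have h1 := hmL i (r + 1)
        have h2 : D (s i) (p i (m i (r' + 1))) =
            D (s i) (p i (m i r')) + D (p i (m i r')) (p i (m i (r' + 1))) := by
          rw [hps i _ (hmL i _), hps i _ (hmL i _), hp i _ _ (hmle i r') (hmL i _)]
          have := hmle i r'
          omega
        have h3 := hb.dist_left hD h2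
        have h4 := hb.dist_right hD h2
        rw [hz, hps i z (by omega), hps i _ (hmL i _)] at h3 h4
        rcases lt_or_gt_of_ne hrr with hr | hr
        · have := (hm i).2.2.1 (show (r : ℕ) + 1 ≤ r' from hr)
          omega
        · have := (hm i).2.2.1 (show (r' : ℕ) + 1 ≤ r from hr)
          omega
      have hcc : c i r = c j r' := hconf i j hij r r' _ hb' hb (hnotmark i r x h0 hx _ _)
        (hnotmark i r x h0 hx _ _) (hnotmark i r x h0 hx _ _) (hnotmark i r x h0 hx _ _)
      have h5 := hyc i r x hx.le
      have h6 := hyc j r' x' hx'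
      rw [← hcc] at h6 ⊢
      have h7 := hbet.dist_left hD (s := s (c i r)) (by
        rw [h6, hygeo j r' 0 x' (Nat.zero_le _) hx']
        omega)
      -- Distinctness of the two positions makes the inequality of potentials strict.
      have h8 : D (y i r x) (y j r' x') ≠ 0 := by
        intro h
        have h9 := hD.eq_of h
        rcases Nat.eq_zero_or_pos x' with rfl | h0'
        · obtain ⟨⟨r1, h1⟩, -⟩ := hmark j r'
          exact hnotmark i r x h0 hx _ _ (h9.trans h1)
        · rcases Nat.lt_or_ge x' (m j (r' + 1) - m j r') with h10 | h10
          · obtain ⟨z, hz0, hz1, hz⟩ := hyint i r x h0 hx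
            obtain ⟨z', hz0', hz1', hz'⟩ := hyint j r' x' h0' h10
            have := hmL i (r + 1)
            exact hint i j hij z z' (by omega) (by omega) (hz.symm.trans (h9.trans hz'))
          · obtain ⟨-, ⟨r1, h1⟩⟩ := hmark j r'
            rw [le_antisymm hx' h10] at h9
            exact hnotmark i r x h0 hx _ _ (h9.trans h1)
      have h9 := hygeo j r' 0 x' (Nat.zero_le _) hx'
      unfold Between at hbet
      omega

end DisjointShortestPaths

namespace DisjointShortestPaths

open RAM

/-! ### Expressions and statements, and their compilation -/

/-- Expressions over variables in `α`. `size` is the number `n` of vertices, `scale e` is `n * e`,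
and `sum x e` is the sum of `e` over all values `x < n`. -/
inductive Expr (α : Type) where
  | var (x : α)
  | size
  | const (c : ℕ)
  | add (e f : Expr α)
  | sub (e f : Expr α)
  | load (e : Expr α)
  | scale (e : Expr α)
  | sum (x : α) (e : Expr α)

/-- Statements: `mem[e] := f`, sequences, and loops over all values `x < n`. -/
inductive Stmt (α : Type) where
  | store (e f : Expr α)
  | seq (s t : Stmt α)
  | loop (x : α) (s : Stmt α)

section semantics

variable {α : Type} [DecidableEq α] (n : ℕ)

def Expr.eval (μ : ℕ → ℕ) : Expr α → (α → ℕ) → ℕ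
  | .var x, ρ => ρ x
  | .size, _ => n
  | .const c, _ => c
  | .add e f, ρ => e.eval μ ρ + f.eval μ ρ
  | .sub e f, ρ => e.eval μ ρ - f.eval μ ρ
  | .load e, ρ => μ (e.eval μ ρ)
  | .scale e, ρ => n * e.eval μ ρ
  | .sum x e, ρ => ∑ v ∈ Finset.range n, e.eval μ (Function.update ρ x v)

def Stmt.run : Stmt α → (α → ℕ) → (ℕ → ℕ) → ℕ → ℕ
  | .store e f, ρ, μ => Function.update μ (e.eval n μ ρ) (f.eval n μ ρ)
  | .seq s t, ρ, μ => t.run ρ (s.run ρ μ)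
  | .loop x s, ρ, μ => Nat.rec μ (fun v μ' => s.run (Function.update ρ x v) μ') n

end semantics

/-- The weight bounds the exponent of the running time to the base `max n 2`. The `8` at every node
absorbs all constant factors and the factor `n` of a loop. -/
def Expr.weight {α : Type} : Expr α → ℕ
  | .var _ | .size | .const _ => 8
  | .add e f | .sub e f => e.weight + f.weight + 8
  | .load e | .scale e | .sum _ e => e.weight + 8

def Stmt.weight {α : Type} : Stmt α → ℕ
  | .store e f => e.weight + f.weight + 8
  | .seq s t => s.weight + t.weight + 8
  | .loop _ s => s.weight + 8

/-- The register that holds the variable `x`. -/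
def varReg {α : Type} [Encodable α] (x : α) : ℕ := 2 * Encodable.encode x + 1

/-- The `m`-th auxiliary register. -/
def tmpReg (m : ℕ) : ℕ := 2 * m + 2

/-- Execute `body` with register `r` equal to `0, …, n - 1`, and restore `r` in the end. -/
def forLoop (r m : ℕ) (body : Prog) : Prog :=
  -- Copying is adding to zero. The three auxiliary registers hold the saved value of `r`, the
  -- number of iterations left, and the constant `1`.
  .seq (.const (tmpReg m) 0) <| .seq (.add (tmpReg m) (tmpReg m) r) <|
  .seq (.const (tmpReg (m + 1)) 0) <| .seq (.add (tmpReg (m + 1)) (tmpReg (m + 1)) 0) <|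
  .seq (.const r 0) <|
  .seq (.loop (tmpReg (m + 1)) <| .seq body <| .seq (.const (tmpReg (m + 2)) 1) <|
    .seq (.add r r (tmpReg (m + 2))) (.sub (tmpReg (m + 1)) (tmpReg (m + 1)) (tmpReg (m + 2)))) <|
  .seq (.const r 0) (.add r r (tmpReg m))

section compilation

variable {α : Type} [Encodable α]

/-- Code that writes the value of the expression to the `m`-th auxiliary register. -/
def Expr.compile : Expr α → ℕ → Prog
  | .var x, m => .seq (.const (tmpReg m) 0) (.add (tmpReg m) (tmpReg m) (varReg x))
  | .size, m => .seq (.const (tmpReg m) 0) (.add (tmpReg m) (tmpReg m) 0)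
  | .const c, m => .const (tmpReg m) c
  | .add e f, m => .seq (e.compile m) <| .seq (f.compile (m + 1)) <|
      .add (tmpReg m) (tmpReg m) (tmpReg (m + 1))
  | .sub e f, m => .seq (e.compile m) <| .seq (f.compile (m + 1)) <|
      .sub (tmpReg m) (tmpReg m) (tmpReg (m + 1))
  | .load e, m => .seq (e.compile m) (.load (tmpReg m) (tmpReg m))
  | .scale e, m => .seq (e.compile (m + 1)) <| .seq (.const (tmpReg m) 0) <|
      forLoop (tmpReg (m + 2)) (m + 3) (.add (tmpReg m) (tmpReg m) (tmpReg (m + 1)))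
  | .sum x e, m => .seq (.const (tmpReg m) 0) <| forLoop (varReg x) (m + 1) <|
      .seq (e.compile (m + 3)) (.add (tmpReg m) (tmpReg m) (tmpReg (m + 3)))

def Stmt.compile : Stmt α → ℕ → Prog
  | .store e f, m => .seq (e.compile m) <| .seq (f.compile (m + 1)) <|
      .store (tmpReg m) (tmpReg (m + 1))
  | .seq s t, m => .seq (s.compile m) (t.compile m)
  | .loop x s, m => forLoop (varReg x) m (s.compile (m + 2))

end compilation

@[simp] theorem setReg_mem (σ : State) (r a : ℕ) : (σ.setReg r a).mem = σ.mem := rfl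

@[simp] theorem setReg_reg_self (σ : State) (r a : ℕ) : (σ.setReg r a).reg r = a :=
  Function.update_self ..

theorem setReg_reg_of_ne (σ : State) {r q : ℕ} (a : ℕ) (h : q ≠ r) :
    (σ.setReg r a).reg q = σ.reg q :=
  Function.update_of_ne h ..

/-- The loop rule: `I v` is the invariant before the iteration with value `v`. -/
theorem exists_exec_forLoop {r m n B : ℕ} {body : Prog} (hr1 : r ≠ tmpReg m)
    (hr2 : r ≠ tmpReg (m + 1)) (hr3 : r ≠ tmpReg (m + 2)) (I : ℕ → State → Prop)
    (hI : ∀ v σ σ', I v σ → σ'.mem = σ.mem → (∀ q, q ≠ r → q ≠ tmpReg m → q ≠ tmpReg (m + 1) →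
      q ≠ tmpReg (m + 2) → σ'.reg q = σ.reg q) → I v σ')
    (hbody : ∀ v < n, ∀ σ, I v σ → σ.reg r = v → ∃ T ≤ B, ∃ τ, Exec body σ T τ ∧ I (v + 1) τ ∧
      τ.reg r = σ.reg r ∧ τ.reg (tmpReg m) = σ.reg (tmpReg m) ∧
      τ.reg (tmpReg (m + 1)) = σ.reg (tmpReg (m + 1)))
    (σ : State) (hσ0 : σ.reg 0 = n) (hσ : I 0 σ) :
    ∃ T ≤ n * (B + 4) + 8, ∃ τ, Exec (forLoop r m body) σ T τ ∧ I n τ ∧ τ.reg r = σ.reg r := by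
  have h01 : tmpReg (m + 1) ≠ tmpReg m := by simp [tmpReg]
  have h12 : tmpReg (m + 2) ≠ tmpReg (m + 1) := by simp [tmpReg]
  have h02 : tmpReg (m + 2) ≠ tmpReg m := by simp [tmpReg]
  have hz1 : 0 ≠ tmpReg m := by simp [tmpReg]
  have hz2 : 0 ≠ tmpReg (m + 1) := by simp [tmpReg]
  have hloop : ∀ j v (σ : State), v + j = n → I v σ → σ.reg r = v → σ.reg (tmpReg (m + 1)) = j →
      ∃ T ≤ j * (B + 4) + 1, ∃ τ, Exec (.loop (tmpReg (m + 1)) <| .seq body <|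
        .seq (.const (tmpReg (m + 2)) 1) <| .seq (.add r r (tmpReg (m + 2)))
          (.sub (tmpReg (m + 1)) (tmpReg (m + 1)) (tmpReg (m + 2)))) σ T τ ∧ I n τ ∧
        τ.reg (tmpReg m) = σ.reg (tmpReg m) := by
    intro j
    induction j with
    | zero =>
      intro v σ hv hIv _ hj
      exact ⟨1, by simp, σ, .loop_false hj, by rwa [← hv, add_zero], rfl⟩
    | succ j ih =>
      intro v σ hv hIv hrv hj
      obtain ⟨T, hT, τ, hex, hIτ, h1, h2, h3⟩ := hbody v (by omega) σ hIv hrv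
      have e1 := Exec.const τ (tmpReg (m + 2)) 1
      have e2 := Exec.add (τ.setReg (tmpReg (m + 2)) 1) r r (tmpReg (m + 2))
      rw [setReg_reg_self, setReg_reg_of_ne _ _ hr3, h1, hrv] at e2
      have e3 := Exec.sub ((τ.setReg (tmpReg (m + 2)) 1).setReg r (v + 1)) (tmpReg (m + 1))
        (tmpReg (m + 1)) (tmpReg (m + 2))
      rw [setReg_reg_of_ne _ _ hr2.symm, setReg_reg_of_ne _ _ h12.symm,
        setReg_reg_of_ne _ _ hr3.symm, setReg_reg_self, h3, hj, Nat.add_sub_cancel] at e3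
      obtain ⟨U, hU, ω, hex', hIω, hω⟩ := ih (v + 1)
        (((τ.setReg (tmpReg (m + 2)) 1).setReg r (v + 1)).setReg (tmpReg (m + 1)) j) (by omega)
        (hI _ τ _ hIτ rfl fun q hq0 hq1 hq2 hq3 => by
          rw [setReg_reg_of_ne _ _ hq2, setReg_reg_of_ne _ _ hq0, setReg_reg_of_ne _ _ hq3])
        (by rw [setReg_reg_of_ne _ _ hr2, setReg_reg_self]) (setReg_reg_self ..)
      refine ⟨T + (1 + (1 + 1)) + U + 1, ?_, ω, .loop_true (by omega)
        (.seq hex (.seq e1 (.seq e2 e3))) hex', hIω, ?_⟩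
      · rw [add_mul]
        omega
      · rw [hω, setReg_reg_of_ne _ _ h01.symm, setReg_reg_of_ne _ _ hr1.symm,
          setReg_reg_of_ne _ _ h02.symm, h2]
  have e1 := Exec.const σ (tmpReg m) 0
  have e2 := Exec.add (σ.setReg (tmpReg m) 0) (tmpReg m) (tmpReg m) r
  rw [setReg_reg_self, setReg_reg_of_ne _ _ hr1, zero_add] at e2
  generalize hσ2 : (σ.setReg (tmpReg m) 0).setReg (tmpReg m) (σ.reg r) = σ2 at e2
  have e3 := Exec.const σ2 (tmpReg (m + 1)) 0
  have e4 := Exec.add (σ2.setReg (tmpReg (m + 1)) 0) (tmpReg (m + 1)) (tmpReg (m + 1)) 0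
  have hσ2n : σ2.reg 0 = n := by
    rw [← hσ2, setReg_reg_of_ne _ _ hz1, setReg_reg_of_ne _ _ hz1, hσ0]
  rw [setReg_reg_self, setReg_reg_of_ne _ _ hz2, zero_add, hσ2n] at e4
  generalize hσ4 : (σ2.setReg (tmpReg (m + 1)) 0).setReg (tmpReg (m + 1)) n = σ4 at e4
  have e5 := Exec.const σ4 r 0
  obtain ⟨T, hT, τ, hex, hIτ, hτ⟩ := hloop n 0 (σ4.setReg r 0) (zero_add _)
    (hI 0 σ _ hσ (by rw [← hσ4, ← hσ2]; rfl) fun q hq0 hq1 hq2 _ => by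
      rw [setReg_reg_of_ne _ _ hq0, ← hσ4, setReg_reg_of_ne _ _ hq2, setReg_reg_of_ne _ _ hq2,
        ← hσ2, setReg_reg_of_ne _ _ hq1, setReg_reg_of_ne _ _ hq1])
    (setReg_reg_self ..)
    (by rw [setReg_reg_of_ne _ _ hr2.symm, ← hσ4, setReg_reg_self])
  have hτr : τ.reg (tmpReg m) = σ.reg r := by
    rw [hτ, setReg_reg_of_ne _ _ hr1.symm, ← hσ4, setReg_reg_of_ne _ _ h01.symm,
      setReg_reg_of_ne _ _ h01.symm, ← hσ2, setReg_reg_self]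
  have e6 := Exec.const τ r 0
  have e7 := Exec.add (τ.setReg r 0) r r (tmpReg m)
  rw [setReg_reg_self, setReg_reg_of_ne _ _ hr1.symm, hτr, zero_add] at e7
  refine ⟨1 + (1 + (1 + (1 + (1 + (T + (1 + 1)))))), by omega, _,
    .seq e1 (.seq e2 (.seq e3 (.seq e4 (.seq e5 (.seq hex (.seq e6 e7)))))),
    hI n τ _ hIτ rfl fun q hq0 _ _ _ => ?_, setReg_reg_self ..⟩
  rw [setReg_reg_of_ne _ _ hq0, setReg_reg_of_ne _ _ hq0]

end DisjointShortestPaths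

/-! ### Running time and correctness of compiled code -/

namespace DisjointShortestPaths

open RAM

/-- The constant `128` is `2 ^ 7`, so seven of the eight additional powers of `X` pay for it and the
last one is the factor `X`. -/
theorem two_mul_le_pow {X : ℕ} (hX : 2 ≤ X) (a : ℕ) : 128 * X * X ^ a ≤ X ^ (a + 8) := by
  have h1 : 2 ^ 7 ≤ X ^ 7 := Nat.pow_le_pow_left hX 7
  calc 128 * X * X ^ a ≤ X ^ 7 * X * X ^ a := by gcongr; simpa using h1
    _ = X ^ (a + 8) := by ring

theorem leaf_cost_le {X : ℕ} (hX : 2 ≤ X) : 2 ≤ X ^ 8 := by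
  have := two_mul_le_pow hX 0
  simp only [pow_zero, mul_one, zero_add] at this
  omega

theorem seq_cost_le {X : ℕ} (hX : 2 ≤ X) {T U a b : ℕ} (hT : T ≤ X ^ a) (hU : U ≤ X ^ b) :
    T + (U + 1) ≤ X ^ (a + b + 8) := by
  have h1 := two_mul_le_pow hX (a + b)
  have h2 : 1 ≤ X ^ a := Nat.one_le_pow _ _ (by omega)
  have h3 : 1 ≤ X ^ b := Nat.one_le_pow _ _ (by omega)
  rw [pow_add X a b] at h1
  have h4 : X ^ a ≤ X ^ a * X ^ b := Nat.le_mul_of_pos_right _ h3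
  have h5 : X ^ b ≤ X ^ a * X ^ b := Nat.le_mul_of_pos_left _ h2
  have h6 : 3 * (X ^ a * X ^ b) ≤ 128 * X * (X ^ a * X ^ b) := Nat.mul_le_mul_right _ (by omega)
  omega

theorem loop_cost_le {X n : ℕ} (hX : 2 ≤ X) (hn : n ≤ X) {T a : ℕ} (hT : T ≤ X ^ a) :
    T + 1 + (n * ((T + 1) + 4) + 8) ≤ X ^ (a + 8) := by
  have h1 := two_mul_le_pow hX a
  have h2 : 1 ≤ X ^ a := Nat.one_le_pow _ _ (by omega)
  have h3 : n * ((T + 1) + 4) ≤ X * (6 * X ^ a) := Nat.mul_le_mul hn (by omega)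
  have h4 : X ^ a ≤ X * X ^ a := Nat.le_mul_of_pos_left _ (by omega)
  rw [mul_assoc] at h1
  rw [mul_left_comm] at h3
  omega

/-- The states agree on all variables, on `n`, and on the auxiliary registers below `m`. -/
def Frame (m : ℕ) (σ τ : State) : Prop :=
  ∀ q, q % 2 = 1 ∨ q < 2 * m + 2 → τ.reg q = σ.reg q

theorem Frame.trans {m m' : ℕ} {σ τ ω : State} (h : Frame m σ τ) (h' : Frame m' τ ω)
    (hm : m ≤ m') : Frame m σ ω := fun q hq => by
  rw [h' q (by omega), h q hq]

theorem Frame.setReg {m m' : ℕ} {σ τ : State} (h : Frame m σ τ) (hm : m ≤ m') (a : ℕ) :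
    Frame m σ (τ.setReg (tmpReg m') a) := fun q hq => by
  rw [setReg_reg_of_ne _ _ (by unfold tmpReg; omega), h q hq]

theorem Frame.refl (m : ℕ) (σ : State) : Frame m σ σ := fun _ _ => rfl

variable {α : Type} [Encodable α]

/-- The values of the variables in a state. -/
def env (σ : State) (x : α) : ℕ := σ.reg (varReg x)

theorem Frame.env_eq {m : ℕ} {σ τ : State} (h : Frame m σ τ) :
    (env τ : α → ℕ) = env σ :=
  funext fun x => h _ (Or.inl (by unfold varReg; omega))

theorem varReg_injective : Function.Injective (varReg (α := α)) := fun x y h =>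
  Encodable.encode_injective (by unfold varReg at h; omega)

variable [DecidableEq α]

theorem Expr.exists_exec (n : ℕ) (e : Expr α) (m : ℕ) (σ : State) (hσ : σ.reg 0 = n) :
    ∃ T ≤ (max n 2) ^ e.weight, ∃ τ, Exec (e.compile m) σ T τ ∧ τ.mem = σ.mem ∧ Frame m σ τ ∧
      τ.reg (tmpReg m) = e.eval n σ.mem (env σ) := by
  have hX : 2 ≤ max n 2 := le_max_right _ _
  have hn : n ≤ max n 2 := le_max_left _ _
  induction e generalizing m σ with
  | var x =>
    refine ⟨1 + 1, leaf_cost_le hX, _, .seq (.const ..) (.add ..), rfl,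
      ((Frame.refl m σ).setReg le_rfl _).setReg le_rfl _, ?_⟩
    rw [setReg_reg_self, setReg_reg_self, setReg_reg_of_ne _ _ (by unfold varReg tmpReg; omega),
      zero_add]
    rfl
  | size =>
    refine ⟨1 + 1, leaf_cost_le hX, _, .seq (.const ..) (.add ..), rfl,
      ((Frame.refl m σ).setReg le_rfl _).setReg le_rfl _, ?_⟩
    rw [setReg_reg_self, setReg_reg_self, setReg_reg_of_ne _ _ (by unfold tmpReg; omega),
      zero_add, hσ]
    rfl
  | const c =>
    exact ⟨1, one_le_two.trans (leaf_cost_le hX), _, .const .., rfl,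
      (Frame.refl m σ).setReg le_rfl _, setReg_reg_self ..⟩
  | add e f ihe ihf =>
    obtain ⟨T, hT, τ, hex, hmem, hfr, hval⟩ := ihe m σ hσ
    obtain ⟨U, hU, ω, hex', hmem', hfr', hval'⟩ := ihf (m + 1) τ
      (by rw [hfr 0 (by omega), hσ])
    refine ⟨T + (U + 1), seq_cost_le hX hT hU, _, .seq hex (.seq hex' (.add ..)),
      by rw [setReg_mem, hmem', hmem], (hfr.trans hfr' (Nat.le_succ m)).setReg le_rfl _, ?_⟩
    rw [setReg_reg_self, hfr' _ (by unfold tmpReg; omega), hval, hval', hfr.env_eq, hmem]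
    rfl
  | sub e f ihe ihf =>
    obtain ⟨T, hT, τ, hex, hmem, hfr, hval⟩ := ihe m σ hσ
    obtain ⟨U, hU, ω, hex', hmem', hfr', hval'⟩ := ihf (m + 1) τ
      (by rw [hfr 0 (by omega), hσ])
    refine ⟨T + (U + 1), seq_cost_le hX hT hU, _, .seq hex (.seq hex' (.sub ..)),
      by rw [setReg_mem, hmem', hmem], (hfr.trans hfr' (Nat.le_succ m)).setReg le_rfl _, ?_⟩
    rw [setReg_reg_self, hfr' _ (by unfold tmpReg; omega), hval, hval', hfr.env_eq, hmem]
    rfl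
  | load e ih =>
    obtain ⟨T, hT, τ, hex, hmem, hfr, hval⟩ := ih m σ hσ
    refine ⟨T + 1, ?_, _, .seq hex (.load ..), hmem, hfr.setReg le_rfl _, ?_⟩
    · have := loop_cost_le hX hn hT
      simp only [Expr.weight]
      omega
    · rw [setReg_reg_self, hval, hmem]
      rfl
  | scale e ih =>
    obtain ⟨T, hT, τ, hex, hmem, hfr, hval⟩ := ih (m + 1) σ hσ
    obtain ⟨U, hU, ω, hex', hI, hr⟩ := exists_exec_forLoop (n := n) (r := tmpReg (m + 2))
      (m := m + 3) (B := 1) (body := .add (tmpReg m) (tmpReg m) (tmpReg (m + 1)))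
      (by unfold tmpReg; omega) (by unfold tmpReg; omega) (by unfold tmpReg; omega)
      (fun v ω => ω.mem = τ.mem ∧ Frame m τ ω ∧ ω.reg (tmpReg m) = v * τ.reg (tmpReg (m + 1)) ∧
        ω.reg (tmpReg (m + 1)) = τ.reg (tmpReg (m + 1)))
      (fun v ω ω' ⟨h1, h2, h3, h4⟩ h5 h6 => ⟨by rw [h5, h1], fun q hq => by
          rw [h6 q (by unfold tmpReg; omega) (by unfold tmpReg; omega) (by unfold tmpReg; omega)
            (by unfold tmpReg; omega), h2 q hq],
        by rw [h6 _ (by unfold tmpReg; omega) (by unfold tmpReg; omega) (by unfold tmpReg; omega)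
            (by unfold tmpReg; omega), h3],
        by rw [h6 _ (by unfold tmpReg; omega) (by unfold tmpReg; omega) (by unfold tmpReg; omega)
            (by unfold tmpReg; omega), h4]⟩)
      (fun v _ ω ⟨h1, h2, h3, h4⟩ _ => ⟨1, le_rfl, _, .add .., ⟨h1, h2.setReg le_rfl _,
        by rw [setReg_reg_self, h3, h4, add_mul, one_mul],
        by rw [setReg_reg_of_ne _ _ (by unfold tmpReg; omega), h4]⟩,
        setReg_reg_of_ne _ _ (by unfold tmpReg; omega),
        setReg_reg_of_ne _ _ (by unfold tmpReg; omega),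
        setReg_reg_of_ne _ _ (by unfold tmpReg; omega)⟩)
      (τ.setReg (tmpReg m) 0)
      (by rw [setReg_reg_of_ne _ _ (by unfold tmpReg; omega), hfr 0 (by omega), hσ])
      ⟨rfl, (Frame.refl m τ).setReg le_rfl _, by rw [setReg_reg_self, zero_mul],
        setReg_reg_of_ne _ _ (by unfold tmpReg; omega)⟩
    refine ⟨T + (1 + U), ?_, ω, .seq hex (.seq (.const ..) hex'), hI.1.trans hmem, ?_, ?_⟩
    · have h1 := loop_cost_le hX hn hT
      have h2 : n * (1 + 4) ≤ n * ((T + 1) + 4) := Nat.mul_le_mul_left _ (by omega)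
      simp only [Expr.weight]
      omega
    · exact fun q hq => by rw [hI.2.1 q hq, hfr q (by omega)]
    · rw [hI.2.2.1, hval]
      rfl
  | sum x e ih =>
    have hvr : varReg x % 2 = 1 := by unfold varReg; omega
    obtain ⟨U, hU, ω, hex', hI, hr⟩ := exists_exec_forLoop (n := n) (r := varReg x)
      (m := m + 1) (B := (max n 2) ^ e.weight + 1)
      (body := .seq (e.compile (m + 3)) (.add (tmpReg m) (tmpReg m) (tmpReg (m + 3))))
      (by unfold tmpReg; omega) (by unfold tmpReg; omega) (by unfold tmpReg; omega)
      -- The register of the summation variable is left out of the invariant, because the loop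
      -- changes it and restores it only in the end.
      (fun v ω => ω.mem = σ.mem ∧
        (∀ q, q ≠ varReg x ∧ (q % 2 = 1 ∨ q < 2 * m + 2) → ω.reg q = σ.reg q) ∧
        ω.reg (tmpReg m) = ∑ v' ∈ Finset.range v, e.eval n σ.mem (Function.update (env σ) x v'))
      (fun v ω ω' ⟨h1, h2, h3⟩ h5 h6 => ⟨by rw [h5, h1], fun q hq => by
          rw [h6 q (by omega) (by unfold tmpReg; omega) (by unfold tmpReg; omega)
            (by unfold tmpReg; omega), h2 q hq],
        by rw [h6 _ (by unfold tmpReg; omega) (by unfold tmpReg; omega) (by unfold tmpReg; omega)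
            (by unfold tmpReg; omega), h3]⟩)
      (fun v _ ω ⟨h1, h2, h3⟩ hω => by
        obtain ⟨T, hT, τ, hex, hmem, hfr, hval⟩ := ih (m + 3) ω (by rw [h2 0 (by omega), hσ])
        have henv : (env ω : α → ℕ) = Function.update (env σ) x v := by
          funext y
          rcases eq_or_ne y x with rfl | hy
          · rw [Function.update_self]
            exact hω
          · rw [Function.update_of_ne hy]
            exact h2 _ ⟨fun h => hy (varReg_injective h), Or.inl (by unfold varReg; omega)⟩
        refine ⟨T + 1, by omega, _, .seq hex (.add ..), ⟨hmem.trans h1, fun q hq => ?_, ?_⟩,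
          ?_, ?_, ?_⟩
        · rw [setReg_reg_of_ne _ _ (by unfold tmpReg; omega), hfr q (by omega), h2 q hq]
        · rw [setReg_reg_self, hfr _ (by unfold tmpReg; omega), h3, hval, Finset.sum_range_succ,
            henv, h1]
        · rw [setReg_reg_of_ne _ _ (by unfold tmpReg; omega), hfr _ (by omega)]
        · rw [setReg_reg_of_ne _ _ (by unfold tmpReg; omega), hfr _ (by unfold tmpReg; omega)]
        · rw [setReg_reg_of_ne _ _ (by unfold tmpReg; omega), hfr _ (by unfold tmpReg; omega)])
      (σ.setReg (tmpReg m) 0)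
      (by rw [setReg_reg_of_ne _ _ (by unfold tmpReg; omega), hσ])
      ⟨rfl, fun q hq => setReg_reg_of_ne _ _ (by unfold tmpReg; omega),
        by rw [setReg_reg_self, Finset.sum_range_zero]⟩
    refine ⟨1 + U, ?_, ω, .seq (.const ..) hex', hI.1, fun q hq => ?_, hI.2.2⟩
    · have h1 := loop_cost_le hX hn (le_refl ((max n 2) ^ e.weight))
      simp only [Expr.weight]
      omega
    · rcases eq_or_ne q (varReg x) with rfl | hq'
      · rw [hr, setReg_reg_of_ne _ _ (by unfold tmpReg; omega)]
      · exact hI.2.1 q (by omega)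

theorem Stmt.exists_exec (n : ℕ) (s : Stmt α) (m : ℕ) (σ : State) (hσ : σ.reg 0 = n) :
    ∃ T ≤ (max n 2) ^ s.weight, ∃ τ, Exec (s.compile m) σ T τ ∧
      τ.mem = s.run n (env σ) σ.mem ∧ Frame m σ τ := by
  have hX : 2 ≤ max n 2 := le_max_right _ _
  have hn : n ≤ max n 2 := le_max_left _ _
  induction s generalizing m σ with
  | store e f =>
    obtain ⟨T, hT, τ, hex, hmem, hfr, hval⟩ := e.exists_exec n m σ hσ
    obtain ⟨U, hU, ω, hex', hmem', hfr', hval'⟩ := f.exists_exec n (m + 1) τ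
      (by rw [hfr 0 (by omega), hσ])
    refine ⟨T + (U + 1), seq_cost_le hX hT hU, _, .seq hex (.seq hex' (.store ..)), ?_,
      fun q hq => (hfr.trans hfr' (Nat.le_succ m)) q hq⟩
    rw [hfr' _ (by unfold tmpReg; omega), hval, hval', hfr.env_eq, hmem]
    simp only [State.setMem, Stmt.run, hmem', hmem]
  | seq s t ihs iht =>
    obtain ⟨T, hT, τ, hex, hmem, hfr⟩ := ihs m σ hσ
    obtain ⟨U, hU, ω, hex', hmem', hfr'⟩ := iht m τ (by rw [hfr 0 (by omega), hσ])
    refine ⟨T + U, ?_, ω, .seq hex hex', ?_, hfr.trans hfr' le_rfl⟩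
    · have := seq_cost_le hX hT hU
      simp only [Stmt.weight]
      omega
    · rw [hmem', hfr.env_eq, hmem]
      rfl
  | loop x s ih =>
    have hvr : varReg x % 2 = 1 := by unfold varReg; omega
    obtain ⟨U, hU, ω, hex', hI, hr⟩ := exists_exec_forLoop (n := n) (r := varReg x)
      (m := m) (B := (max n 2) ^ s.weight) (body := s.compile (m + 2))
      (by unfold tmpReg; omega) (by unfold tmpReg; omega) (by unfold tmpReg; omega)
      (fun v ω => ω.mem = Nat.rec σ.mem (fun v μ => s.run n (Function.update (env σ) x v) μ) v ∧
        (∀ q, q ≠ varReg x ∧ (q % 2 = 1 ∨ q < 2 * m + 2) → ω.reg q = σ.reg q))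
      (fun v ω ω' ⟨h1, h2⟩ h5 h6 => ⟨by rw [h5, h1], fun q hq => by
          rw [h6 q (by omega) (by unfold tmpReg; omega) (by unfold tmpReg; omega)
            (by unfold tmpReg; omega), h2 q hq]⟩)
      (fun v _ ω ⟨h1, h2⟩ hω => by
        obtain ⟨T, hT, τ, hex, hmem, hfr⟩ := ih (m + 2) ω (by rw [h2 0 (by omega), hσ])
        have henv : (env ω : α → ℕ) = Function.update (env σ) x v := by
          funext y
          rcases eq_or_ne y x with rfl | hy
          · rw [Function.update_self]
            exact hω
          · rw [Function.update_of_ne hy]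
            exact h2 _ ⟨fun h => hy (varReg_injective h), Or.inl (by unfold varReg; omega)⟩
        refine ⟨T, hT, τ, hex, ⟨?_, fun q hq => ?_⟩, hfr _ (by omega),
          hfr _ (by unfold tmpReg; omega), hfr _ (by unfold tmpReg; omega)⟩
        · rw [hmem, henv, h1]
        · rw [hfr q (by omega), h2 q hq])
      σ hσ ⟨rfl, fun q hq => rfl⟩
    refine ⟨U, ?_, ω, hex', hI.1, fun q hq => ?_⟩
    · have h1 := loop_cost_le hX hn (le_refl ((max n 2) ^ s.weight))
      have h2 : n * ((max n 2) ^ s.weight + 4) ≤ n * ((max n 2) ^ s.weight + 1 + 4) :=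
        Nat.mul_le_mul_left _ (by omega)
      simp only [Stmt.weight]
      omega
    · rcases eq_or_ne q (varReg x) with rfl | hq'
      · exact hr
      · exact hI.2 q (by omega)

end DisjointShortestPaths

namespace DisjointShortestPaths

/-! ### Logical connectives -/

section logic

variable {α : Type}

/-- Truth means being nonzero. With truncated subtraction `1 - e` is negation, addition is
disjunction, and a sum over `x < n` is existential quantification. -/
protected def Expr.not (e : Expr α) : Expr α := .sub (.const 1) e

protected def Expr.or (e f : Expr α) : Expr α := .add e f

protected def Expr.and (e f : Expr α) : Expr α := (e.not.or f.not).not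

protected def Expr.eq (e f : Expr α) : Expr α := (Expr.add (.sub e f) (.sub f e)).not

def Expr.all (l : List (Expr α)) : Expr α := l.foldr Expr.and (.const 1)

def Expr.any (l : List (Expr α)) : Expr α := l.foldr Expr.or (.const 0)

/-- Existential quantification over values `< n` of the variables `xs`. -/
def Expr.ex (xs : List α) (e : Expr α) : Expr α := xs.foldr Expr.sum e

def Stmt.loops (xs : List α) (s : Stmt α) : Stmt α := xs.foldr Stmt.loop s

/-- The index of a tuple of numbers `< n`. -/
def tupleIdx (n : ℕ) : List ℕ → ℕ
  | [] => 0
  | v :: l => v + n * tupleIdx n l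

def Expr.idx : List (Expr α) → Expr α
  | [] => .const 0
  | e :: l => .add e (.scale (Expr.idx l))

/-- The entry of the table at address `base` with the given indices. -/
def Expr.entry (base : Expr α) (l : List (Expr α)) : Expr α := .load (.add base (Expr.idx l))

/-- Compute the least fixed point of `φ` in the table at address `base` that is indexed by the
variables `xs`, in `n ^ ys.length` rounds. -/
def Stmt.fillTable (base : Expr α) (xs ys : List α) (φ : Expr α) : Stmt α :=
  .loops ys <| .loops xs <| .store (.add base (Expr.idx (xs.map .var)))
    ((Expr.entry base (xs.map .var)).or φ)

end logic

variable {α : Type} [DecidableEq α] {n : ℕ} {μ : ℕ → ℕ} {ρ : α → ℕ}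

/-- The truth of an expression. -/
def Expr.Holds (n : ℕ) (μ : ℕ → ℕ) (e : Expr α) (ρ : α → ℕ) : Prop := e.eval n μ ρ ≠ 0

@[simp] theorem holds_not {e : Expr α} : e.not.Holds n μ ρ ↔ ¬ e.Holds n μ ρ := by
  simp only [Expr.Holds, Expr.not, Expr.eval]
  omega

@[simp] theorem holds_or {e f : Expr α} :
    (e.or f).Holds n μ ρ ↔ e.Holds n μ ρ ∨ f.Holds n μ ρ := by
  simp only [Expr.Holds, Expr.or, Expr.eval]
  omega

@[simp] theorem holds_and {e f : Expr α} :
    (e.and f).Holds n μ ρ ↔ e.Holds n μ ρ ∧ f.Holds n μ ρ := by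
  rw [Expr.and, holds_not, holds_or, holds_not, holds_not]
  tauto

@[simp] theorem holds_eq {e f : Expr α} :
    (e.eq f).Holds n μ ρ ↔ e.eval n μ ρ = f.eval n μ ρ := by
  rw [Expr.eq, holds_not]
  simp only [Expr.Holds, Expr.eval]
  omega

@[simp] theorem holds_all {l : List (Expr α)} :
    (Expr.all l).Holds n μ ρ ↔ ∀ e ∈ l, e.Holds n μ ρ := by
  induction l with
  | nil => simp [Expr.all, Expr.Holds, Expr.eval]
  | cons e l ih =>
    rw [show Expr.all (e :: l) = e.and (Expr.all l) from rfl, holds_and, ih]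
    simp

@[simp] theorem holds_any {l : List (Expr α)} :
    (Expr.any l).Holds n μ ρ ↔ ∃ e ∈ l, e.Holds n μ ρ := by
  induction l with
  | nil => simp [Expr.any, Expr.Holds, Expr.eval]
  | cons e l ih =>
    rw [show Expr.any (e :: l) = e.or (Expr.any l) from rfl, holds_or, ih]
    simp

theorem holds_sum {x : α} {e : Expr α} :
    (Expr.sum x e).Holds n μ ρ ↔ ∃ v < n, e.Holds n μ (Function.update ρ x v) := by
  simp only [Expr.Holds, Expr.eval, Ne, Finset.sum_eq_zero_iff, Finset.mem_range]
  push Not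
  rfl

theorem holds_ex {xs : List α} {e : Expr α} :
    (Expr.ex xs e).Holds n μ ρ ↔
      ∃ ρ' : α → ℕ, (∀ x ∈ xs, ρ' x < n) ∧ (∀ x ∉ xs, ρ' x = ρ x) ∧ e.Holds n μ ρ' := by
  induction xs generalizing ρ with
  | nil =>
    refine ⟨fun h => ⟨ρ, by simp, by simp, h⟩, fun ⟨ρ', _, h, h'⟩ => ?_⟩
    have : ρ' = ρ := funext fun x => h x (by simp)
    rwa [this] at h'
  | cons x xs ih =>
    rw [show Expr.ex (x :: xs) e = .sum x (Expr.ex xs e) from rfl, holds_sum]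
    simp only [ih]
    constructor
    · rintro ⟨v, hv, ρ', h1, h2, h3⟩
      refine ⟨ρ', fun y hy => ?_, fun y hy => ?_, h3⟩
      · by_cases hy' : y ∈ xs
        · exact h1 y hy'
        · obtain rfl : y = x := by simpa [hy'] using hy
          rw [h2 y hy', Function.update_self]
          exact hv
      · rw [List.mem_cons, not_or] at hy
        rw [h2 y hy.2, Function.update_of_ne hy.1]
    · rintro ⟨ρ', h1, h2, h3⟩
      refine ⟨ρ' x, h1 x (by simp), ρ', fun y hy => h1 y (by simp [hy]), fun y hy => ?_, h3⟩
      rcases eq_or_ne y x with rfl | hyx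
      · rw [Function.update_self]
      · rw [Function.update_of_ne hyx, h2 y (by simp [hy, hyx])]

theorem eval_idx (l : List (Expr α)) :
    (Expr.idx l).eval n μ ρ = tupleIdx n (l.map fun e => e.eval n μ ρ) := by
  induction l with
  | nil => rfl
  | cons e l ih => simp only [Expr.idx, Expr.eval, ih, List.map_cons, tupleIdx]

theorem tupleIdx_lt {n : ℕ} {l : List ℕ} (h : ∀ v ∈ l, v < n) : tupleIdx n l < n ^ l.length := by
  induction l with
  | nil => simp [tupleIdx]
  | cons v l ih =>
    have h1 := ih fun v hv => h v (by simp [hv])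
    have h2 := h v (by simp)
    simp only [tupleIdx, List.length_cons, pow_succ']
    calc v + n * tupleIdx n l < n + n * tupleIdx n l := by omega
      _ = n * (tupleIdx n l + 1) := by ring
      _ ≤ n * n ^ l.length := Nat.mul_le_mul_left _ h1

theorem tupleIdx_inj {n : ℕ} {l l' : List ℕ} (hlen : l.length = l'.length) (h : ∀ v ∈ l, v < n)
    (h' : ∀ v ∈ l', v < n) (heq : tupleIdx n l = tupleIdx n l') : l = l' := by
  induction l generalizing l' with
  | nil => exact (List.eq_nil_of_length_eq_zero hlen.symm).symm
  | cons v l ih =>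
    cases l' with
    | nil => simp at hlen
    | cons v' l' =>
      have h1 := h v (by simp)
      have h2 := h' v' (by simp)
      simp only [tupleIdx] at heq
      have h3 : v = v' := by
        have := congrArg (· % n) heq
        simpa [Nat.add_mul_mod_self_left, Nat.mod_eq_of_lt h1, Nat.mod_eq_of_lt h2] using this
      subst h3
      rw [ih (by simpa using hlen) (fun v hv => h v (by simp [hv]))
        (fun v hv => h' v (by simp [hv])) (Nat.eq_of_mul_eq_mul_left (by omega) (Nat.add_left_cancel heq))]

/-! ### Loops -/

theorem run_loop_induction (J : ℕ → (ℕ → ℕ) → Prop) {x : α} {s : Stmt α} (h0 : J 0 μ)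
    (hs : ∀ v < n, ∀ μ, J v μ → J (v + 1) (s.run n (Function.update ρ x v) μ)) :
    J n ((Stmt.loop x s).run n ρ μ) := by
  have : ∀ v ≤ n, J v (Nat.rec μ (fun v μ' => s.run n (Function.update ρ x v) μ') v) := by
    intro v
    induction v with
    | zero => exact fun _ => h0
    | succ v ih => exact fun hv => hs v hv _ (ih (by omega))
  exact this n le_rfl

theorem run_loops_invariant {I : (ℕ → ℕ) → Prop} {s : Stmt α} (xs : List α)
    (hI : ∀ ρ' : α → ℕ, (∀ x ∉ xs, ρ' x = ρ x) → (∀ x ∈ xs, ρ' x < n) → ∀ μ, I μ →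
      I (s.run n ρ' μ)) (h0 : I μ) : I ((Stmt.loops xs s).run n ρ μ) := by
  induction xs generalizing ρ μ with
  | nil => exact hI ρ (fun _ _ => rfl) (by simp) μ h0
  | cons x xs ih =>
    refine run_loop_induction (fun _ => I) h0 fun v hv μ hμ => ih (fun ρ' h1 h2 => ?_) hμ
    refine hI ρ' (fun y hy => ?_) fun y hy => ?_
    · rw [List.mem_cons, not_or] at hy
      rw [h1 y hy.2, Function.update_of_ne hy.1]
    · by_cases hy' : y ∈ xs
      · exact h2 y hy'
      · obtain rfl : y = x := by simpa [hy'] using hy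
        rw [h1 y hy', Function.update_self]
        exact hv

/-- A property that is preserved by the body of the loops, and is established by it for one of the
values of the variables, holds in the end. -/
theorem run_loops_visit {I Q : (ℕ → ℕ) → Prop} {s : Stmt α} (xs : List α)
    (hI : ∀ ρ' : α → ℕ, (∀ x ∉ xs, ρ' x = ρ x) → (∀ x ∈ xs, ρ' x < n) → ∀ μ, I μ →
      I (s.run n ρ' μ))
    (hQ : ∀ ρ' : α → ℕ, (∀ x ∉ xs, ρ' x = ρ x) → (∀ x ∈ xs, ρ' x < n) → ∀ μ, I μ → Q μ →
      Q (s.run n ρ' μ))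
    (ρ₁ : α → ℕ) (h1 : ∀ x ∉ xs, ρ₁ x = ρ x) (h2 : ∀ x ∈ xs, ρ₁ x < n)
    (hvisit : ∀ μ, I μ → Q (s.run n ρ₁ μ)) (h0 : I μ) : Q ((Stmt.loops xs s).run n ρ μ) := by
  induction xs generalizing ρ μ with
  | nil =>
    have : ρ₁ = ρ := funext fun x => h1 x (by simp)
    exact this ▸ hvisit μ h0
  | cons x xs ih =>
    have hsub : ∀ v < n, ∀ ρ' : α → ℕ, (∀ y ∉ xs, ρ' y = Function.update ρ x v y) →
        (∀ y ∈ xs, ρ' y < n) → (∀ y ∉ x :: xs, ρ' y = ρ y) ∧ ∀ y ∈ x :: xs, ρ' y < n := by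
      intro v hv ρ' h1 h2
      refine ⟨fun y hy => ?_, fun y hy => ?_⟩
      · rw [List.mem_cons, not_or] at hy
        rw [h1 y hy.2, Function.update_of_ne hy.1]
      · by_cases hy' : y ∈ xs
        · exact h2 y hy'
        · obtain rfl : y = x := by simpa [hy'] using hy
          rw [h1 y hy', Function.update_self]
          exact hv
    have := run_loop_induction (n := n) (ρ := ρ) (x := x) (s := Stmt.loops xs s) (μ := μ)
      (fun v μ => I μ ∧ (ρ₁ x < v → Q μ)) ⟨h0, fun h => absurd h (Nat.not_lt_zero _)⟩
      (fun v hv μ ⟨hμ, hμQ⟩ => ⟨run_loops_invariant xs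
        (fun ρ' e1 e2 => hI ρ' (hsub v hv ρ' e1 e2).1 (hsub v hv ρ' e1 e2).2) hμ, fun hlt => ?_⟩)
    · exact this.2 (h2 x (by simp))
    · rcases Nat.lt_succ_iff_lt_or_eq.1 hlt with hlt | heq
      · exact (run_loops_invariant (I := fun μ => I μ ∧ Q μ) xs (fun ρ' e1 e2 μ hμ =>
          ⟨hI ρ' (hsub v hv ρ' e1 e2).1 (hsub v hv ρ' e1 e2).2 μ hμ.1,
            hQ ρ' (hsub v hv ρ' e1 e2).1 (hsub v hv ρ' e1 e2).2 μ hμ.1 hμ.2⟩) ⟨hμ, hμQ hlt⟩).2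
      · refine ih (fun ρ' e1 e2 => hI ρ' (hsub v hv ρ' e1 e2).1 (hsub v hv ρ' e1 e2).2)
          (fun ρ' e1 e2 => hQ ρ' (hsub v hv ρ' e1 e2).1 (hsub v hv ρ' e1 e2).2)
          (fun y hy => ?_) (fun y hy => h2 y (by simp [hy])) hμ
        rcases eq_or_ne y x with rfl | hyx
        · rw [Function.update_self, heq]
        · rw [Function.update_of_ne hyx, h1 y (by simp [hy, hyx])]

theorem run_loops_count {P : ℕ → (ℕ → ℕ) → Prop} {s : Stmt α} (ys : List α)
    (hs : ∀ r (ρ : α → ℕ) μ, P r μ → P (r + 1) (s.run n ρ μ)) {r : ℕ} (h0 : P r μ) :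
    P (r + n ^ ys.length) ((Stmt.loops ys s).run n ρ μ) := by
  induction ys generalizing ρ μ r with
  | nil => exact hs r ρ μ h0
  | cons y ys ih =>
    have := run_loop_induction (n := n) (ρ := ρ) (x := y) (s := Stmt.loops ys s) (μ := μ)
      (fun v μ => P (r + v * n ^ ys.length) μ) (by simpa using h0) (fun v hv μ hμ => by
        have := ih (ρ := Function.update ρ y v) hμ
        rwa [add_assoc, ← add_one_mul] at this)
    rwa [← pow_succ'] at this

/-- The tuples of length `len` of numbers `< n`. -/
def IsTuple (n len : ℕ) (l : List ℕ) : Prop := l.length = len ∧ ∀ v ∈ l, v < n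

theorem exists_map_eq (xs : List α) (hxs : xs.Nodup) (l : List ℕ) (h : l.length = xs.length)
    (ρ : α → ℕ) : ∃ ρ' : α → ℕ, xs.map ρ' = l ∧ ∀ x ∉ xs, ρ' x = ρ x := by
  induction xs generalizing l with
  | nil => exact ⟨ρ, by simp_all, fun _ _ => rfl⟩
  | cons x xs ih =>
    cases l with
    | nil => simp at h
    | cons v l =>
      obtain ⟨ρ', h1, h2⟩ := ih (List.nodup_cons.1 hxs).2 l (by simpa using h)
      refine ⟨Function.update ρ' x v, ?_, fun y hy => ?_⟩
      · rw [List.map_cons, Function.update_self, ← h1]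
        congr 1
        refine List.map_congr_left fun y hy => Function.update_of_ne ?_ _ _
        rintro rfl
        exact (List.nodup_cons.1 hxs).1 hy
      · rw [List.mem_cons, not_or] at hy
        rw [Function.update_of_ne hy.1, h2 y hy.2]

/-- The table computed by `fillTable` contains the tuples of rank at most `n ^ ys.length`, if `φ`
holds for a tuple of rank `r + 1` as soon as the table contains all tuples of rank `r`; and it
contains only tuples with the property `R`, if `φ` preserves this. -/
theorem run_fillTable {base φ : Expr α} {xs ys : List α} (hxs : xs.Nodup) {B : ℕ}
    (hbase : ∀ (μ : ℕ → ℕ) (ρ : α → ℕ), base.eval n μ ρ = B) {μ₀ : ℕ → ℕ}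
    (hzero : ∀ a, B ≤ a → μ₀ a = 0) {R : List ℕ → Prop} {rank : ℕ → List ℕ → Prop}
    (hsound : ∀ (μ : ℕ → ℕ) (ρ : α → ℕ), (∀ a < B, μ a = μ₀ a) →
      (∀ l, IsTuple n xs.length l → μ (B + tupleIdx n l) ≠ 0 → R l) → (∀ x ∈ xs, ρ x < n) →
      φ.Holds n μ ρ → R (xs.map ρ))
    (hcomplete : ∀ (r : ℕ) (μ : ℕ → ℕ) (ρ : α → ℕ), (∀ a < B, μ a = μ₀ a) →
      (∀ l, IsTuple n xs.length l → rank r l → μ (B + tupleIdx n l) ≠ 0) → (∀ x ∈ xs, ρ x < n) →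
      rank (r + 1) (xs.map ρ) → φ.Holds n μ ρ)
    (hrank : ∀ l, ¬ rank 0 l) (ρ : α → ℕ) :
    (∀ a, a < B ∨ B + n ^ xs.length ≤ a →
      (Stmt.fillTable base xs ys φ).run n ρ μ₀ a = μ₀ a) ∧
    ∀ l, IsTuple n xs.length l →
      (rank (n ^ ys.length) l →
        (Stmt.fillTable base xs ys φ).run n ρ μ₀ (B + tupleIdx n l) ≠ 0) ∧
      ((Stmt.fillTable base xs ys φ).run n ρ μ₀ (B + tupleIdx n l) ≠ 0 → R l) := by
  set body : Stmt α := .store (.add base (Expr.idx (xs.map .var)))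
    ((Expr.entry base (xs.map .var)).or φ) with hbody
  have hrun : ∀ (ρ : α → ℕ) (μ : ℕ → ℕ), body.run n ρ μ =
      Function.update μ (B + tupleIdx n (xs.map ρ))
        (μ (B + tupleIdx n (xs.map ρ)) + φ.eval n μ ρ) := by
    intro ρ μ
    simp only [hbody, Stmt.run, Expr.entry, Expr.or, Expr.eval, hbase, eval_idx, List.map_map,
      Function.comp_def]
  have hmap : ∀ ρ : α → ℕ, (∀ x ∈ xs, ρ x < n) → IsTuple n xs.length (xs.map ρ) := by
    intro ρ hρ
    refine ⟨by simp, fun v hv => ?_⟩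
    obtain ⟨x, hx, rfl⟩ := List.mem_map.1 hv
    exact hρ x hx
  -- Soundness invariant: nothing outside the table changes, and every entry made so far is correct.
  set Inv : (ℕ → ℕ) → Prop := fun μ => (∀ a, a < B ∨ B + n ^ xs.length ≤ a → μ a = μ₀ a) ∧
    ∀ l, IsTuple n xs.length l → μ (B + tupleIdx n l) ≠ 0 → R l with hInv
  have hInv_body : ∀ (ρ : α → ℕ), (∀ x ∈ xs, ρ x < n) → ∀ μ, Inv μ → Inv (body.run n ρ μ) := by
    rintro ρ hρ μ ⟨h1, h2⟩
    have hlt := tupleIdx_lt (hmap ρ hρ).2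
    rw [List.length_map] at hlt
    refine ⟨fun a ha => ?_, fun l hl hne => ?_⟩
    · rw [hrun, Function.update_of_ne (by omega), h1 a ha]
    · rw [hrun] at hne
      by_cases heq : tupleIdx n l = tupleIdx n (xs.map ρ)
      · have hl' := tupleIdx_inj (by rw [hl.1, List.length_map]) hl.2 (hmap ρ hρ).2 heq
        rw [hl', Function.update_self] at hne
        by_cases h3 : μ (B + tupleIdx n l) = 0
        · rw [hl'] at h3 ⊢
          exact hsound μ ρ (fun a ha => h1 a (Or.inl ha)) h2 hρ (by
            unfold Expr.Holds
            omega)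
        · exact h2 l hl h3
      · rw [Function.update_of_ne (by omega)] at hne
        exact h2 l hl hne
  -- The body only adds to an entry, so entries never disappear.
  have hmono : ∀ (ρ : α → ℕ) μ a, μ a ≠ 0 → body.run n ρ μ a ≠ 0 := by
    intro ρ μ a ha
    rw [hrun]
    by_cases h : a = B + tupleIdx n (xs.map ρ)
    · rw [h, Function.update_self]
      rw [h] at ha
      omega
    · rwa [Function.update_of_ne h]
  set P : ℕ → (ℕ → ℕ) → Prop := fun r μ => Inv μ ∧
    ∀ l, IsTuple n xs.length l → rank r l → μ (B + tupleIdx n l) ≠ 0 with hP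
  have hP_body : ∀ r (ρ : α → ℕ), (∀ x ∈ xs, ρ x < n) → ∀ μ, P r μ → P r (body.run n ρ μ) :=
    fun r ρ hρ μ hμ => ⟨hInv_body ρ hρ μ hμ.1, fun l hl hr => hmono _ _ _ (hμ.2 l hl hr)⟩
  have hfin : P (0 + n ^ ys.length) ((Stmt.fillTable base xs ys φ).run n ρ μ₀) := by
    refine run_loops_count ys (fun r ρ μ hμ => ⟨?_, fun l hl hr => ?_⟩) ⟨⟨fun _ _ => rfl,
      fun l _ h => absurd (hzero _ (Nat.le_add_right _ _)) h⟩, fun l _ h => absurd h (hrank l)⟩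
    · exact run_loops_invariant xs (fun ρ' _ hρ' => hInv_body ρ' hρ') hμ.1
    · obtain ⟨ρ₁, h1, h2⟩ := exists_map_eq xs hxs l hl.1 ρ
      have hρ₁ : ∀ x ∈ xs, ρ₁ x < n := fun x hx =>
        hl.2 _ (h1 ▸ List.mem_map_of_mem hx)
      -- One pass visits every tuple, and rank `r` stays complete during the pass. So each tuple of
      -- rank `r + 1` is entered at its visit at the latest.
      refine run_loops_visit (I := P r) (Q := fun μ => μ (B + tupleIdx n l) ≠ 0) xs
        (fun ρ' _ hρ' => hP_body r ρ' hρ') (fun ρ' _ _ μ _ hq => hmono ρ' μ _ hq) ρ₁ h2 hρ₁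
        (fun μ hμ => ?_) hμ
      have h3 := hcomplete r μ ρ₁ (fun a ha => hμ.1.1 a (Or.inl ha)) hμ.2 hρ₁ (h1 ▸ hr)
      unfold Expr.Holds at h3
      rw [hrun, h1, Function.update_self]
      omega
  rw [zero_add] at hfin
  exact ⟨hfin.1.1, fun l hl => ⟨hfin.2 l hl, hfin.1.2 l hl⟩⟩

end DisjointShortestPaths

namespace DisjointShortestPaths

open RAM

/-! ### Distances in a finite graph -/

open Classical in
/-- The distance of two vertices, and the number of vertices if they are not connected. -/
noncomputable def capDist {n : ℕ} (G : SimpleGraph (Fin n)) (u v : Fin n) : ℕ :=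
  if G.Reachable u v then G.dist u v else n

section capDist

variable {n : ℕ} (G : SimpleGraph (Fin n))

theorem capDist_of_reachable {u v : Fin n} (h : G.Reachable u v) : capDist G u v = G.dist u v :=
  if_pos h

theorem capDist_lt_of_reachable {u v : Fin n} (h : G.Reachable u v) : capDist G u v < n := by
  rw [capDist_of_reachable G h]
  obtain ⟨p, hp, hlen⟩ := h.exists_path_of_dist
  rw [← hlen]
  simpa using hp.length_lt

theorem capDist_le (u v : Fin n) : capDist G u v ≤ n := by
  by_cases h : G.Reachable u v
  · exact (capDist_lt_of_reachable G h).le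
  · exact (if_neg h).le

theorem reachable_of_capDist_lt {u v : Fin n} (h : capDist G u v < n) : G.Reachable u v := by
  by_contra hcon
  rw [capDist, if_neg hcon] at h
  exact lt_irrefl _ h

theorem capDist_le_length {u v : Fin n} (p : G.Walk u v) : capDist G u v ≤ p.length := by
  rw [capDist_of_reachable G ⟨p⟩]
  exact SimpleGraph.dist_le p

/-- Distances within a component are below `n`, so the default `n` is the maximum and the triangle
inequality survives. -/
theorem isNatMetric_capDist : IsNatMetric (capDist G) where
  self u := by rw [capDist_of_reachable G (.refl u), SimpleGraph.dist_self]
  eq_of {u v} h := by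
    have h1 := reachable_of_capDist_lt G (u := u) (v := v) (by rw [h]; exact u.pos)
    rw [capDist_of_reachable G h1] at h
    exact h1.dist_eq_zero_iff.1 h
  symm u v := by
    by_cases h : G.Reachable u v
    · rw [capDist_of_reachable G h, capDist_of_reachable G h.symm, SimpleGraph.dist_comm]
    · rw [capDist, capDist, if_neg h, if_neg fun h' => h h'.symm]
  tri u v w := by
    by_cases h : G.Reachable u v
    · by_cases h' : G.Reachable v w
      · obtain ⟨p, hp⟩ := h.exists_walk_length_eq_dist
        obtain ⟨q, hq⟩ := h'.exists_walk_length_eq_dist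
        have := capDist_le_length G (p.append q)
        rwa [SimpleGraph.Walk.length_append, hp, hq, ← capDist_of_reachable G h,
          ← capDist_of_reachable G h'] at this
      · have := capDist_le G u w
        rw [capDist.eq_1 G v w, if_neg h']
        omega
    · have := capDist_le G u w
      rw [capDist.eq_1 G u v, if_neg h]
      omega

theorem capDist_of_adj {u v : Fin n} (h : G.Adj u v) : capDist G u v = 1 := by
  rw [capDist_of_reachable G h.reachable, SimpleGraph.dist_eq_one_iff_adj.2 h]

theorem exists_adj_capDist {u v : Fin n} (h : capDist G u v < n) (huv : u ≠ v) :
    ∃ w, G.Adj w v ∧ capDist G u w + 1 = capDist G u v := by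
  have hr := reachable_of_capDist_lt G h
  obtain ⟨p, hp⟩ := hr.exists_walk_length_eq_dist
  have hnil : ¬ p.Nil := SimpleGraph.Walk.not_nil_of_ne huv
  have hadj := p.adj_penultimate hnil
  refine ⟨p.penultimate, hadj, ?_⟩
  have h1 := capDist_le_length G p.dropLast
  have h2 := (isNatMetric_capDist G).tri u p.penultimate v
  rw [capDist_of_adj G hadj] at h2
  have h3 := p.length_dropLast_add_one hnil
  rw [hp, ← capDist_of_reachable G hr] at h3
  omega

end capDist

/-! ### The program -/

/-- The variables of the program: the marks, the start, the end and the position of every token,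
and four auxiliary variables. -/
abbrev Name (k M : ℕ) : Type := (Fin k × Fin (M + 1)) ⊕ ((Fin k × Fin M) × Fin 3) ⊕ Fin 4

namespace Name

variable {k M : ℕ}

abbrev mark (i : Fin k) (r : Fin (M + 1)) : Name k M := .inl (i, r)

abbrev src (σ : Fin k × Fin M) : Name k M := .inr (.inl (σ, 0))

abbrev dst (σ : Fin k × Fin M) : Name k M := .inr (.inl (σ, 1))

abbrev pos (σ : Fin k × Fin M) : Name k M := .inr (.inl (σ, 2))

abbrev aux (j : Fin 4) : Name k M := .inr (.inr j)

end Name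

open Name

section program

variable (k M : ℕ)

noncomputable def tokens : List (Fin k × Fin M) := Finset.univ.toList

noncomputable def markIndices : List (Fin k × Fin (M + 1)) := Finset.univ.toList

/-- The address of the table of distances. -/
def distBase : Expr (Name k M) := .add (.scale .size) (.const (2 * k))

/-- The address of the table of configurations. -/
def configBase : Expr (Name k M) := .add (distBase k M) (.scale (.scale .size))

variable {k M}

def adjE (p q : Name k M) : Expr (Name k M) := .load (.add (.scale (.var p)) (.var q))

def distLeE (p q d : Name k M) : Expr (Name k M) :=
  .entry (distBase k M) [.var p, .var q, .var d]

/-- The distance of `p` and `q`. -/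
def distE (p q : Name k M) : Expr (Name k M) := .sum (aux 2) (distLeE p q (aux 2)).not

def eqE (p q : Name k M) : Expr (Name k M) := .eq (.var p) (.var q)

/-- The distance of `aux 0` and `aux 1` is at most `aux 2`. -/
def distRule : Expr (Name k M) :=
  (eqE (aux 0) (aux 1)).or <| .sum (aux 3) <| Expr.and (adjE (aux 3) (aux 1)) <|
    -- The bound must be positive, as subtraction is truncated at zero.
    Expr.and (.var (aux 2)) <|
      .entry (distBase k M) [.var (aux 0), .var (aux 3), .sub (.var (aux 2)) (.const 1)]

noncomputable def fillDist : Stmt (Name k M) :=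
  .fillTable (distBase k M) [aux 0, aux 1, aux 2] [aux 0] distRule

variable (k M) in
noncomputable def configVars : List (Name k M) :=
  (tokens k M).map src ++ ((tokens k M).map dst ++ (tokens k M).map pos)

/-- The token `τ` with position `p` is not in the way of the token `σ`. -/
noncomputable def clearE (σ τ : Fin k × Fin M) : Expr (Name k M) :=
  Expr.and (eqE (pos σ) (src τ)).not <| Expr.and (eqE (pos σ) (dst τ)).not <|
    if τ = σ then .const 1 else (Expr.eq (.add (distE (src τ) (pos σ)) (distE (pos σ) (pos τ)))
      (distE (src τ) (pos τ))).not

/-- The token `σ` may move from `aux 0` to `pos σ`. -/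
noncomputable def moveE (σ : Fin k × Fin M) : Expr (Name k M) :=
  Expr.and (adjE (aux 0) (pos σ)) <|
    Expr.and (.eq (.add (distE (pos σ) (dst σ)) (.const 1)) (distE (aux 0) (dst σ))) <|
      (eqE (pos σ) (dst σ)).or (.all ((tokens k M).map (clearE σ)))

/-- The configuration is in the table if the token `σ` is moved back to `aux 0`. -/
noncomputable def beforeE (σ : Fin k × Fin M) : Expr (Name k M) :=
  .entry (configBase k M) ((tokens k M).map (fun τ => .var (src τ)) ++
    ((tokens k M).map (fun τ => .var (dst τ)) ++
      (tokens k M).map fun τ => if τ = σ then .var (aux 0) else .var (pos τ)))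

/-- The table is filled backwards: an entry describes the configuration after a move, and `aux 0`
guesses the previous vertex of the token that moved. -/
noncomputable def configRule : Expr (Name k M) :=
  (Expr.all ((tokens k M).map fun σ => eqE (pos σ) (src σ))).or <|
    .any ((tokens k M).map fun σ => .sum (aux 0) ((beforeE σ).and (moveE σ)))

/-- The repeated loop variable serves only as a counter of `n ^ (k * M + 1)` rounds. -/
noncomputable def fillConfig : Stmt (Name k M) :=
  .fillTable (configBase k M) (configVars k M) (List.replicate (k * M + 1) (aux 0)) configRule

/-- The `i`-th of the `2 * k` given vertices. -/
def terminalE (i : ℕ) : Expr (Name k M) := .load (.add (.scale .size) (.const i))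

/-- The conditions on the marks and the ends of the tokens. -/
noncomputable def marksE : Expr (Name k M) :=
  Expr.and (.all ((markIndices k M).map fun q => Expr.and
      (.eq (.var (mark q.1 0)) (terminalE q.1))
      (.eq (.var (mark q.1 (Fin.last M))) (terminalE (k + q.1))))) <|
  Expr.and (.all ((tokens k M).map fun σ => .eq (distE (mark σ.1 0) (mark σ.1 (Fin.succ σ.2)))
      (.add (distE (mark σ.1 0) (mark σ.1 (Fin.castSucc σ.2)))
        (distE (mark σ.1 (Fin.castSucc σ.2)) (mark σ.1 (Fin.succ σ.2)))))) <|
  Expr.and (.all ((tokens k M).map fun σ => Expr.or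
      (Expr.and (eqE (src σ) (mark σ.1 (Fin.castSucc σ.2)))
        (eqE (dst σ) (mark σ.1 (Fin.succ σ.2))))
      (Expr.and (eqE (src σ) (mark σ.1 (Fin.succ σ.2)))
        (eqE (dst σ) (mark σ.1 (Fin.castSucc σ.2)))))) <|
  .all ((markIndices k M).map fun q => .all ((markIndices k M).map fun q' =>
    if q.1 = q'.1 then .const 1 else (eqE (mark q.1 q.2) (mark q'.1 q'.2)).not.or
      ((eqE (mark q.1 q.2) (mark q.1 0)).or (eqE (mark q.1 q.2) (mark q.1 (Fin.last M))))))

noncomputable def finalE : Expr (Name k M) :=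
  .entry (configBase k M) ((tokens k M).map (fun τ => .var (src τ)) ++
    ((tokens k M).map (fun τ => .var (dst τ)) ++ (tokens k M).map fun τ => .var (dst τ)))

variable (k M)

/-- The double negation turns the number of witnesses into `0` or `1`. -/
noncomputable def answerE : Expr (Name k M) :=
  (Expr.ex ((markIndices k M).map (fun q => mark q.1 q.2) ++
    ((tokens k M).map src ++ (tokens k M).map dst)) (marksE.and finalE)).not.not

noncomputable def decider : Prog :=
  .seq ((Stmt.seq fillDist fillConfig : Stmt (Name k M)).compile 0) <|
    .seq ((answerE k M).compile 0) <| .seq (.const 0 0) (.add 0 0 (tmpReg 0))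

end program

end DisjointShortestPaths

namespace DisjointShortestPaths

open RAM Name

/-! ### Correctness of the program -/

section input

variable {n k : ℕ} (G : SimpleGraph (Fin n)) (s t : Fin k → Fin n)

theorem inputState_adj (u v : Fin n) :
    (inputState G s t).mem (n * u + v) ≠ 0 ↔ G.Adj u v := by
  have h : n * u + v < n * n := by
    have := Nat.mul_le_mul_left n u.isLt
    have := v.isLt
    rw [Nat.succ_eq_add_one, mul_add] at *
    omega
  have h1 : Fin.divNat ⟨n * u + v, h⟩ = u := by
    refine Fin.ext ?_
    simp only [Fin.divNat]
    rw [Nat.mul_add_div v.pos, Nat.div_eq_of_lt v.isLt, add_zero]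
  have h2 : Fin.modNat ⟨n * u + v, h⟩ = v := by
    refine Fin.ext ?_
    simp only [Fin.modNat]
    rw [Nat.mul_add_mod, Nat.mod_eq_of_lt v.isLt]
  simp only [inputState, dif_pos h, h1, h2]
  split_ifs <;> simp_all

theorem inputState_left (i : Fin k) : (inputState G s t).mem (n * n + i) = s i := by
  have h : ¬ n * n + (i : ℕ) < n * n := by omega
  simp [inputState]

theorem inputState_right (i : Fin k) : (inputState G s t).mem (n * n + (k + i)) = t i := by
  have h : ¬ n * n + (k + (i : ℕ)) < n * n := by omega
  simp [inputState]

theorem inputState_zero {a : ℕ} (ha : n * n + 2 * k ≤ a) : (inputState G s t).mem a = 0 := by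
  have h1 : ¬ a < n * n := by omega
  have h2 : ¬ a - n * n < k := by omega
  have h3 : ¬ a - n * n - k < k := by omega
  simp [inputState, h1, h2, h3]

end input

theorem holds_entry {α : Type} [DecidableEq α] {n : ℕ} {μ : ℕ → ℕ} {ρ : α → ℕ} {base : Expr α}
    {l : List (Expr α)} : (Expr.entry base l).Holds n μ ρ ↔
      μ (base.eval n μ ρ + tupleIdx n (l.map fun e => e.eval n μ ρ)) ≠ 0 := by
  rw [← eval_idx]
  rfl

section tables

variable {n k M : ℕ} {G : SimpleGraph (Fin n)} {s t : Fin k → Fin n} {μ : ℕ → ℕ}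
  {ρ : Name k M → ℕ}

theorem eval_distBase : (distBase k M).eval n μ ρ = n * n + 2 * k := rfl

theorem eval_configBase : (configBase k M).eval n μ ρ = n * n + 2 * k + n ^ 3 := by
  simp only [configBase, Expr.eval, eval_distBase]
  ring

theorem holds_eqE {p q : Name k M} : (eqE p q).Holds n μ ρ ↔ ρ p = ρ q := holds_eq

theorem holds_adjE (hμ : ∀ a < n * n + 2 * k, μ a = (inputState G s t).mem a) {p q : Name k M}
    {u v : Fin n} (hp : ρ p = u) (hq : ρ q = v) : (adjE p q).Holds n μ ρ ↔ G.Adj u v := by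
  have h : n * u + v < n * n + 2 * k := by
    have := Nat.mul_le_mul_left n u.isLt
    have := v.isLt
    rw [Nat.succ_eq_add_one, mul_add] at *
    omega
  rw [← inputState_adj G s t, ← hμ _ h, ← hp, ← hq]
  rfl

/-- The table of distances in the memory is correct. -/
def IsDistTable (G : SimpleGraph (Fin n)) (k : ℕ) (μ : ℕ → ℕ) : Prop :=
  ∀ (u v : Fin n) (d : ℕ), d < n →
    (μ (n * n + 2 * k + tupleIdx n [(u : ℕ), (v : ℕ), d]) ≠ 0 ↔ capDist G u v ≤ d)

/-- The distance is the number of `d < n` that are not upper bounds for it. This count is `n` for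
disconnected vertices, in agreement with `capDist`. -/
theorem eval_distE (hμ : IsDistTable G k μ) {p q : Name k M} {u v : Fin n} (hp : ρ p = u)
    (hq : ρ q = v) (hp' : p ≠ aux 2) (hq' : q ≠ aux 2) :
    (distE p q).eval n μ ρ = capDist G u v := by
  have h1 : ∀ d ∈ Finset.range n, (distLeE p q (aux 2)).not.eval n μ
      (Function.update ρ (aux 2) d) = if d < capDist G u v then 1 else 0 := by
    intro d hd
    have h2 := hμ u v d (Finset.mem_range.1 hd)
    have h3 : (distLeE p q (aux 2)).eval n μ (Function.update ρ (aux 2) d) =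
        μ (n * n + 2 * k + tupleIdx n [(u : ℕ), (v : ℕ), d]) := by
      simp only [distLeE, Expr.entry, Expr.eval, eval_distBase, eval_idx, List.map_cons,
        List.map_nil, Function.update_self, Function.update_of_ne hp', Function.update_of_ne hq',
        hp, hq]
    simp only [Expr.not, Expr.eval, h3]
    split_ifs <;> omega
  have h4 : (Finset.range n).filter (fun d => d < capDist G u v) =
      Finset.range (capDist G u v) := by
    ext d
    have := capDist_le G u v
    simp only [Finset.mem_filter, Finset.mem_range]
    omega
  simp only [distE, Expr.eval]
  rw [Finset.sum_congr rfl h1, Finset.sum_boole, h4, Finset.card_range, Nat.cast_id]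

theorem run_fillDist (ρ : Name k M → ℕ) :
    (∀ a, a < n * n + 2 * k ∨ n * n + 2 * k + n ^ 3 ≤ a →
      (fillDist : Stmt (Name k M)).run n ρ (inputState G s t).mem a =
        (inputState G s t).mem a) ∧
      IsDistTable G k ((fillDist : Stmt (Name k M)).run n ρ (inputState G s t).mem) := by
  have hD := isNatMetric_capDist G
  have h := run_fillTable (n := n) (base := distBase k M) (φ := distRule)
    (xs := [aux 0, aux 1, aux 2]) (ys := [aux 0]) (by simp) (B := n * n + 2 * k)
    (fun _ _ => rfl) (μ₀ := (inputState G s t).mem) (fun a ha => inputState_zero G s t ha)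
    (R := fun l => ∃ (u v : Fin n) (d : ℕ), l = [(u : ℕ), (v : ℕ), d] ∧ capDist G u v ≤ d)
    -- The value `d` is settled after `d + 1` rounds, so `n` rounds suffice.
    (rank := fun r l => ∃ (u v : Fin n) (d : ℕ), l = [(u : ℕ), (v : ℕ), d] ∧
      capDist G u v ≤ d ∧ d < r ∧ d < n) ?_ ?_ (fun l ⟨_, _, _, _, _, h, _⟩ => Nat.not_lt_zero _ h) ρ
  · refine ⟨h.1, fun u v d hd => ?_⟩
    have h2 := h.2 [(u : ℕ), (v : ℕ), d] ⟨rfl, by simp [hd]⟩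
    refine ⟨fun hne => ?_, fun hle => h2.1 ⟨u, v, d, rfl, hle, by simpa using hd, hd⟩⟩
    obtain ⟨u', v', d', heq, hle⟩ := h2.2 hne
    simp only [List.cons.injEq, and_true] at heq
    rwa [Fin.ext heq.1, Fin.ext heq.2.1, heq.2.2]
  · intro μ ρ hμ hT hρ hφ
    obtain ⟨u, hu⟩ : ∃ u : Fin n, ρ (aux 0) = u := ⟨⟨_, hρ (aux 0) (by simp)⟩, rfl⟩
    obtain ⟨v, hv⟩ : ∃ v : Fin n, ρ (aux 1) = v := ⟨⟨_, hρ (aux 1) (by simp)⟩, rfl⟩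
    have hd := hρ (aux 2) (by simp)
    refine ⟨u, v, ρ (aux 2), by simp [hu, hv], ?_⟩
    rw [distRule, holds_or, holds_sum] at hφ
    rcases hφ with hφ | ⟨w, hw, hφ⟩
    · rw [holds_eqE, hu, hv] at hφ
      rw [Fin.ext hφ, hD.self]
      exact Nat.zero_le _
    · rw [holds_and, holds_and, holds_adjE (u := ⟨w, hw⟩) (v := v) hμ (by simp) (by simpa using hv),
        holds_entry] at hφ
      obtain ⟨h1, h2, h3⟩ := hφ
      simp only [Expr.Holds, Expr.eval] at h2
      simp [Expr.eval, eval_distBase, hu] at h2 h3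
      obtain ⟨u', w', d', heq, hle⟩ := hT [(u : ℕ), w, ρ (aux 2) - 1] ⟨rfl, by simp; omega⟩ h3
      simp only [List.cons.injEq, and_true] at heq
      have h4 := hD.tri u ⟨w, hw⟩ v
      rw [capDist_of_adj G h1] at h4
      rw [← Fin.ext heq.1, ← Fin.ext (a := ⟨w, hw⟩) heq.2.1] at hle
      omega
  · rintro r μ ρ hμ hT hρ ⟨u, v, d, heq, hle, hdr, hd⟩
    simp only [List.map_cons, List.map_nil, List.cons.injEq, and_true] at heq
    obtain ⟨hu, hv, hd'⟩ := heq
    rw [distRule, holds_or, holds_sum]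
    by_cases huv : u = v
    · left
      rw [holds_eqE, hu, hv, huv]
    · right
      obtain ⟨w, hwv, hw⟩ := exists_adj_capDist G (lt_of_le_of_lt hle hd) huv
      refine ⟨w, w.isLt, ?_⟩
      rw [holds_and, holds_and, holds_adjE (u := w) (v := v) hμ (by simp) (by simpa using hv),
        holds_entry]
      refine ⟨hwv, ?_, ?_⟩
      · simp only [Expr.Holds, Expr.eval]
        simp [hd']
        omega
      · have := hT [(u : ℕ), (w : ℕ), d - 1] ⟨rfl, by simp; omega⟩
          ⟨u, w, d - 1, rfl, by omega, by omega, by omega⟩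
        simpa [Expr.eval, eval_distBase, hu, hd'] using this

end tables

end DisjointShortestPaths

namespace DisjointShortestPaths

open RAM Name

/-! ### The table of configurations -/

section configurations

variable {n k M : ℕ} {G : SimpleGraph (Fin n)} {s t : Fin k → Fin n} {μ : ℕ → ℕ}
  {ρ : Name k M → ℕ} {a b v : Fin k × Fin M → Fin n}

theorem mem_tokens (σ : Fin k × Fin M) : σ ∈ tokens k M := by simp [tokens]

theorem length_tokens : (tokens k M).length = k * M := by simp [tokens]

/-- The list of numbers that encodes a triple of assignments to the tokens. -/
noncomputable def encode (f g h : Fin k × Fin M → ℕ) : List ℕ :=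
  (tokens k M).map f ++ ((tokens k M).map g ++ (tokens k M).map h)

theorem encode_inj {f g h f' g' h' : Fin k × Fin M → ℕ} (heq : encode f g h = encode f' g' h') :
    f = f' ∧ g = g' ∧ h = h' := by
  obtain ⟨h1, h2⟩ := List.append_inj heq (by simp)
  obtain ⟨h2, h3⟩ := List.append_inj h2 (by simp)
  have key : ∀ {f f' : Fin k × Fin M → ℕ}, (tokens k M).map f = (tokens k M).map f' → f = f' :=
    fun h => funext fun σ => List.map_inj_left.1 h σ (mem_tokens σ)
  exact ⟨key h1, key h2, key h3⟩

theorem map_configVars (ρ : Name k M → ℕ) : (configVars k M).map ρ =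
    encode (fun σ => ρ (src σ)) (fun σ => ρ (dst σ)) fun σ => ρ (pos σ) := by
  simp only [configVars, encode, List.map_append, List.map_map, Function.comp_def]

theorem isTuple_encode {f g h : Fin k × Fin M → Fin n} :
    IsTuple n (configVars k M).length
      (encode (fun σ => (f σ : ℕ)) (fun σ => (g σ : ℕ)) fun σ => (h σ : ℕ)) := by
  refine ⟨by simp [configVars, encode], fun x hx => ?_⟩
  simp only [encode, List.mem_append, List.mem_map] at hx
  rcases hx with ⟨σ, -, rfl⟩ | ⟨σ, -, rfl⟩ | ⟨σ, -, rfl⟩ <;> exact Fin.isLt _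

theorem nodup_configVars : (configVars k M).Nodup := by
  have h0 : (tokens k M).Nodup := Finset.nodup_toList _
  refine List.Nodup.append (h0.map fun σ τ h => by simpa using h)
    (List.Nodup.append (h0.map fun σ τ h => by simpa using h)
      (h0.map fun σ τ h => by simpa using h) ?_) ?_
  · intro x hx hx'
    simp only [List.mem_map] at hx hx'
    obtain ⟨σ, -, rfl⟩ := hx
    simp at hx'
  · intro x hx hx'
    simp only [List.mem_append, List.mem_map] at hx hx'
    obtain ⟨σ, -, rfl⟩ := hx
    simp at hx'

/-- The total distance of the tokens from their ends. -/
noncomputable def totalDist (G : SimpleGraph (Fin n)) (b v : Fin k × Fin M → Fin n) : ℕ :=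
  ∑ σ, capDist G (v σ) (b σ)

/-- Every legal move lowers the total distance by one, so this distance counts the moves made,
whatever their order. -/
theorem Legal.totalDist_eq {σ : Fin k × Fin M} {x : Fin n}
    (h : Legal G (capDist G) a b v σ x) :
    totalDist G b v = totalDist G b (Function.update v σ x) + 1 := by
  simp only [totalDist]
  rw [← Finset.add_sum_erase _ _ (Finset.mem_univ σ),
    ← Finset.add_sum_erase _ (fun τ => capDist G (Function.update v σ x τ) (b τ))
      (Finset.mem_univ σ), Function.update_self, ← h.2.1,
    Finset.sum_congr rfl fun τ hτ => by
      rw [← Function.update_of_ne (Finset.ne_of_mem_erase hτ) x v]]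
  omega

theorem holds_moveE (hμ : ∀ c < n * n + 2 * k, μ c = (inputState G s t).mem c)
    (hdist : IsDistTable G k μ) (ha : ∀ τ, ρ (src τ) = a τ) (hb : ∀ τ, ρ (dst τ) = b τ)
    (hv : ∀ τ, ρ (pos τ) = v τ) {w : Fin n} (hw : ρ (aux 0) = w) (σ : Fin k × Fin M) :
    (moveE σ).Holds n μ ρ ↔
      Legal G (capDist G) a b (Function.update v σ w) σ (v σ) := by
  rw [moveE, holds_and, holds_and, holds_or, holds_adjE hμ hw (hv σ), holds_eq, holds_eqE,
    eval_distE hdist hw (hb σ) (by simp) (by simp), holds_all]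
  simp only [Expr.eval]
  rw [eval_distE hdist (hv σ) (hb σ) (by simp) (by simp), hv, hb, Legal, Function.update_self]
  refine and_congr_right fun _ => and_congr_right fun _ =>
    or_congr (by rw [Fin.ext_iff]) ?_
  simp only [List.mem_map, forall_exists_index, and_imp, forall_apply_eq_imp_iff₂]
  refine ⟨fun h τ => ?_, fun h τ _ => ?_⟩
  · have h1 := h τ (mem_tokens τ)
    rw [clearE, holds_and, holds_and, holds_not, holds_not, holds_eqE, holds_eqE, hv, ha, hb] at h1
    refine ⟨fun h2 => h1.1 (by rw [h2]), fun h2 => h1.2.1 (by rw [h2]), fun hne hbet => ?_⟩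
    have h3 := h1.2.2
    rw [if_neg hne, holds_not, holds_eq] at h3
    simp only [Expr.eval] at h3
    rw [eval_distE hdist (ha τ) (hv σ) (by simp) (by simp),
      eval_distE hdist (hv σ) (hv τ) (by simp) (by simp),
      eval_distE hdist (ha τ) (hv τ) (by simp) (by simp)] at h3
    rw [Function.update_of_ne hne] at hbet
    exact h3 hbet
  · obtain ⟨h1, h2, h3⟩ := h τ
    rw [clearE, holds_and, holds_and, holds_not, holds_not, holds_eqE, holds_eqE, hv, ha, hb]
    refine ⟨fun h4 => h1 (Fin.ext h4), fun h4 => h2 (Fin.ext h4), ?_⟩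
    split_ifs with hne
    · exact one_ne_zero
    · rw [holds_not, holds_eq]
      simp only [Expr.eval]
      rw [eval_distE hdist (ha τ) (hv σ) (by simp) (by simp),
        eval_distE hdist (hv σ) (hv τ) (by simp) (by simp),
        eval_distE hdist (ha τ) (hv τ) (by simp) (by simp)]
      have := h3 hne
      rwa [Function.update_of_ne hne] at this

theorem holds_beforeE (ha : ∀ τ, ρ (src τ) = a τ) (hb : ∀ τ, ρ (dst τ) = b τ)
    (hv : ∀ τ, ρ (pos τ) = v τ) {w : Fin n} (hw : ρ (aux 0) = w) (σ : Fin k × Fin M) :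
    (beforeE σ).Holds n μ ρ ↔ μ (n * n + 2 * k + n ^ 3 + tupleIdx n
      (encode (fun τ => (a τ : ℕ)) (fun τ => (b τ : ℕ))
        fun τ => (Function.update v σ w τ : ℕ))) ≠ 0 := by
  rw [beforeE, holds_entry, eval_configBase]
  have h1 : ∀ τ, (if τ = σ then Expr.var (aux 0) else Expr.var (pos τ) :
      Expr (Name k M)).eval n μ ρ = (Function.update v σ w τ : ℕ) := by
    intro τ
    rcases eq_or_ne τ σ with rfl | hτ
    · rw [if_pos rfl, Function.update_self]
      exact hw
    · rw [if_neg hτ, Function.update_of_ne hτ]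
      exact hv τ
  simp only [List.map_append, List.map_map, Function.comp_def, h1]
  simp only [Expr.eval, ha, hb, encode]

/-- The table of configurations in the memory is correct. -/
def IsConfigTable (G : SimpleGraph (Fin n)) (k M : ℕ) (μ : ℕ → ℕ) : Prop :=
  ∀ a b : Fin k × Fin M → Fin n, μ (n * n + 2 * k + n ^ 3 + tupleIdx n
    (encode (fun τ => (a τ : ℕ)) (fun τ => (b τ : ℕ)) fun τ => (b τ : ℕ))) ≠ 0 ↔
      Reach G (capDist G) a b b

/-- The number of moves is below the number of rounds of `fillConfig`. For `n = 1` no move is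
possible, and for `n ≥ 2` one uses `k * M < 2 ^ (k * M)`. -/
theorem totalDist_lt (hn0 : 0 < n) (G : SimpleGraph (Fin n)) (a b : Fin k × Fin M → Fin n) :
    totalDist G b a < n ^ (k * M + 1) := by
  rcases Nat.lt_or_ge n 2 with hn | hn
  · have h0 : totalDist G b a = 0 := Finset.sum_eq_zero fun σ _ => by
      have : a σ = b σ := Fin.ext (by have := (a σ).isLt; have := (b σ).isLt; omega)
      rw [this, (isNatMetric_capDist G).self]
    rw [h0]
    exact Nat.pow_pos hn0
  · calc totalDist G b a ≤ ∑ _σ : Fin k × Fin M, n := Finset.sum_le_sum fun σ _ => capDist_le G _ _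
      _ = (k * M) * n := by simp
      _ < 2 ^ (k * M) * n := Nat.mul_lt_mul_of_pos_right Nat.lt_two_pow_self (by omega)
      _ ≤ n ^ (k * M) * n := Nat.mul_le_mul_right _ (Nat.pow_le_pow_left hn _)
      _ = _ := (pow_succ _ _).symm

theorem run_fillConfig (hn0 : 0 < n) (hμ : ∀ c < n * n + 2 * k, μ c = (inputState G s t).mem c)
    (hdist : IsDistTable G k μ) (hzero : ∀ c, n * n + 2 * k + n ^ 3 ≤ c → μ c = 0)
    (ρ : Name k M → ℕ) :
    (∀ c, c < n * n + 2 * k + n ^ 3 → (fillConfig : Stmt (Name k M)).run n ρ μ c = μ c) ∧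
      IsConfigTable G k M ((fillConfig : Stmt (Name k M)).run n ρ μ) := by
  have hD := isNatMetric_capDist G
  have hinput : ∀ μ' : ℕ → ℕ, (∀ c < n * n + 2 * k + n ^ 3, μ' c = μ c) →
      ∀ c < n * n + 2 * k, μ' c = (inputState G s t).mem c := fun μ' h c hc => by
    rw [h c (by omega), hμ c hc]
  have hdist' : ∀ μ' : ℕ → ℕ, (∀ c < n * n + 2 * k + n ^ 3, μ' c = μ c) →
      IsDistTable G k μ' := fun μ' h u v d hd => by
    have h1 : tupleIdx n [(u : ℕ), (v : ℕ), d] < n ^ 3 := tupleIdx_lt (by simp [hd])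
    rw [h _ (by omega), hdist u v d hd]
  have henv : ∀ (ρ : Name k M → ℕ) (a b v : Fin k × Fin M → Fin n),
      (∀ τ, ρ (src τ) = a τ) → (∀ τ, ρ (dst τ) = b τ) → (∀ τ, ρ (pos τ) = v τ) →
      ∀ w, (∀ τ, Function.update ρ (aux 0) w (src τ) = a τ) ∧
        (∀ τ, Function.update ρ (aux 0) w (dst τ) = b τ) ∧
        (∀ τ, Function.update ρ (aux 0) w (pos τ) = v τ) ∧
        Function.update ρ (aux 0) w (aux 0) = w :=
    fun ρ a b v ha hb hv w => ⟨fun τ => by rw [Function.update_of_ne (by simp), ha],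
      fun τ => by rw [Function.update_of_ne (by simp), hb],
      fun τ => by rw [Function.update_of_ne (by simp), hv], Function.update_self ..⟩
  have h := run_fillTable (n := n) (base := configBase k M) (φ := configRule)
    (xs := configVars k M) (ys := List.replicate (k * M + 1) (aux 0)) nodup_configVars
    (B := n * n + 2 * k + n ^ 3) (fun _ _ => eval_configBase) hzero
    (R := fun l => ∃ a b v : Fin k × Fin M → Fin n,
      l = encode (fun τ => (a τ : ℕ)) (fun τ => (b τ : ℕ)) (fun τ => (v τ : ℕ)) ∧
        Reach G (capDist G) a b v)
    -- Rank `r` means fewer than `r` moves, expressed through the loss of total distance. The start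
    -- has rank `1`.
    (rank := fun r l => ∃ a b v : Fin k × Fin M → Fin n,
      l = encode (fun τ => (a τ : ℕ)) (fun τ => (b τ : ℕ)) (fun τ => (v τ : ℕ)) ∧
        Reach G (capDist G) a b v ∧ totalDist G b a < totalDist G b v + r) ?_ ?_ ?_ ρ
  · refine ⟨fun c hc => h.1 c (Or.inl hc), fun a b => ?_⟩
    obtain ⟨h1, h2⟩ := h.2 _ (isTuple_encode (f := a) (g := b) (h := b))
    refine ⟨fun hne => ?_, fun hreach => h1 ⟨a, b, b, rfl, hreach, ?_⟩⟩
    · obtain ⟨a', b', v', heq, hreach⟩ := h2 hne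
      obtain ⟨e1, e2, e3⟩ := encode_inj heq
      have e1 : a = a' := funext fun τ => Fin.ext (congrFun e1 τ)
      have e2 : b = b' := funext fun τ => Fin.ext (congrFun e2 τ)
      have e3 : b = v' := funext fun τ => Fin.ext (congrFun e3 τ)
      rwa [← e1, ← e2, ← e3] at hreach
    · have := totalDist_lt hn0 G a b
      rw [List.length_replicate]
      omega
  · intro μ' ρ hμ' hT hρ hφ
    have hlt : ∀ τ, ρ (src τ) < n ∧ ρ (dst τ) < n ∧ ρ (pos τ) < n := fun τ =>
      ⟨hρ _ (by simp [configVars, mem_tokens]), hρ _ (by simp [configVars, mem_tokens]),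
        hρ _ (by simp [configVars, mem_tokens])⟩
    obtain ⟨a, ha⟩ : ∃ a : Fin k × Fin M → Fin n, ∀ τ, ρ (src τ) = a τ :=
      ⟨fun τ => ⟨_, (hlt τ).1⟩, fun _ => rfl⟩
    obtain ⟨b, hb⟩ : ∃ b : Fin k × Fin M → Fin n, ∀ τ, ρ (dst τ) = b τ :=
      ⟨fun τ => ⟨_, (hlt τ).2.1⟩, fun _ => rfl⟩
    obtain ⟨v, hv⟩ : ∃ v : Fin k × Fin M → Fin n, ∀ τ, ρ (pos τ) = v τ :=
      ⟨fun τ => ⟨_, (hlt τ).2.2⟩, fun _ => rfl⟩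
    refine ⟨a, b, v, by simp only [map_configVars, ha, hb, hv], ?_⟩
    rw [configRule, holds_or, holds_all, holds_any] at hφ
    rcases hφ with hφ | ⟨e, he, hφ⟩
    · have : v = a := funext fun σ => Fin.ext (by
        have := hφ _ (List.mem_map_of_mem (mem_tokens σ))
        rwa [holds_eqE, hv, ha] at this)
      rw [this]
      exact .start
    · obtain ⟨σ, -, rfl⟩ := List.mem_map.1 he
      obtain ⟨w, hw, hφ⟩ := holds_sum.1 hφ
      obtain ⟨e1, e2, e3, e4⟩ := henv ρ a b v ha hb hv w
      rw [holds_and, holds_beforeE e1 e2 e3 (w := ⟨w, hw⟩) e4,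
        holds_moveE (hinput μ' hμ') (hdist' μ' hμ') e1 e2 e3 (w := ⟨w, hw⟩) e4] at hφ
      obtain ⟨a', b', v', heq, hreach⟩ := hT _ isTuple_encode hφ.1
      obtain ⟨f1, f2, f3⟩ := encode_inj heq
      have f1 : a = a' := funext fun τ => Fin.ext (congrFun f1 τ)
      have f2 : b = b' := funext fun τ => Fin.ext (congrFun f2 τ)
      have f3 : Function.update v σ ⟨w, hw⟩ = v' := funext fun τ => Fin.ext (congrFun f3 τ)
      rw [← f1, ← f2, ← f3] at hreach
      have := hreach.step σ _ hφ.2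
      rwa [Function.update_idem, Function.update_eq_self] at this
  · rintro r μ' ρ hμ' hT hρ ⟨a, b, v, heq, hreach, hr⟩
    rw [map_configVars] at heq
    obtain ⟨ha, hb, hv⟩ := encode_inj heq
    replace ha : ∀ τ, ρ (src τ) = a τ := congrFun ha
    replace hb : ∀ τ, ρ (dst τ) = b τ := congrFun hb
    replace hv : ∀ τ, ρ (pos τ) = v τ := congrFun hv
    rw [configRule, holds_or, holds_all, holds_any]
    cases hreach with
    | start =>
      left
      intro e he
      obtain ⟨σ, -, rfl⟩ := List.mem_map.1 he
      rw [holds_eqE, hv, ha]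
    | @step v₀ σ x hreach hlegal =>
      right
      refine ⟨_, List.mem_map_of_mem (mem_tokens σ), ?_⟩
      have hlegal' := hlegal.totalDist_eq
      obtain ⟨e1, e2, e3, e4⟩ := henv ρ a b _ ha hb hv (v₀ σ)
      have hback : Function.update (Function.update v₀ σ x) σ (v₀ σ) = v₀ := by
        rw [Function.update_idem, Function.update_eq_self]
      refine holds_sum.2 ⟨v₀ σ, (v₀ σ).isLt, ?_⟩
      rw [holds_and, holds_beforeE e1 e2 e3 e4,
        holds_moveE (hinput μ' hμ') (hdist' μ' hμ') e1 e2 e3 e4, hback, Function.update_self]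
      exact ⟨hT _ isTuple_encode ⟨a, b, v₀, rfl, hreach, by omega⟩, hlegal⟩
  · rintro l ⟨a, b, v, -, hreach, h⟩
    have : totalDist G b v ≤ totalDist G b a := by
      clear h
      induction hreach with
      | start => exact le_rfl
      | @step v₀ σ x _ hlegal ih =>
        have h1 := hlegal.totalDist_eq
        omega
    omega

end configurations

end DisjointShortestPaths

namespace DisjointShortestPaths

open RAM Name

/-! ### The final answer and the whole program -/

section answer

variable {n k M : ℕ} {G : SimpleGraph (Fin n)} {s t : Fin k → Fin n} {μ : ℕ → ℕ}
  {ρ : Name k M → ℕ}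

theorem mem_markIndices (q : Fin k × Fin (M + 1)) : q ∈ markIndices k M := by simp [markIndices]

theorem holds_all_map {α β : Type} [DecidableEq α] {ρ : α → ℕ} {l : List β} {f : β → Expr α} :
    (Expr.all (l.map f)).Holds n μ ρ ↔ ∀ x ∈ l, (f x).Holds n μ ρ := by
  simp

theorem holds_marksE (hμ : ∀ c < n * n + 2 * k, μ c = (inputState G s t).mem c)
    (hdist : IsDistTable G k μ) {m : Fin k → Fin (M + 1) → Fin n} {a b : Fin k × Fin M → Fin n}
    (hm : ∀ i r, ρ (mark i r) = m i r) (ha : ∀ τ, ρ (src τ) = a τ) (hb : ∀ τ, ρ (dst τ) = b τ) :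
    (marksE : Expr (Name k M)).Holds n μ ρ ↔
      (∀ i, m i 0 = s i ∧ m i (Fin.last M) = t i) ∧
      (∀ i r, capDist G (m i 0) (m i (Fin.succ r)) = capDist G (m i 0) (m i (Fin.castSucc r)) +
        capDist G (m i (Fin.castSucc r)) (m i (Fin.succ r))) ∧
      (∀ i r, (a (i, r) = m i (Fin.castSucc r) ∧ b (i, r) = m i (Fin.succ r)) ∨
        (a (i, r) = m i (Fin.succ r) ∧ b (i, r) = m i (Fin.castSucc r))) ∧
      (∀ i j, i ≠ j → ∀ r r', m i r = m j r' → m i r = m i 0 ∨ m i r = m i (Fin.last M)) := by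
  have hleft : ∀ i : Fin k, (terminalE i : Expr (Name k M)).eval n μ ρ = s i := fun i => by
    simp only [terminalE, Expr.eval]
    rw [hμ _ (by omega), inputState_left]
  have hright : ∀ i : Fin k, (terminalE (k + i) : Expr (Name k M)).eval n μ ρ = t i := fun i => by
    simp only [terminalE, Expr.eval]
    rw [hμ _ (by omega), inputState_right]
  have hdistE : ∀ i r r', (distE (mark i r) (mark i r') : Expr (Name k M)).eval n μ ρ =
      capDist G (m i r) (m i r') := fun i r r' =>
    eval_distE hdist (hm i r) (hm i r') (by simp) (by simp)
  rw [marksE, holds_and, holds_and, holds_and]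
  simp only [holds_all_map, mem_markIndices, mem_tokens, true_imp_iff, holds_and, holds_or,
    holds_eq, holds_eqE, hm, ha, hb, hleft, hright, Expr.eval, hdistE, Prod.forall, ← Fin.ext_iff]
  refine and_congr ?_ (and_congr_right fun _ => and_congr_right fun _ => ?_)
  · exact ⟨fun h i => h i 0, fun h i _ => h i⟩
  · refine ⟨fun h i j hij r r' heq => ?_, fun h i r j r' => ?_⟩
    · have := h i r j r'
      rw [if_neg hij] at this
      simpa [holds_eqE, hm, heq, ← Fin.ext_iff] using this
    · split_ifs with hij
      · exact one_ne_zero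
      · simp only [holds_or, holds_not, holds_eqE, hm, ← Fin.ext_iff]
        exact or_iff_not_imp_left.2 fun h' => h i j hij r r' (not_not.1 h')

theorem holds_finalE (htable : IsConfigTable G k M μ) {a b : Fin k × Fin M → Fin n}
    (ha : ∀ τ, ρ (src τ) = a τ) (hb : ∀ τ, ρ (dst τ) = b τ) :
    (finalE : Expr (Name k M)).Holds n μ ρ ↔ Reach G (capDist G) a b b := by
  rw [← htable a b, finalE, holds_entry, eval_configBase]
  simp only [List.map_append, List.map_map, Function.comp_def, Expr.eval, ha, hb, encode]

open Classical in
theorem eval_answerE (hμ : ∀ c < n * n + 2 * k, μ c = (inputState G s t).mem c)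
    (hdist : IsDistTable G k μ) (htable : IsConfigTable G k M μ) :
    (answerE k M).eval n μ ρ = if Accepts G (capDist G) M s t then 1 else 0 := by
  have hle : (answerE k M).eval n μ ρ ≤ 1 := Nat.sub_le _ _
  have hiff : (answerE k M).Holds n μ ρ ↔ Accepts G (capDist G) M s t := by
    rw [answerE, holds_not, holds_not, not_not, holds_ex]
    constructor
    · rintro ⟨ρ', h1, -, h3⟩
      obtain ⟨m, hm⟩ : ∃ m : Fin k → Fin (M + 1) → Fin n, ∀ i r, ρ' (mark i r) = m i r :=
        ⟨fun i r => ⟨ρ' (mark i r), h1 _ (by simp [mem_markIndices])⟩, fun _ _ => rfl⟩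
      obtain ⟨a, ha⟩ : ∃ a : Fin k × Fin M → Fin n, ∀ τ, ρ' (src τ) = a τ :=
        ⟨fun τ => ⟨ρ' (src τ), h1 _ (by simp [mem_tokens])⟩, fun _ => rfl⟩
      obtain ⟨b, hb⟩ : ∃ b : Fin k × Fin M → Fin n, ∀ τ, ρ' (dst τ) = b τ :=
        ⟨fun τ => ⟨ρ' (dst τ), h1 _ (by simp [mem_tokens])⟩, fun _ => rfl⟩
      rw [holds_and, holds_marksE hμ hdist hm ha hb, holds_finalE htable ha hb] at h3
      obtain ⟨⟨e1, e2, e3, e4⟩, e5⟩ := h3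
      refine ⟨m, a, b, e1, fun i r => ?_, e3, fun i j hij r r' heq => ?_, e5⟩
      · rw [← (e1 i).1]
        exact e2 i r
      · rw [← (e1 i).1, ← (e1 i).2]
        exact e4 i j hij r r' heq
    · rintro ⟨m, a, b, e1, e2, e3, e4, e5⟩
      obtain ⟨ρ', hm, ha, hb, hρ'⟩ : ∃ ρ' : Name k M → ℕ, (∀ i r, ρ' (mark i r) = m i r) ∧
          (∀ τ, ρ' (src τ) = a τ) ∧ (∀ τ, ρ' (dst τ) = b τ) ∧
          ∀ x, (∀ i r, x ≠ mark i r) → (∀ τ, x ≠ src τ) → (∀ τ, x ≠ dst τ) → ρ' x = ρ x := by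
        refine ⟨fun x => match x with
          | .inl (i, r) => m i r
          | .inr (.inl (τ, 0)) => a τ
          | .inr (.inl (τ, 1)) => b τ
          | x => ρ x, fun _ _ => rfl, fun _ => rfl, fun _ => rfl, ?_⟩
        rintro (⟨i, r⟩ | ⟨τ, j⟩ | j) h1 h2 h3
        · exact absurd rfl (h1 i r)
        · fin_cases j
          · exact absurd rfl (h2 τ)
          · exact absurd rfl (h3 τ)
          · rfl
        · rfl
      refine ⟨ρ', fun x hx => ?_, fun x hx => ?_, ?_⟩
      · simp only [List.mem_append, List.mem_map] at hx
        rcases hx with ⟨q, -, rfl⟩ | ⟨τ, -, rfl⟩ | ⟨τ, -, rfl⟩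
        · exact (hm _ _).trans_lt (Fin.isLt _)
        · exact (ha _).trans_lt (Fin.isLt _)
        · exact (hb _).trans_lt (Fin.isLt _)
      · simp only [List.mem_append, List.mem_map, mem_markIndices, mem_tokens, true_and, not_or,
          not_exists] at hx
        exact hρ' x (fun i r h => hx.1 (i, r) h.symm) (fun τ h => hx.2.1 τ h.symm)
          fun τ h => hx.2.2 τ h.symm
      · rw [holds_and, holds_marksE hμ hdist hm ha hb, holds_finalE htable ha hb]
        refine ⟨⟨e1, fun i r => ?_, e3, fun i j hij r r' heq => ?_⟩, e5⟩
        · rw [(e1 i).1]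
          exact e2 i r
        · rw [(e1 i).1, (e1 i).2]
          exact e4 i j hij r r' heq
  unfold Expr.Holds at hiff
  split_ifs with h
  · have := hiff.2 h
    omega
  · by_contra hcon
    exact h (hiff.1 hcon)

/-- The program decides whether the tokens can be moved to their ends. -/
theorem exists_exec_decider (hn0 : 0 < n) (M : ℕ) (G : SimpleGraph (Fin n))
    (s t : Fin k → Fin n) :
    ∃ T ≤ (max n 2) ^ ((fillDist : Stmt (Name k M)).weight +
        (fillConfig : Stmt (Name k M)).weight + (answerE k M).weight + 24),
      ∃ τ, Exec (decider k M) (inputState G s t) T τ ∧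
        (Accepts G (capDist G) M s t → τ.reg 0 = 1) ∧
        (¬ Accepts G (capDist G) M s t → τ.reg 0 = 0) := by
  classical
  have hX : 2 ≤ max n 2 := le_max_right _ _
  obtain ⟨T, hT, σ, hex, hmem, hfr⟩ := (Stmt.seq fillDist fillConfig :
    Stmt (Name k M)).exists_exec n 0 (inputState G s t) rfl
  obtain ⟨U, hU, τ, hex', hmem', hfr', hval⟩ := (answerE k M).exists_exec n 0 σ
    (by rw [hfr 0 (by omega)]; rfl)
  obtain ⟨h1, h2⟩ := run_fillDist (G := G) (s := s) (t := t) (M := M) (env (inputState G s t))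
  obtain ⟨h3, h4⟩ := run_fillConfig (M := M) hn0 (fun c hc => h1 c (Or.inl hc)) h2
    (fun c hc => by rw [h1 c (Or.inr hc), inputState_zero G s t (by omega)])
    (env (inputState G s t))
  have h5 : ∀ c < n * n + 2 * k, σ.mem c = (inputState G s t).mem c := fun c hc => by
    rw [hmem]
    exact (h3 c (by omega)).trans (h1 c (Or.inl hc))
  have h6 : IsDistTable G k σ.mem := fun u v d hd => by
    have h7 : tupleIdx n [(u : ℕ), (v : ℕ), d] < n ^ 3 := tupleIdx_lt (by simp [hd])
    rw [hmem, ← h2 u v d hd]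
    exact not_congr (by rw [← h3 _ (by omega)]; rfl)
  rw [eval_answerE h5 h6 (by rw [hmem]; exact h4)] at hval
  have e1 := Exec.const τ 0 0
  have e2 := Exec.add (τ.setReg 0 0) 0 0 (tmpReg 0)
  rw [setReg_reg_self, setReg_reg_of_ne _ _ (by simp [tmpReg]), hval, zero_add] at e2
  refine ⟨T + (U + (1 + 1)), ?_, _, .seq hex (.seq hex' (.seq e1 e2)), fun h => ?_, fun h => ?_⟩
  · have h7 := seq_cost_le hX hT hU
    have h8 := seq_cost_le hX h7 (Nat.one_le_pow 0 _ (by omega))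
    simp only [Stmt.weight] at h8
    refine le_trans (by omega) (h8.trans (Nat.pow_le_pow_right (by omega) (by omega)))
  · rw [setReg_reg_self, if_pos h]
  · rw [setReg_reg_self, if_neg h]

end answer

end DisjointShortestPaths

namespace DisjointShortestPaths

open RAM Name

/-! ### The size of the program -/

section weight

/-- A conjunction is three negations and a disjunction, with overhead `3 * 16 + 8 = 56`. -/
theorem weight_all_le {α β : Type} {l : List β} {f : β → Expr α} {w : ℕ}
    (h : ∀ x ∈ l, (f x).weight ≤ w) :
    (Expr.all (l.map f)).weight ≤ l.length * (w + 56) + 8 := by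
  induction l with
  | nil => simp [Expr.all, Expr.weight]
  | cons x l ih =>
    have h1 := ih fun y hy => h y (by simp [hy])
    have h2 := h x (by simp)
    simp only [Expr.all, List.map_cons, List.foldr_cons, Expr.and, Expr.or, Expr.not, Expr.weight,
      List.length_cons, add_mul] at h1 ⊢
    omega

theorem weight_any_le {α β : Type} {l : List β} {f : β → Expr α} {w : ℕ}
    (h : ∀ x ∈ l, (f x).weight ≤ w) :
    (Expr.any (l.map f)).weight ≤ l.length * (w + 8) + 8 := by
  induction l with
  | nil => simp [Expr.any, Expr.weight]
  | cons x l ih =>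
    have h1 := ih fun y hy => h y (by simp [hy])
    have h2 := h x (by simp)
    simp only [Expr.any, List.map_cons, List.foldr_cons, Expr.or, Expr.weight,
      List.length_cons, add_mul] at h1 ⊢
    omega

theorem weight_idx_le {α : Type} {l : List (Expr α)} (h : ∀ e ∈ l, e.weight ≤ 8) :
    (Expr.idx l).weight ≤ l.length * 24 + 8 := by
  induction l with
  | nil => simp [Expr.idx, Expr.weight]
  | cons e l ih =>
    have h1 := ih fun y hy => h y (by simp [hy])
    have h2 := h e (by simp)
    simp only [Expr.idx, Expr.weight, List.length_cons]
    omega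

theorem weight_ex {α : Type} (xs : List α) (e : Expr α) :
    (Expr.ex xs e).weight = e.weight + 8 * xs.length := by
  induction xs with
  | nil => rfl
  | cons x xs ih =>
    rw [show Expr.ex (x :: xs) e = .sum x (Expr.ex xs e) from rfl, Expr.weight, ih,
      List.length_cons]
    ring

theorem weight_loops {α : Type} (xs : List α) (s : Stmt α) :
    (Stmt.loops xs s).weight = s.weight + 8 * xs.length := by
  induction xs with
  | nil => rfl
  | cons x xs ih =>
    rw [show Stmt.loops (x :: xs) s = .loop x (Stmt.loops xs s) from rfl, Stmt.weight, ih,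
      List.length_cons]
    ring

variable {k M : ℕ}

theorem length_markIndices : (markIndices k M).length = k * (M + 1) := by simp [markIndices]

theorem weight_eqE (p q : Name k M) : (eqE p q).weight = 72 := rfl

theorem weight_distE (p q : Name k M) : (distE p q).weight = 152 := by
  simp [distE, distLeE, Expr.not, Expr.weight, Expr.entry, Expr.idx, distBase]

theorem weight_fillDist_le : (fillDist : Stmt (Name k M)).weight ≤ 2000 := by
  simp [fillDist, Stmt.fillTable, weight_loops, Stmt.weight, Expr.weight, Expr.entry, Expr.idx,
    distRule, distBase, Expr.or, Expr.and, Expr.not, adjE, weight_eqE]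

theorem weight_clearE_le (σ τ : Fin k × Fin M) : (clearE σ τ).weight ≤ 1300 := by
  unfold clearE
  split_ifs <;> simp [Expr.and, Expr.or, Expr.not, Expr.eq, Expr.weight, weight_eqE, weight_distE]

theorem weight_moveE_le (σ : Fin k × Fin M) : (moveE σ).weight ≤ k * M * 1356 + 1100 := by
  have h := weight_all_le (l := tokens k M) fun τ _ => weight_clearE_le σ τ
  rw [length_tokens] at h
  simp only [moveE, Expr.and, Expr.or, Expr.not, Expr.eq, Expr.weight, adjE, weight_eqE,
    weight_distE]
  omega

theorem weight_configEntry_le {f g h : Fin k × Fin M → Expr (Name k M)}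
    (hf : ∀ τ, (f τ).weight = 8) (hg : ∀ τ, (g τ).weight = 8) (hh : ∀ τ, (h τ).weight = 8) :
    (Expr.entry (configBase k M) ((tokens k M).map f ++
      ((tokens k M).map g ++ (tokens k M).map h))).weight ≤ k * M * 72 + 100 := by
  have h1 := weight_idx_le (l := (tokens k M).map f ++ ((tokens k M).map g ++
    (tokens k M).map h)) (fun e he => by
      simp only [List.mem_append, List.mem_map] at he
      rcases he with ⟨τ, -, rfl⟩ | ⟨τ, -, rfl⟩ | ⟨τ, -, rfl⟩
      · exact (hf τ).le
      · exact (hg τ).le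
      · exact (hh τ).le)
  simp only [List.length_append, List.length_map, length_tokens] at h1
  simp only [Expr.entry, Expr.weight, configBase, distBase]
  omega

/-- The rule ranges over pairs of tokens, one moving and one to be avoided, whence the square. -/
theorem weight_fillConfig_le :
    (fillConfig : Stmt (Name k M)).weight ≤ 4000 * (k * M + 1) ^ 2 := by
  have h1 := weight_any_le (l := tokens k M) (f := fun σ => .sum (aux 0) ((beforeE σ).and (moveE σ)))
    (w := k * M * 1428 + 1300) fun σ _ => by
      have h2 := weight_moveE_le σ
      have h3 : (beforeE σ).weight ≤ k * M * 72 + 100 :=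
        weight_configEntry_le (fun _ => rfl) (fun _ => rfl) fun τ => by split_ifs <;> rfl
      simp only [Expr.weight, Expr.and, Expr.or, Expr.not]
      omega
  have h4 := weight_all_le (l := tokens k M) (f := fun σ => eqE (pos σ) (src σ)) fun σ _ =>
    (weight_eqE _ _).le
  have h5 : (Expr.entry (configBase k M) ((configVars k M).map .var)).weight ≤
      k * M * 72 + 100 := by
    simp only [configVars, List.map_append, List.map_map]
    exact weight_configEntry_le (fun _ => rfl) (fun _ => rfl) fun _ => rfl
  have h6 : (configVars k M).length = k * M + (k * M + k * M) := by
    simp only [configVars, List.length_append, List.length_map, length_tokens]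
  rw [length_tokens] at h1 h4
  simp only [Expr.entry, Expr.weight] at h5
  simp only [fillConfig, Stmt.fillTable, weight_loops, Stmt.weight, Expr.weight, Expr.entry,
    Expr.or, configRule, List.length_replicate, h6]
  nlinarith

theorem weight_marksE_le :
    (marksE : Expr (Name k M)).weight ≤ 4000 * (k * (M + 1) + 1) ^ 2 := by
  have h1 := weight_all_le (l := markIndices k M) (w := 400) (f := fun q => Expr.and
      (.eq (.var (mark q.1 0)) (terminalE q.1))
      (.eq (.var (mark q.1 (Fin.last M))) (terminalE (k + q.1)))) fun q _ => by
    simp [Expr.and, Expr.or, Expr.not, Expr.eq, Expr.weight, terminalE]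
  have h2 := weight_all_le (l := tokens k M) (w := 1000)
    (f := fun σ => .eq (distE (mark σ.1 0) (mark σ.1 (Fin.succ σ.2)))
      (.add (distE (mark σ.1 0) (mark σ.1 (Fin.castSucc σ.2)))
        (distE (mark σ.1 (Fin.castSucc σ.2)) (mark σ.1 (Fin.succ σ.2))))) fun σ _ => by
    simp [Expr.not, Expr.eq, Expr.weight, weight_distE]
  have h3 := weight_all_le (l := tokens k M) (w := 500) (f := fun σ => Expr.or
      (Expr.and (eqE (src σ) (mark σ.1 (Fin.castSucc σ.2)))
        (eqE (dst σ) (mark σ.1 (Fin.succ σ.2))))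
      (Expr.and (eqE (src σ) (mark σ.1 (Fin.succ σ.2)))
        (eqE (dst σ) (mark σ.1 (Fin.castSucc σ.2))))) fun σ _ => by
    simp [Expr.and, Expr.or, Expr.not, Expr.weight, weight_eqE]
  have h4 := weight_all_le (l := markIndices k M) (w := k * (M + 1) * 356 + 8)
    (f := fun q => .all ((markIndices k M).map fun q' =>
      if q.1 = q'.1 then .const 1 else (eqE (mark q.1 q.2) (mark q'.1 q'.2)).not.or
        ((eqE (mark q.1 q.2) (mark q.1 0)).or (eqE (mark q.1 q.2) (mark q.1 (Fin.last M))))))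
    fun q _ => by
      refine (weight_all_le (w := 300) fun q' _ => ?_).trans_eq (by rw [length_markIndices])
      split_ifs <;> simp [Expr.or, Expr.not, Expr.weight, weight_eqE]
  rw [length_markIndices] at h1 h4
  rw [length_tokens] at h2 h3
  simp only [Expr.and, Expr.or, Expr.not] at h1 h2 h3 h4
  simp only [marksE, Expr.and, Expr.or, Expr.not, Expr.weight]
  have h5 : k * M ≤ k * (M + 1) := Nat.mul_le_mul_left _ (Nat.le_succ M)
  nlinarith

theorem weight_answerE_le : (answerE k M).weight ≤ 5000 * (k * (M + 1) + 1) ^ 2 := by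
  have h1 := weight_marksE_le (k := k) (M := M)
  have h2 : (finalE : Expr (Name k M)).weight ≤ k * M * 72 + 100 :=
    weight_configEntry_le (fun _ => rfl) (fun _ => rfl) fun _ => rfl
  have h5 : k * M ≤ k * (M + 1) := Nat.mul_le_mul_left _ (Nat.le_succ M)
  simp only [answerE, Expr.not, Expr.and, Expr.or, Expr.weight, weight_ex, List.length_append,
    List.length_map, length_tokens, length_markIndices]
  have h6 : k * (M + 1) + 1 ≤ (k * (M + 1) + 1) ^ 2 := Nat.le_self_pow two_ne_zero _
  omega

end weight

theorem seven_mul_add_two_le {k : ℕ} (hk : 2 ≤ k) : 7 * k + 2 ≤ 5 ^ k := by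
  induction k, hk using Nat.le_induction with
  | base => norm_num
  | succ k hk ih =>
    rw [pow_succ]
    omega

/-- The left side is of order `(k * (5 * k) ^ k) ^ 2`. For `k ≥ 2` the bound `25 ≤ k ^ 5` turns this
into `k ^ (7 * k + 2)`. For `k = 1` the right side is only `4000`, and `(12 * 5) ^ 2 = 3600` just
fits. -/
theorem sq_markCount_le {k : ℕ} (hk : 1 ≤ k) :
    (k * (segCount k + 1) + 1) ^ 2 ≤ 4000 * k ^ 5 ^ k := by
  have h1 : (4 * k + 1) ^ k ≤ (5 * k) ^ k := Nat.pow_le_pow_left (by omega) k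
  have h2 : k ≤ (5 * k) ^ k :=
    (by omega : k ≤ 5 * k).trans (Nat.le_self_pow (by omega) _)
  have h3 : segCount k + 1 ≤ 11 * (5 * k) ^ k := by
    unfold segCount
    omega
  have h4 : k * (segCount k + 1) + 1 ≤ 12 * (k * (5 * k) ^ k) := by
    have h5 := Nat.mul_le_mul_left k h3
    have h6 : 1 ≤ k * (5 * k) ^ k := Nat.mul_pos hk (Nat.pow_pos (by omega))
    rw [mul_left_comm] at h5
    omega
  rcases hk.eq_or_lt with rfl | hk2
  · exact (Nat.pow_le_pow_left h4 2).trans (by norm_num)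
  · have h7 : 25 ^ k ≤ k ^ (5 * k) := by
      rw [pow_mul]
      exact Nat.pow_le_pow_left (le_trans (by norm_num) (Nat.pow_le_pow_left hk2 5)) k
    calc (k * (segCount k + 1) + 1) ^ 2 ≤ (12 * (k * (5 * k) ^ k)) ^ 2 := Nat.pow_le_pow_left h4 2
      _ = 144 * (k ^ (2 * k + 2) * (5 ^ 2) ^ k) := by
        rw [← pow_mul, mul_comm 2 k, pow_mul 5 k 2]
        ring
      _ ≤ 4000 * (k ^ (2 * k + 2) * k ^ (5 * k)) := by
        exact Nat.mul_le_mul (by norm_num) (Nat.mul_le_mul_left _ h7)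
      _ = 4000 * k ^ (7 * k + 2) := by
        rw [← pow_add]
        congr 2
        ring
      _ ≤ 4000 * k ^ 5 ^ k := by
        exact Nat.mul_le_mul_left _ (Nat.pow_le_pow_right hk (seven_mul_add_two_le hk2))

end DisjointShortestPaths

theorem theorem1 :
    ∃ c C : ℕ, ∀ k : ℕ, ∃ p : RAM.Prog,
      ∀ (n : ℕ) (G : SimpleGraph (Fin n)) (s t : Fin k → Fin n),
        ∃ (T : ℕ) (τ : RAM.State), RAM.Exec p (RAM.inputState G s t) T τ ∧
          T ≤ C * (max n 2) ^ (c * k ^ (5 ^ k)) ∧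
          (HasDisjointShortestPaths G s t → τ.reg 0 = 1) ∧
          (¬ HasDisjointShortestPaths G s t → τ.reg 0 = 0) := by
  -- The factor `12000` covers the weights `2000 + 4000 + 5000 + 24`, each times the square bounded
  -- in `sq_markCount_le`; `4000` is the constant there.
  refine ⟨12000 * 4000, 1, fun k => ?_⟩
  rcases Nat.eq_zero_or_pos k with rfl | hk
  -- For `k = 0` the exponent is `0` and only one step is allowed; the empty family is always a
  -- solution.
  · refine ⟨.const 0 1, fun n G s t => ⟨1, _, .const .., by simp, fun _ => DisjointShortestPaths.setReg_reg_self ..,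
      fun h => absurd ⟨fun i => i.elim0, fun i => i.elim0, fun i => i.elim0⟩ h⟩⟩
  · refine ⟨DisjointShortestPaths.decider k (DisjointShortestPaths.segCount k), fun n G s t => ?_⟩
    -- A terminal is a vertex, so `n` is positive.
    obtain ⟨T, hT, τ, hex, h1, h0⟩ := DisjointShortestPaths.exists_exec_decider (s ⟨0, hk⟩).pos
      (DisjointShortestPaths.segCount k) G s t
    have hD := DisjointShortestPaths.isNatMetric_capDist G
    have hdist : ∀ u v, G.Reachable u v → DisjointShortestPaths.capDist G u v = G.dist u v :=
      fun u v h => DisjointShortestPaths.capDist_of_reachable G h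
    refine ⟨T, τ, hex, ?_, fun h => h1 (DisjointShortestPaths.HasDisjointShortestPaths.accepts hD hdist h),
      fun h => h0 fun h' => h (h'.hasDisjointShortestPaths hD hdist)⟩
    rw [one_mul]
    refine hT.trans (Nat.pow_le_pow_right (by omega) ?_)
    have w1 := DisjointShortestPaths.weight_fillDist_le (k := k) (M := DisjointShortestPaths.segCount k)
    have w2 := DisjointShortestPaths.weight_fillConfig_le (k := k) (M := DisjointShortestPaths.segCount k)
    have w3 := DisjointShortestPaths.weight_answerE_le (k := k) (M := DisjointShortestPaths.segCount k)
    have w4 := DisjointShortestPaths.sq_markCount_le hk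
    have w5 : (k * DisjointShortestPaths.segCount k + 1) ^ 2 ≤ (k * (DisjointShortestPaths.segCount k + 1) + 1) ^ 2 :=
      Nat.pow_le_pow_left (by rw [mul_add]; omega) 2
    have w6 : 1 ≤ (k * (DisjointShortestPaths.segCount k + 1) + 1) ^ 2 := Nat.one_le_pow _ _ (by omega)
    rw [mul_assoc]
    omega
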